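/- Let $\mathbb{F}$ be an algebraically closed field of characteristic $0$ and let $\mathcal{L}$ be a finite-dimensional semisimple Lie algebra over $\mathbb{F}$, with a fixed Cartan subalgebra and a fixed system of simple roots. Let $\mathcal{L}=\bigoplus_{g\in G}\mathcal{L}_g$ be a grading by an abelian group $G$. Every character $\chi\in\widehat{G}=\mathrm{Hom}(G,\mathbb{F}^\times)$ acts on $\mathcal{L}$ by the automorphism $\alpha_\chi(x)=\chi(g)x$ for $x\in\mathcal{L}_g$. For a dominant integral weight $\lambda$, let $V_\lambda$ be the finite-dimensional simple $\mathcal{L}$-module of highest weight $\lambda$, let $K_\lambda$ be the group of all $\chi\in\widehat{G}$ such that $V_\lambda$ is isomorphic to its twist $V_\lambda^\chi$ (on which $x\in\mathcal{L}$ acts as $\alpha_\chi(x)$ does on $V_\lambda$), and let $H_\lambda=K_\lambda^\perp=\{g\in G : \chi(g)=1 \text{ for all } \chi\in K_\lambda\}$. For an abelian group $A$, the $A$-graded Brauer group of $\mathbb{F}$ consists of the isomorphism classes of finite-dimensional $A$-graded division algebras (i.e. graded algebras in which every nonzero homogeneous element is invertible) over $\mathbb{F}$ that are simple as ungraded algebras.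 The class $[\mathcal{R}]$ of an $A$-graded matrix algebra $\mathcal{R}$ over $\mathbb{F}$ is the isomorphism class of the graded division algebra $\mathcal{D}$ such that $\mathcal{R}\cong\mathrm{End}_{\mathcal{D}}(W)$ as a graded algebra for a nonzero finite-dimensional graded right $\mathcal{D}$-module $W$, and the product is $[\mathcal{R}_1][\mathcal{R}_2]=[\mathcal{R}_1\otimes\mathcal{R}_2]$. A homomorphism $A\to A'$ induces a map from the $A$-graded to the $A'$-graded Brauer group, by regarding $A$-graded algebras as $A'$-graded algebras. The Brauer invariant $\mathrm{Br}(\lambda)$ is the class of $\mathrm{End}(V_\lambda)$ in the $(G/H_\lambda)$-graded Brauer group, where $\mathrm{End}(V_\lambda)$ has the unique $(G/H_\lambda)$-grading for which the representation $U(\mathcal{L})\to\mathrm{End}(V_\lambda)$ is a homomorphism of graded algebras. **Proposition.** Let $\lambda_1$ and $\lambda_2$ be dominant integral weights of $\mathcal{L}$ and let $\mu=\lambda_1+\lambda_2$. Then $H_{\lambda_1}\subset H_\mu$ if and only if $H_{\lambda_2}\subset H_\mu$, and, if these inclusions hold, $$\mathrm{Br}(\mu)=\mathrm{Br}(\lambda_1)\,\mathrm{Br}(\lambda_2)$$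 in the $(G/H_\mu)$-graded Brauer group, where $\mathrm{Br}(\lambda_i)$ is mapped to this group by means of the quotient map $G/H_{\lambda_i}\to G/H_\mu$. -/

import Mathlib

open scoped TensorProduct DirectSum

noncomputable section

attribute [local instance] LieRing.ofAssociativeRing

universe u v w

namespace GradedBrauer

/-! ### Families of subspaces indexed by an abelian group

A `G`-grading on an `F`-algebra `A` is a family `𝒜 : G → Submodule F A`.  The abelian group `G` is
written additively. -/

section Gradings

variable {F : Type u} [Field F] {G : Type w}

/-- The algebras `(A, 𝒜)` and `(B, ℬ)` are isomorphic as `G`-graded algebras. -/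
def GradedIso {A : Type*} [Ring A] [Algebra F A] {B : Type*} [Ring B] [Algebra F B]
    (𝒜 : G → Submodule F A) (ℬ : G → Submodule F B) : Prop :=
  ∃ e : A ≃ₐ[F] B, ∀ g, (𝒜 g).map e.toLinearMap = ℬ g

theorem GradedIso.refl {A : Type*} [Ring A] [Algebra F A] (𝒜 : G → Submodule F A) :
    GradedIso 𝒜 𝒜 :=
  ⟨AlgEquiv.refl, fun g => by ext x; simp⟩

theorem GradedIso.symm {A : Type*} [Ring A] [Algebra F A] {B : Type*} [Ring B] [Algebra F B]
    {𝒜 : G → Submodule F A} {ℬ : G → Submodule F B} (h : GradedIso 𝒜 ℬ) : GradedIso ℬ 𝒜 := by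
  obtain ⟨e, he⟩ := h
  refine ⟨e.symm, fun g => ?_⟩
  ext x
  simp [← he g]

theorem GradedIso.trans {A : Type*} [Ring A] [Algebra F A] {B : Type*} [Ring B] [Algebra F B]
    {C : Type*} [Ring C] [Algebra F C]
    {𝒜 : G → Submodule F A} {ℬ : G → Submodule F B} {𝒞 : G → Submodule F C}
    (h : GradedIso 𝒜 ℬ) (h' : GradedIso ℬ 𝒞) : GradedIso 𝒜 𝒞 := by
  obtain ⟨e, he⟩ := h
  obtain ⟨e', he'⟩ := h'
  refine ⟨e.trans e', fun g => ?_⟩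
  ext x
  simp [← he' g, ← he g]

variable [AddCommGroup G]

/-- `𝒜` is a `G`-grading on the associative unital algebra `A`: `1 ∈ 𝒜 0`,
`𝒜 g * 𝒜 h ⊆ 𝒜 (g + h)`, and `A` is the direct sum of the `𝒜 g`. -/
structure IsAlgebraGrading {A : Type v} [Ring A] [Algebra F A] (𝒜 : G → Submodule F A) : Prop where
  gradedMonoid : SetLike.GradedMonoid 𝒜
  independent : iSupIndep 𝒜
  iSup_eq_top : ⨆ g, 𝒜 g = ⊤

/-- The coarsening of a `G`-grading along a homomorphism `f : G → G'`: the component of degree `g'`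
is the sum of the components whose degree is mapped to `g'` by `f`. -/
def coarsen {G' : Type*} [AddCommGroup G'] (f : G →+ G') {A : Type*} [AddCommGroup A] [Module F A]
    (𝒜 : G → Submodule F A) (g' : G') : Submodule F A :=
  ⨆ g : {g : G // f g = g'}, 𝒜 g

/-- The tensor product grading: `(A ⊗ B)_g = ∑_{a + b = g} A_a ⊗ B_b`. -/
def tensorGrading {A : Type*} [Ring A] [Algebra F A] {B : Type*} [Ring B] [Algebra F B]
    (𝒜 : G → Submodule F A) (ℬ : G → Submodule F B) (g : G) : Submodule F (A ⊗[F] B) :=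
  ⨆ p : {p : G × G // p.1 + p.2 = g},
    Submodule.map₂ (TensorProduct.mk F A B) (𝒜 p.1.1) (ℬ p.1.2)

/-- The grading on `M_k(D) = M_k(F) ⊗ D` given by a graded algebra `D` and a `k`-tuple `γ` of
elements of `G`: if `d ∈ D` is homogeneous then `E_{ij} ⊗ d` has degree `γ i + deg d - γ j`.
This is the graded algebra `End_D(W)` for the graded right `D`-module `W` with a homogeneous
basis `v_1, …, v_k`, `deg v_i = γ i`. -/
def matrixGrading {D : Type*} [Ring D] [Algebra F D] (𝒟 : G → Submodule F D)
    {k : ℕ} (γ : Fin k → G) (g : G) : Submodule F (Matrix (Fin k) (Fin k) D) where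
  carrier := {M | ∀ i j, M i j ∈ 𝒟 (g + γ j - γ i)}
  add_mem' hM hN i j := add_mem (hM i j) (hN i j)
  zero_mem' _ _ := zero_mem _
  smul_mem' c _ hM i j := Submodule.smul_mem _ c (hM i j)

end Gradings

/-! ### The graded Brauer group of an algebraically closed field -/

/-- A finite-dimensional `G`-graded division algebra over `F` that is simple as an ungraded algebra
(hence, `F` being algebraically closed, a matrix algebra).  Every such algebra has a copy in the
universe of `F`. -/
structure DivisionAlgebra (F : Type u) [Field F] (G : Type w) [AddCommGroup G] where
  carrier : Type u
  [ring : Ring carrier]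
  [algebra : Algebra F carrier]
  [finiteDimensional : FiniteDimensional F carrier]
  [simple : IsSimpleRing carrier]
  grading : G → Submodule F carrier
  isGrading : IsAlgebraGrading grading
  isUnit_of_homogeneous : ∀ (g : G) (x : carrier), x ∈ grading g → x ≠ 0 → IsUnit x

attribute [instance] DivisionAlgebra.ring DivisionAlgebra.algebra
  DivisionAlgebra.finiteDimensional DivisionAlgebra.simple

section Group

variable (F : Type u) [Field F] (G : Type w) [AddCommGroup G]

instance divisionAlgebraSetoid : Setoid (DivisionAlgebra F G) where
  r D D' := GradedIso D.grading D'.grading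
  iseqv := ⟨fun D => GradedIso.refl D.grading, GradedIso.symm, GradedIso.trans⟩

/-- The underlying set of the `G`-graded Brauer group of an algebraically closed field `F`: the
isomorphism classes of graded division algebras which are matrix algebras. -/
def BrauerGroup : Type (max (u + 1) w) := Quotient (divisionAlgebraSetoid F G)

/-- The field `F` with the trivial grading. -/
def trivialDivisionAlgebra : DivisionAlgebra F G where
  carrier := F
  grading g := ⨆ _ : g = 0, ⊤
  isGrading :=
    { gradedMonoid :=
        { one_mem := by simp
          mul_mem := by
            intro i j x y hx hy
            by_cases hi : i = 0
            · by_cases hj : j = 0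
              · simp [hi, hj]
              · simp_all
            · simp_all }
      independent := by
        intro g
        by_cases hg : g = 0
        · subst hg
          have : (⨆ (j : G) (_ : j ≠ 0), (⨆ _ : j = 0, (⊤ : Submodule F F))) = ⊥ := by
            simp only [iSup_eq_bot]
            intro i hi h
            exact absurd h hi
          rw [this]
          exact disjoint_bot_right
        · simp [hg]
      iSup_eq_top := by simp }
  isUnit_of_homogeneous := fun _ _ _ hx => isUnit_iff_ne_zero.mpr hx

/-- The identity element of the graded Brauer group is the class of `F`. -/
instance : One (BrauerGroup F G) := ⟨Quotient.mk _ (trivialDivisionAlgebra F G)⟩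

variable {F G}

/-- `(R, ℛ)` is isomorphic, as a graded algebra, to `End_D(W)` for some nonzero finite-dimensional
graded right vector space `W` over the graded division algebra `D`. -/
def IsEndOver {R : Type v} [Ring R] [Algebra F R] (ℛ : G → Submodule F R)
    (D : DivisionAlgebra F G) : Prop :=
  ∃ (k : ℕ) (γ : Fin k → G), 0 < k ∧ GradedIso ℛ (matrixGrading D.grading γ)

open Classical in
/-- The class `[R]` of a `G`-graded matrix algebra `(R, ℛ)` in the graded Brauer group: the
isomorphism class of the graded division algebra `D` such that `R ≅ End_D(W)`.  For every graded
matrix algebra such a `D` exists and is unique up to isomorphism; for other families of subspaces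
`ℛ` the value has no meaning. -/
def brauerClass {R : Type v} [Ring R] [Algebra F R] (ℛ : G → Submodule F R) : BrauerGroup F G :=
  if h : ∃ D : DivisionAlgebra F G, IsEndOver ℛ D then Quotient.mk _ h.choose else 1

theorem brauerClass_congr {R : Type*} [Ring R] [Algebra F R] {S : Type*} [Ring S] [Algebra F S]
    {ℛ : G → Submodule F R} {𝒮 : G → Submodule F S} (h : GradedIso ℛ 𝒮) :
    brauerClass ℛ = brauerClass 𝒮 := by
  have key : IsEndOver ℛ = IsEndOver 𝒮 := by
    funext D
    exact propext ⟨fun ⟨k, γ, hk, e⟩ => ⟨k, γ, hk, h.symm.trans e⟩,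
      fun ⟨k, γ, hk, e⟩ => ⟨k, γ, hk, h.trans e⟩⟩
  unfold brauerClass
  generalize IsEndOver 𝒮 = P at key
  subst key
  rfl

theorem GradedIso.tensor {A A' B B' : Type*} [Ring A] [Algebra F A] [Ring A'] [Algebra F A']
    [Ring B] [Algebra F B] [Ring B'] [Algebra F B']
    {𝒜 : G → Submodule F A} {𝒜' : G → Submodule F A'}
    {ℬ : G → Submodule F B} {ℬ' : G → Submodule F B'}
    (h : GradedIso 𝒜 𝒜') (h' : GradedIso ℬ ℬ') :
    GradedIso (tensorGrading 𝒜 ℬ) (tensorGrading 𝒜' ℬ') := by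
  obtain ⟨e, he⟩ := h
  obtain ⟨e', he'⟩ := h'
  refine ⟨Algebra.TensorProduct.congr e e', fun g => ?_⟩
  simp only [tensorGrading, Submodule.map_iSup]
  refine iSup_congr fun p => ?_
  rw [← he, ← he', Submodule.map_map₂, Submodule.map₂_map_map]
  rfl

theorem GradedIso.coarsen {G' : Type*} [AddCommGroup G'] (f : G →+ G')
    {A A' : Type*} [Ring A] [Algebra F A] [Ring A'] [Algebra F A']
    {𝒜 : G → Submodule F A} {𝒜' : G → Submodule F A'} (h : GradedIso 𝒜 𝒜') :
    GradedIso (coarsen f 𝒜) (coarsen f 𝒜') := by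
  obtain ⟨e, he⟩ := h
  refine ⟨e, fun g => ?_⟩
  simp only [GradedBrauer.coarsen, Submodule.map_iSup, he]

/-- The multiplication of the graded Brauer group: `[D₁][D₂] = [D₁ ⊗ D₂]`. -/
instance : Mul (BrauerGroup F G) where
  mul := Quotient.lift₂ (fun D D' => brauerClass (tensorGrading D.grading D'.grading))
    fun _ _ _ _ h h' => brauerClass_congr (GradedIso.tensor h h')

/-- The homomorphism from the `G`-graded to the `G'`-graded Brauer group induced by a homomorphism
`f : G → G'`: a `G`-graded algebra is regarded as a `G'`-graded algebra by coarsening. -/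
def BrauerGroup.map {G' : Type*} [AddCommGroup G'] (f : G →+ G') :
    BrauerGroup F G → BrauerGroup F G' :=
  Quotient.lift (fun D => brauerClass (coarsen f D.grading))
    fun _ _ h => brauerClass_congr (GradedIso.coarsen f h)

end Group

/-! ### Brauer invariants of modules over a graded Lie algebra -/

section Lie

variable {F : Type*} [Field F] {L : Type*} [LieRing L] [LieAlgebra F L]
  {G : Type*} [AddCommGroup G] [DecidableEq G]
  (ℒ : G → Submodule F L) [GradedLieAlgebra ℒ]

/-- The action of a character `χ` of `G` on the `G`-graded space `L`: `χ * x = χ(g) x` for `x` of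
degree `g`. -/
def charLinear (χ : AddChar G F) : L →ₗ[F] L :=
  (DirectSum.toModule F G L fun g => χ g • (ℒ g).subtype) ∘ₗ
    (DirectSum.decomposeLinearEquiv ℒ).toLinearMap

theorem charLinear_of_mem (χ : AddChar G F) {g : G} {x : L} (hx : x ∈ ℒ g) :
    charLinear ℒ χ x = χ g • x := by
  lift x to ℒ g using hx
  simp [charLinear]

/-- The automorphism `α_χ` of `L` by which a character `χ` of `G` acts. -/
def charAut (χ : AddChar G F) : L →ₗ⁅F⁆ L where
  toLinearMap := charLinear ℒ χ
  map_lie' := by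
    intro x y
    change charLinear ℒ χ ⁅x, y⁆ = ⁅charLinear ℒ χ x, charLinear ℒ χ y⁆
    induction x using DirectSum.Decomposition.inductionOn ℒ with
    | zero => simp
    | add a b ha hb => simp only [add_lie, map_add, ha, hb]
    | homogeneous a =>
      induction y using DirectSum.Decomposition.inductionOn ℒ with
      | zero => simp
      | add c d hc hd => simp only [lie_add, map_add, hc, hd]
      | homogeneous c =>
        rw [charLinear_of_mem ℒ χ a.2, charLinear_of_mem ℒ χ c.2,
          charLinear_of_mem ℒ χ (SetLike.GradedBracket.bracket_mem a.2 c.2),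
          AddChar.map_add_eq_mul, smul_lie, lie_smul, mul_smul]

theorem charAut_one (x : L) : charAut ℒ 1 x = x := by
  change charLinear ℒ 1 x = x
  induction x using DirectSum.Decomposition.inductionOn ℒ with
  | zero => simp
  | add a b ha hb => rw [map_add, ha, hb]
  | homogeneous a => simp [charLinear_of_mem ℒ 1 a.2]

theorem charAut_mul (χ ψ : AddChar G F) (x : L) :
    charAut ℒ (χ * ψ) x = charAut ℒ χ (charAut ℒ ψ x) := by
  change charLinear ℒ (χ * ψ) x = charLinear ℒ χ (charLinear ℒ ψ x)
  induction x using DirectSum.Decomposition.inductionOn ℒ with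
  | zero => simp
  | add a b ha hb => simp only [map_add, ha, hb]
  | homogeneous a => simp [charLinear_of_mem ℒ _ a.2, mul_smul, smul_comm (ψ _)]

variable (V : Type*) [AddCommGroup V] [Module F V] [LieRingModule L V] [LieModule F L V]

/-- The inertia group `K` of an `L`-module `V`: the characters `χ` of `G` such that `V` is isomorphic
to the twisted module `V^χ`, on which `x ∈ L` acts as `α_χ(x)` acts on `V`. -/
def inertiaGroup : Subgroup (AddChar G F) where
  carrier := {χ | ∃ φ : V ≃ₗ[F] V, ∀ (x : L) (v : V), φ ⁅x, v⁆ = ⁅charAut ℒ χ x, φ v⁆}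
  one_mem' := ⟨LinearEquiv.refl F V, fun x v => by simp [charAut_one]⟩
  mul_mem' := by
    rintro χ ψ ⟨φ, hφ⟩ ⟨φ', hφ'⟩
    exact ⟨φ'.trans φ, fun x v => by simp [hφ, hφ', charAut_mul]⟩
  inv_mem' := by
    rintro χ ⟨φ, hφ⟩
    refine ⟨φ.symm, fun x v => φ.injective ?_⟩
    rw [LinearEquiv.apply_symm_apply, hφ, LinearEquiv.apply_symm_apply, ← charAut_mul,
      mul_inv_cancel, charAut_one]

/-- The subgroup `H = K^⊥` of `G`: the elements on which every character in the inertia group of `V`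
takes the value `1`. -/
def inertiaPerp : AddSubgroup G where
  carrier := {g | ∀ χ ∈ inertiaGroup ℒ V, χ g = 1}
  zero_mem' χ _ := χ.map_zero_eq_one
  add_mem' ha hb χ hχ := by rw [χ.map_add_eq_mul, ha χ hχ, hb χ hχ, one_mul]
  neg_mem' ha χ hχ := by rw [χ.map_neg_eq_inv, ha χ hχ, inv_one]

/-- The grading on the universal enveloping algebra `U(L)` induced by the grading of `L`: the
component of degree `g` is spanned by the products `x₁ ⋯ xₙ` of homogeneous elements of `L` whose
degrees add up to `g`. -/
def envelopingGrading (g : G) : Submodule F (UniversalEnvelopingAlgebra F L) :=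
  Submodule.span F {a | ∃ l : List (Σ i : G, ℒ i), (l.map Sigma.fst).sum = g ∧
    a = (l.map fun x => UniversalEnvelopingAlgebra.ι F (x.2 : L)).prod}

/-- The representation `ρ : U(L) → End(V)` of an `L`-module `V`. -/
def rep : UniversalEnvelopingAlgebra F L →ₐ[F] Module.End F V :=
  UniversalEnvelopingAlgebra.lift F (LieModule.toEnd F L V)

/-- The `(G/H)`-grading on `End(V)`, where `V` is a simple `L`-module and `H = K^⊥` is as above: the
unique one for which the surjection `ρ : U(L) → End(V)` is a homomorphism of graded algebras, where
`U(L)` has the `(G/H)`-grading induced by its `G`-grading.  Its components are thus the images of the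
components of `U(L)`. -/
def endGrading (q : G ⧸ inertiaPerp ℒ V) : Submodule F (Module.End F V) :=
  (coarsen (QuotientAddGroup.mk' (inertiaPerp ℒ V)) (envelopingGrading ℒ) q).map
    (rep (F := F) (L := L) V).toLinearMap

/-- The Brauer invariant of a simple `L`-module `V`: the class of `End(V)` in the `(G/H)`-graded
Brauer group, where `H = K^⊥` is as above. -/
def brauerInvariant : BrauerGroup F (G ⧸ inertiaPerp ℒ V) :=
  brauerClass (endGrading ℒ V)

end Lie

/-! ### Highest weights -/

section Weights

variable {F : Type*} [Field F] [CharZero F] [IsAlgClosed F]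
  {L : Type*} [LieRing L] [LieAlgebra F L] [FiniteDimensional F L] [LieAlgebra.IsSemisimple F L]
  {𝔥 : LieSubalgebra F L} [𝔥.IsCartanSubalgebra]

/-- The weight `lam` is dominant integral: its values on the simple coroots are nonnegative
integers. -/
def IsDominantIntegral (b : (LieAlgebra.IsKilling.rootSystem 𝔥).Base) (lam : Module.Dual F 𝔥) :
    Prop :=
  ∀ α ∈ b.support, ∃ n : ℕ, lam ((LieAlgebra.IsKilling.rootSystem 𝔥).coroot α) = n

/-- `V` is the simple `L`-module of highest weight `lam`: it is a simple `L`-module and contains a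
nonzero vector of weight `lam` annihilated by all root spaces of positive roots. -/
structure IsSimpleOfHighestWeight (b : (LieAlgebra.IsKilling.rootSystem 𝔥).Base)
    (lam : Module.Dual F 𝔥) (V : Type*) [AddCommGroup V] [Module F V] [LieRingModule L V]
    [LieModule F L V] : Prop where
  irreducible : LieModule.IsIrreducible F L V
  exists_vector : ∃ v : V, v ≠ 0 ∧ (∀ h : 𝔥, ⁅(h : L), v⁆ = lam h • v) ∧
    ∀ α : 𝔥.root, b.IsPos α → ∀ x ∈ LieAlgebra.rootSpace 𝔥 (α : LieModule.Weight F 𝔥 L),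
      ⁅x, v⁆ = 0

end Weights

end GradedBrauer

end

noncomputable section

universe u v w

namespace GradedBrauer

section Prime

theorem exists_mul_mul_ne_zero {R : Type*} [Ring R] [IsSimpleRing R] {x y : R} (hx : x ≠ 0)
    (hy : y ≠ 0) : ∃ z, x * z * y ≠ 0 := by
  by_contra! h
  let I : TwoSidedIdeal R := TwoSidedIdeal.mk' {z | ∀ r, x * r * z = 0} (by simp)
    (fun {a b} ha hb r => by
      have h1 := ha r
      have h2 := hb r
      rw [mul_add, h1, h2, add_zero])
    (fun {a} ha r => by
      have h1 := ha r
      rw [mul_neg, h1, neg_zero])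
    (fun {s a} ha r => by
      have h1 := ha (r * s)
      rwa [mul_assoc x, mul_assoc r, ← mul_assoc r, ← mul_assoc x] at *)
    (fun {a s} ha r => by
      have h1 := ha r
      rw [← mul_assoc, h1, zero_mul])
  have hmem : ∀ z, z ∈ I ↔ ∀ r, x * r * z = 0 := fun z => TwoSidedIdeal.mem_mk' _ _ _ _ _ _ _
  rcases eq_bot_or_eq_top I with hI | hI
  · have : y ∈ I := (hmem y).2 h
    rw [hI] at this
    exact hy this
  · have : (1 : R) ∈ I := by rw [hI]; trivial
    have := (hmem 1).1 this 1
    simp only [mul_one] at this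
    exact hx this

theorem one_mem_span_mul_mul {F R : Type*} [Field F] [Ring R] [Algebra F R] [IsSimpleRing R]
    {x : R} (hx : x ≠ 0) : (1 : R) ∈ Submodule.span F {y | ∃ a b, y = a * x * b} := by
  let S : Submodule F R := Submodule.span F {y | ∃ a b, y = a * x * b}
  let I : TwoSidedIdeal R := TwoSidedIdeal.mk' (S : Set R) S.zero_mem (fun ha hb => S.add_mem ha hb)
    (fun ha => S.neg_mem ha)
    (fun {r y} hy => by
      induction hy using Submodule.span_induction with
      | mem y hy =>
        obtain ⟨a, b, rfl⟩ := hy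
        exact Submodule.subset_span ⟨r * a, b, by simp only [mul_assoc]⟩
      | zero => rw [mul_zero]; exact S.zero_mem
      | add a b _ _ ha hb => rw [mul_add]; exact S.add_mem ha hb
      | smul c a _ ha => rw [mul_smul_comm]; exact S.smul_mem c ha)
    (fun {y r} hy => by
      induction hy using Submodule.span_induction with
      | mem y hy =>
        obtain ⟨a, b, rfl⟩ := hy
        exact Submodule.subset_span ⟨a, b * r, by simp only [mul_assoc]⟩
      | zero => rw [zero_mul]; exact S.zero_mem
      | add a b _ _ ha hb => rw [add_mul]; exact S.add_mem ha hb
      | smul c a _ ha => rw [smul_mul_assoc]; exact S.smul_mem c ha)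
  have hmem : ∀ z, z ∈ I ↔ z ∈ S := fun z => TwoSidedIdeal.mem_mk' _ _ _ _ _ _ _
  rcases eq_bot_or_eq_top I with hI | hI
  · have : x ∈ I := (hmem x).2 (Submodule.subset_span ⟨1, 1, by simp⟩)
    rw [hI] at this
    exact absurd this hx
  · exact (hmem 1).1 (by rw [hI]; trivial)

end Prime

section Grading

variable {F : Type u} [Field F] {G : Type w}

/-- A degree preserving injective linear map into an independent family reflects degrees. -/
theorem mem_of_map_mem {A B : Type*} [AddCommGroup A] [Module F A] [AddCommGroup B] [Module F B]
    {𝒜 : G → Submodule F A} {ℬ : G → Submodule F B} (h𝒜 : ⨆ g, 𝒜 g = ⊤) (hℬ : iSupIndep ℬ)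
    (f : A →ₗ[F] B) (hf : Function.Injective f) (hfg : ∀ g, ∀ x ∈ 𝒜 g, f x ∈ ℬ g)
    {g : G} {x : A} (hx : f x ∈ ℬ g) : x ∈ 𝒜 g := by
  have htop : x ∈ 𝒜 g ⊔ ⨆ (h) (_ : h ≠ g), 𝒜 h := by
    have : (⊤ : Submodule F A) ≤ 𝒜 g ⊔ ⨆ (h) (_ : h ≠ g), 𝒜 h := by
      rw [← h𝒜]
      refine iSup_le fun h => ?_
      by_cases hg : h = g
      · rw [hg]; exact le_sup_left
      · exact le_sup_of_le_right (le_iSup₂_of_le h hg le_rfl)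
    exact this trivial
  obtain ⟨a, ha, a', ha', rfl⟩ := Submodule.mem_sup.1 htop
  have h1 : f a' ∈ ℬ g := by
    have := (ℬ g).sub_mem hx (hfg g a ha)
    simpa using this
  have h2 : f a' ∈ ⨆ (h) (_ : h ≠ g), ℬ h := by
    have hle : (⨆ (h) (_ : h ≠ g), 𝒜 h) ≤ (⨆ (h) (_ : h ≠ g), ℬ h).comap f :=
      iSup₂_le fun h hh y hy => Submodule.mem_iSup_of_mem h (Submodule.mem_iSup_of_mem hh (hfg h y hy))
    exact hle ha'
  have h3 : f a' = 0 := by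
    have := (Submodule.disjoint_def.1 (hℬ g)) _ h1 h2
    exact this
  have : a' = 0 := hf (by rw [h3, map_zero])
  rw [this, add_zero]
  exact ha

theorem exists_homogeneous_map_ne_zero {A B : Type*} [AddCommGroup A] [Module F A]
    [AddCommGroup B] [Module F B] {𝒜 : G → Submodule F A} (h𝒜 : ⨆ g, 𝒜 g = ⊤)
    (f : A →ₗ[F] B) (hf : ∃ x, f x ≠ 0) : ∃ g, ∃ x ∈ 𝒜 g, f x ≠ 0 := by
  by_contra! h
  obtain ⟨x, hx⟩ := hf
  have : (⊤ : Submodule F A) ≤ LinearMap.ker f := by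
    rw [← h𝒜]
    exact iSup_le fun g y hy => h g y hy
  exact hx (this (trivial : x ∈ ⊤))

variable [AddCommGroup G]

namespace IsAlgebraGrading

variable {R : Type v} [Ring R] [Algebra F R] {ℛ : G → Submodule F R}

theorem mul_mem (h : IsAlgebraGrading ℛ) {g k : G} {x y : R} (hx : x ∈ ℛ g) (hy : y ∈ ℛ k) :
    x * y ∈ ℛ (g + k) :=
  h.gradedMonoid.mul_mem hx hy

theorem one_mem (h : IsAlgebraGrading ℛ) : (1 : R) ∈ ℛ 0 := h.gradedMonoid.one_mem

theorem mem_neg_of_mul_eq_one (h : IsAlgebraGrading ℛ) {g : G} {x y : R} (hx : x ∈ ℛ g)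
    (hxy : x * y = 1) (hyx : y * x = 1) : y ∈ ℛ (-g) := by
  refine mem_of_map_mem (ℬ := fun k => ℛ (g + k)) h.iSup_eq_top
    (h.independent.comp (add_right_injective g)) (LinearMap.mulLeft F x) ?_ ?_ ?_
  · intro a b hab
    simp only [LinearMap.mulLeft_apply] at hab
    have := congrArg (y * ·) hab
    simpa [← mul_assoc, hyx] using this
  · intro k z hz
    exact h.mul_mem hx hz
  · simpa [hxy] using h.one_mem

theorem exists_homogeneous_mul_mul_ne_zero [IsSimpleRing R] (h : IsAlgebraGrading ℛ) {x y : R}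
    (hx : x ≠ 0) (hy : y ≠ 0) : ∃ g, ∃ z ∈ ℛ g, x * z * y ≠ 0 :=
  exists_homogeneous_map_ne_zero h.iSup_eq_top
    (LinearMap.mulRight F y ∘ₗ LinearMap.mulLeft F x) (exists_mul_mul_ne_zero hx hy)

/-- The component of degree `0`, as a subalgebra. -/
def zeroSubalgebra (h : IsAlgebraGrading ℛ) : Subalgebra F R where
  carrier := ℛ 0
  mul_mem' ha hb := by simpa using h.mul_mem ha hb
  add_mem' ha hb := (ℛ 0).add_mem ha hb
  algebraMap_mem' c := by
    rw [Algebra.algebraMap_eq_smul_one]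
    exact (ℛ 0).smul_mem c h.one_mem

/-- If the only idempotents of degree `0` are `0` and `1`, then the elements of degree `0` are
units or nilpotent. -/
theorem isUnit_or_isNilpotent [FiniteDimensional F R] (h : IsAlgebraGrading ℛ)
    (hidem : ∀ e ∈ ℛ 0, e * e = e → e = 0 ∨ e = 1) {x : R} (hx : x ∈ ℛ 0) :
    IsUnit x ∨ IsNilpotent x := by
  let S := Algebra.adjoin F ({x} : Set R)
  have hS : S ≤ h.zeroSubalgebra := Algebra.adjoin_le (Set.singleton_subset_iff.2 hx)
  have : IsMulCommutative S := Algebra.isMulCommutative_adjoin F (by rintro a rfl b rfl; rfl)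
  have : FiniteDimensional F S := inferInstanceAs (FiniteDimensional F S.toSubmodule)
  have : IsArtinianRing S := IsArtinianRing.of_finite F S
  let x' : S := ⟨x, Algebra.subset_adjoin rfl⟩
  obtain ⟨n, y, hy⟩ := IsArtinian.exists_pow_succ_smul_dvd x' (1 : S)
  simp only [smul_eq_mul, mul_one, Nat.succ_eq_add_one] at hy
  have key : ∀ k, x' ^ (n + k) * y ^ k = x' ^ n := by
    intro k
    induction k with
    | zero => simp
    | succ k ih =>
      calc x' ^ (n + (k + 1)) * y ^ (k + 1) = (x' ^ (n + 1) * y) * (x' ^ k * y ^ k) := by ring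
        _ = x' ^ (n + k) * y ^ k := by rw [hy]; ring
        _ = _ := ih
  have hidem' : (x' ^ n * y ^ n) * (x' ^ n * y ^ n) = x' ^ n * y ^ n := by
    calc (x' ^ n * y ^ n) * (x' ^ n * y ^ n) = (x' ^ (n + n) * y ^ n) * y ^ n := by ring
      _ = _ := by rw [key]
  rcases hidem _ (hS (x' ^ n * y ^ n).2) (congrArg Subtype.val hidem') with h0 | h1
  · right
    have h0 : x' ^ n * y ^ n = 0 := Subtype.ext h0
    have h2 : x' ^ n = 0 := by
      rw [← key n, pow_add, mul_assoc, h0, mul_zero]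
    exact ⟨n, congrArg Subtype.val h2⟩
  · left
    have h1 : x' ^ n * y ^ n = 1 := Subtype.ext h1
    have h2 : x' * y = 1 := by
      calc x' * y = (x' * y) * (x' ^ n * y ^ n) := by rw [h1, mul_one]
        _ = (x' ^ (n + 1) * y) * y ^ n := by ring
        _ = 1 := by rw [hy, h1]
    refine ⟨⟨x, y, congrArg Subtype.val h2, ?_⟩, rfl⟩
    rw [mul_comm] at h2
    exact congrArg Subtype.val h2

theorem not_isUnit_add [FiniteDimensional F R] (h : IsAlgebraGrading ℛ)
    (hidem : ∀ e ∈ ℛ 0, e * e = e → e = 0 ∨ e = 1) {x y : R} (hx : x ∈ ℛ 0) (hy : y ∈ ℛ 0)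
    (hxu : ¬ IsUnit x) (hyu : ¬ IsUnit y) : ¬ IsUnit (x + y) := by
  rintro ⟨u, hu⟩
  have hu0 : (u : R) ∈ ℛ 0 := hu ▸ (ℛ 0).add_mem hx hy
  have hinv : ((u⁻¹ : Rˣ) : R) ∈ ℛ 0 := by
    simpa using h.mem_neg_of_mul_eq_one hu0 u.mul_inv u.inv_mul
  have h1 : ((u⁻¹ : Rˣ) : R) * x ∈ ℛ 0 := by simpa using h.mul_mem hinv hx
  have h2 : ((u⁻¹ : Rˣ) : R) * x + (u⁻¹ : Rˣ) * y = 1 := by rw [← mul_add, ← hu, u.inv_mul]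
  rcases h.isUnit_or_isNilpotent hidem h1 with h3 | h3
  · exact hxu ((Units.isUnit_units_mul _ _).1 h3)
  · have h4 := h3.isUnit_one_sub
    rw [← h2, add_sub_cancel_left] at h4
    exact hyu ((Units.isUnit_units_mul _ _).1 h4)

/-- A finite-dimensional graded simple algebra without nontrivial idempotents of degree `0` is a
graded division algebra. -/
theorem isUnit_of_homogeneous [FiniteDimensional F R] [IsSimpleRing R] (h : IsAlgebraGrading ℛ)
    (hidem : ∀ e ∈ ℛ 0, e * e = e → e = 0 ∨ e = 1) {g : G} {x : R} (hx : x ∈ ℛ g) (hx0 : x ≠ 0) :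
    IsUnit x := by
  by_contra hxu
  have hartin : IsArtinianRing R := IsArtinianRing.of_finite F R
  let N : Submodule F R :=
    Submodule.span F {y | ∃ k l, ∃ a ∈ ℛ k, ∃ b ∈ ℛ l, k + g + l = 0 ∧ y = a * x * b}
  have hN0 : ∀ y ∈ N, y ∈ ℛ 0 ∧ ¬ IsUnit y := by
    intro y hy
    induction hy using Submodule.span_induction with
    | mem y hy =>
      obtain ⟨k, l, a, ha, b, hb, hkl, rfl⟩ := hy
      refine ⟨hkl ▸ h.mul_mem (h.mul_mem ha hx) hb, fun hu => hxu ?_⟩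
      have h1 := isUnit_of_mul_isUnit_left hu
      exact isUnit_of_mul_isUnit_right h1
    | zero => exact ⟨(ℛ 0).zero_mem, not_isUnit_zero⟩
    | add a b _ _ ha hb =>
      exact ⟨(ℛ 0).add_mem ha.1 hb.1, h.not_isUnit_add hidem ha.1 hb.1 ha.2 hb.2⟩
    | smul c a _ ha =>
      refine ⟨(ℛ 0).smul_mem c ha.1, fun hu => ha.2 ?_⟩
      rw [Algebra.smul_def] at hu
      exact isUnit_of_mul_isUnit_right hu
  have hle : Submodule.span F {y | ∃ a b, y = a * x * b} ≤ N ⊔ ⨆ (q) (_ : q ≠ 0), ℛ q := by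
    rw [Submodule.span_le]
    rintro _ ⟨a, b, rfl⟩
    have ha : a ∈ ⨆ k, ℛ k := by rw [h.iSup_eq_top]; trivial
    have hb : b ∈ ⨆ k, ℛ k := by rw [h.iSup_eq_top]; trivial
    induction ha using Submodule.iSup_induction' with
    | zero => simp
    | add a a' _ _ ha ha' => rw [add_mul, add_mul]; exact Submodule.add_mem _ ha ha'
    | mem k a ha =>
      induction hb using Submodule.iSup_induction' with
      | zero => simp
      | add b b' _ _ hb hb' => rw [mul_add]; exact Submodule.add_mem _ hb hb'
      | mem l b hb =>
        by_cases hkl : k + g + l = 0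
        · exact Submodule.mem_sup_left (Submodule.subset_span ⟨k, l, a, ha, b, hb, hkl, rfl⟩)
        · exact Submodule.mem_sup_right (Submodule.mem_iSup_of_mem _
            (Submodule.mem_iSup_of_mem hkl (h.mul_mem (h.mul_mem ha hx) hb)))
  obtain ⟨n, hn, n', hn', hnn⟩ := Submodule.mem_sup.1 (hle (one_mem_span_mul_mul (F := F) hx0))
  have h1 : n' ∈ ℛ 0 := by
    have : n' = 1 - n := by rw [← hnn]; abel
    rw [this]
    exact (ℛ 0).sub_mem h.one_mem (hN0 n hn).1
  have h2 : n' = 0 := Submodule.disjoint_def.1 (h.independent 0) _ h1 hn'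
  rw [h2, add_zero] at hnn
  exact (hN0 n hn).2 (hnn ▸ isUnit_one)

end IsAlgebraGrading

end Grading

end GradedBrauer

end

noncomputable section

universe u v w

namespace GradedBrauer

section Corner

variable {F : Type u} [Field F] {G : Type w}
  {A : Type*} [Ring A] [Algebra F A] {B : Type*} [Ring B] [Algebra F B]
  {C : Type*} [Ring C] [Algebra F C]

/-- `j` identifies the graded algebra `A` with the corner `e B e` of the graded algebra `B`, where
`e = j 1`. -/
structure IsCornerEmbedding (𝒜 : G → Submodule F A) (ℬ : G → Submodule F B) (j : A →ₙₐ[F] B) :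
    Prop where
  injective : Function.Injective j
  exists_eq : ∀ z, ∃ a, j a = j 1 * z * j 1
  map_mem : ∀ {g x}, x ∈ 𝒜 g → j x ∈ ℬ g

/-- The graded algebra `A` is isomorphic to a corner `e B e` of the graded algebra `B`. -/
def GradedCorner (𝒜 : G → Submodule F A) (ℬ : G → Submodule F B) : Prop :=
  ∃ j : A →ₙₐ[F] B, IsCornerEmbedding 𝒜 ℬ j

theorem map_one_mul (j : A →ₙₐ[F] B) (a : A) : j 1 * j a = j a := by rw [← map_mul, one_mul]

theorem map_mul_one (j : A →ₙₐ[F] B) (a : A) : j a * j 1 = j a := by rw [← map_mul, mul_one]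

namespace IsCornerEmbedding

variable {𝒜 : G → Submodule F A} {ℬ : G → Submodule F B} {j : A →ₙₐ[F] B}

theorem exists_eq_of_mul (hj : IsCornerEmbedding 𝒜 ℬ j) {z : B} (h₁ : j 1 * z = z)
    (h₂ : z * j 1 = z) : ∃ a, j a = z := by
  obtain ⟨a, ha⟩ := hj.exists_eq z
  exact ⟨a, by rw [ha, h₁, h₂]⟩

theorem mem_of_map_mem (hj : IsCornerEmbedding 𝒜 ℬ j) (h𝒜 : ⨆ g, 𝒜 g = ⊤) (hℬ : iSupIndep ℬ)
    {g : G} {a : A} (h : j a ∈ ℬ g) : a ∈ 𝒜 g :=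
  GradedBrauer.mem_of_map_mem h𝒜 hℬ (j : A →ₗ[F] B) hj.injective (fun _ _ => hj.map_mem) h

end IsCornerEmbedding

theorem GradedIso.gradedCorner {𝒜 : G → Submodule F A} {ℬ : G → Submodule F B}
    (h : GradedIso 𝒜 ℬ) : GradedCorner 𝒜 ℬ := by
  obtain ⟨e, he⟩ := h
  refine ⟨((e : A →ₐ[F] B) : A →ₙₐ[F] B), e.injective, fun z => ⟨e.symm z, ?_⟩, ?_⟩
  · change e (e.symm z) = e 1 * z * e 1
    simp
  · intro g x hx
    rw [← he g]
    exact ⟨x, hx, rfl⟩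

theorem GradedCorner.trans {𝒜 : G → Submodule F A} {ℬ : G → Submodule F B}
    {𝒞 : G → Submodule F C} (h : GradedCorner 𝒜 ℬ) (h' : GradedCorner ℬ 𝒞) :
    GradedCorner 𝒜 𝒞 := by
  obtain ⟨j, hj⟩ := h
  obtain ⟨j', hj'⟩ := h'
  refine ⟨j'.comp j, hj'.injective.comp hj.injective, fun z => ?_, fun hx => hj'.map_mem (hj.map_mem hx)⟩
  obtain ⟨b, hb⟩ := hj'.exists_eq z
  obtain ⟨a, ha⟩ := hj.exists_eq b
  refine ⟨a, ?_⟩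
  simp only [NonUnitalAlgHom.comp_apply]
  rw [ha, map_mul, map_mul, hb]
  calc j' (j 1) * (j' 1 * z * j' 1) * j' (j 1) = (j' (j 1) * j' 1) * z * (j' 1 * j' (j 1)) := by
        simp only [mul_assoc]
    _ = _ := by rw [map_one_mul, map_mul_one]

theorem IsCornerEmbedding.isSimpleRing [Nontrivial A] [IsSimpleRing B] {𝒜 : G → Submodule F A}
    {ℬ : G → Submodule F B} {j : A →ₙₐ[F] B} (hj : IsCornerEmbedding 𝒜 ℬ j) : IsSimpleRing A := by
  refine ⟨⟨fun I => ?_⟩⟩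
  by_cases hI : I = ⊥
  · exact Or.inl hI
  right
  obtain ⟨x, hxI, hx⟩ : ∃ x ∈ I, x ≠ 0 := by
    by_contra! h
    refine hI (le_bot_iff.1 fun y hy => ?_)
    rw [h y hy]
    exact zero_mem _
  have hjx : j x ≠ 0 := fun h => hx (hj.injective (by rw [h, map_zero]))
  have key : ∀ y ∈ Submodule.span F {y | ∃ a b, y = a * j x * b},
      ∃ a ∈ I, j a = j 1 * y * j 1 := by
    intro y hy
    induction hy using Submodule.span_induction with
    | mem y hy =>
      obtain ⟨a, b, rfl⟩ := hy
      obtain ⟨a', ha'⟩ := hj.exists_eq a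
      obtain ⟨b', hb'⟩ := hj.exists_eq b
      refine ⟨a' * x * b', I.mul_mem_right _ _ (I.mul_mem_left _ _ hxI), ?_⟩
      rw [map_mul, map_mul, ha', hb']
      calc j 1 * a * j 1 * j x * (j 1 * b * j 1) = j 1 * a * (j 1 * j x * j 1) * b * j 1 := by
            simp only [mul_assoc]
        _ = j 1 * a * j x * b * j 1 := by rw [map_one_mul, map_mul_one]
        _ = _ := by simp only [mul_assoc]
    | zero => exact ⟨0, I.zero_mem, by simp⟩
    | add a b _ _ ha hb =>
      obtain ⟨a', ha', ha⟩ := ha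
      obtain ⟨b', hb', hb⟩ := hb
      exact ⟨a' + b', I.add_mem ha' hb', by rw [map_add, ha, hb, mul_add, add_mul]⟩
    | smul c a _ ha =>
      obtain ⟨a', ha', ha⟩ := ha
      refine ⟨c • a', ?_, by rw [map_smul, ha, mul_smul_comm, smul_mul_assoc]⟩
      rw [Algebra.smul_def]
      exact I.mul_mem_left _ _ ha'
  obtain ⟨a, haI, ha⟩ := key 1 (one_mem_span_mul_mul hjx)
  have : a = 1 := hj.injective (by rw [ha, mul_one, map_one_mul])
  exact (TwoSidedIdeal.one_mem_iff I).1 (this ▸ haI)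

variable [AddCommGroup G]

theorem GradedCorner.coarsen {G' : Type*} [AddCommGroup G'] (f : G →+ G')
    {𝒜 : G → Submodule F A} {ℬ : G → Submodule F B} (h : GradedCorner 𝒜 ℬ) :
    GradedCorner (coarsen f 𝒜) (coarsen f ℬ) := by
  obtain ⟨j, hj⟩ := h
  refine ⟨j, hj.injective, hj.exists_eq, fun {g x} hx => ?_⟩
  have : GradedBrauer.coarsen f 𝒜 g ≤ (GradedBrauer.coarsen f ℬ g).comap (j : A →ₗ[F] B) :=
    iSup_le fun k y hy => Submodule.mem_iSup_of_mem k (hj.map_mem hy)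
  exact this hx

/-- The tensor product of non-unital algebra homomorphisms. -/
def tensorMap {A' B' : Type*} [Ring A'] [Algebra F A'] [Ring B'] [Algebra F B']
    (j : A →ₙₐ[F] B) (j' : A' →ₙₐ[F] B') : A ⊗[F] A' →ₙₐ[F] B ⊗[F] B' where
  toFun := TensorProduct.map (j : A →ₗ[F] B) (j' : A' →ₗ[F] B')
  map_smul' := map_smul _
  map_zero' := map_zero _
  map_add' := map_add _
  map_mul' x y := by
    induction x with
    | zero => simp
    | add a b ha hb => simp only [add_mul, map_add, ha, hb]
    | tmul a b =>
      induction y with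
      | zero => simp
      | add c d hc hd => simp only [mul_add, map_add, hc, hd]
      | tmul c d => simp

theorem tensorMap_tmul {A' B' : Type*} [Ring A'] [Algebra F A'] [Ring B'] [Algebra F B']
    (j : A →ₙₐ[F] B) (j' : A' →ₙₐ[F] B') (a : A) (a' : A') :
    tensorMap j j' (a ⊗ₜ a') = j a ⊗ₜ j' a' := rfl

theorem GradedCorner.tensor {A' B' : Type*} [Ring A'] [Algebra F A'] [Ring B'] [Algebra F B']
    {𝒜 : G → Submodule F A} {ℬ : G → Submodule F B} {𝒜' : G → Submodule F A'}
    {ℬ' : G → Submodule F B'} (h : GradedCorner 𝒜 ℬ) (h' : GradedCorner 𝒜' ℬ') :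
    GradedCorner (tensorGrading 𝒜 𝒜') (tensorGrading ℬ ℬ') := by
  obtain ⟨j, hj⟩ := h
  obtain ⟨j', hj'⟩ := h'
  refine ⟨tensorMap j j', ?_, fun z => ?_, fun {g x} hx => ?_⟩
  · exact TensorProduct.map_injective_of_flat_flat (j : A →ₗ[F] B) (j' : A' →ₗ[F] B')
      hj.injective hj'.injective
  · induction z with
    | zero => exact ⟨0, by simp⟩
    | add z z' hz hz' =>
      obtain ⟨a, ha⟩ := hz
      obtain ⟨a', ha'⟩ := hz'
      exact ⟨a + a', by rw [map_add, ha, ha', mul_add, add_mul]⟩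
    | tmul z z' =>
      obtain ⟨a, ha⟩ := hj.exists_eq z
      obtain ⟨a', ha'⟩ := hj'.exists_eq z'
      refine ⟨a ⊗ₜ a', ?_⟩
      rw [tensorMap_tmul, ha, ha', Algebra.TensorProduct.one_def, tensorMap_tmul]
      simp
  · have : tensorGrading 𝒜 𝒜' g ≤
        (tensorGrading ℬ ℬ' g).comap (tensorMap j j' : A ⊗[F] A' →ₗ[F] B ⊗[F] B') := by
      refine iSup_le fun p => ?_
      rw [Submodule.map₂_le]
      intro a ha b hb
      exact Submodule.mem_iSup_of_mem p
        (Submodule.apply_mem_map₂ (TensorProduct.mk F B B') (hj.map_mem ha) (hj'.map_mem hb))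
    exact this hx

/-- The grading induced on a corner. -/
theorem isAlgebraGrading_comap {ℬ : G → Submodule F B} (hℬ : IsAlgebraGrading ℬ) {j : A →ₙₐ[F] B}
    (hinj : Function.Injective j) (hcorner : ∀ z, ∃ a, j a = j 1 * z * j 1) (h1 : j 1 ∈ ℬ 0) :
    IsAlgebraGrading (fun g => (ℬ g).comap (j : A →ₗ[F] B)) where
  gradedMonoid :=
    { one_mem := h1
      mul_mem := fun {g k x y} hx hy => by
        change j (x * y) ∈ ℬ (g + k)
        rw [map_mul]
        exact hℬ.mul_mem hx hy }
  independent := by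
    intro g
    rw [Submodule.disjoint_def]
    intro x hx hx'
    refine hinj ?_
    rw [map_zero]
    refine Submodule.disjoint_def.1 (hℬ.independent g) _ hx ?_
    have hle : (⨆ (h) (_ : h ≠ g), (ℬ h).comap (j : A →ₗ[F] B)) ≤
        (⨆ (h) (_ : h ≠ g), ℬ h).comap (j : A →ₗ[F] B) :=
      iSup₂_le fun h hh y hy => Submodule.mem_iSup_of_mem h (Submodule.mem_iSup_of_mem hh hy)
    exact hle hx'
  iSup_eq_top := by
    rw [eq_top_iff]
    intro a _
    have key : ∀ y ∈ ⨆ g, ℬ g, ∃ a ∈ ⨆ g, (ℬ g).comap (j : A →ₗ[F] B), j a = j 1 * y * j 1 := by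
      intro y hy
      induction hy using Submodule.iSup_induction' with
      | zero => exact ⟨0, zero_mem _, by simp⟩
      | add a b _ _ ha hb =>
        obtain ⟨a', ha', ha⟩ := ha
        obtain ⟨b', hb', hb⟩ := hb
        exact ⟨a' + b', add_mem ha' hb', by rw [map_add, ha, hb, mul_add, add_mul]⟩
      | mem g y hy =>
        obtain ⟨a, ha⟩ := hcorner y
        refine ⟨a, Submodule.mem_iSup_of_mem g ?_, ha⟩
        change j a ∈ ℬ g
        rw [ha]
        simpa using hℬ.mul_mem (hℬ.mul_mem h1 hy) h1
    obtain ⟨a', ha', h⟩ := key (j a) (by rw [hℬ.iSup_eq_top]; trivial)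
    rw [map_one_mul, map_mul_one] at h
    rwa [hinj h] at ha'

/-- Every corner of a finite-dimensional algebra has a copy in the universe of the field. -/
theorem exists_corner {R : Type v} [Ring R] [Algebra F R] [FiniteDimensional F R] {e : R}
    (he : e * e = e) : ∃ (A : Type u) (_ : Ring A) (_ : Algebra F A) (j : A →ₙₐ[F] R),
      FiniteDimensional F A ∧ Function.Injective j ∧ j 1 = e ∧ ∀ z, ∃ a, j a = e * z * e := by
  let S : NonUnitalSubalgebra F R :=
    { carrier := {x | e * x = x ∧ x * e = x}
      zero_mem' := by simp
      add_mem' := fun {a b} ha hb => ⟨by rw [mul_add, ha.1, hb.1], by rw [add_mul, ha.2, hb.2]⟩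
      mul_mem' := fun {a b} ha hb => ⟨by rw [← mul_assoc, ha.1], by rw [mul_assoc, hb.2]⟩
      smul_mem' := fun c a ha => ⟨by rw [mul_smul_comm, ha.1], by rw [smul_mul_assoc, ha.2]⟩ }
  let _ : Ring S :=
    { (inferInstance : NonUnitalRing S) with
      one := ⟨e, he, he⟩
      one_mul := fun x => Subtype.ext x.2.1
      mul_one := fun x => Subtype.ext x.2.2 }
  let _ : Algebra F S := Algebra.ofModule smul_mul_assoc mul_smul_comm
  have hfin : FiniteDimensional F S := inferInstanceAs (FiniteDimensional F S.toSubmodule)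
  have : Small.{u} S := ⟨Fin (Module.finrank F S) → F, ⟨(Module.finBasis F S).equivFun.toEquiv⟩⟩
  let φ : Shrink.{u} S ≃ₐ[F] S := Shrink.algEquiv F S
  let i : S →ₙₐ[F] R :=
    { toFun := Subtype.val
      map_smul' := fun _ _ => rfl
      map_zero' := rfl
      map_add' := fun _ _ => rfl
      map_mul' := fun _ _ => rfl }
  refine ⟨Shrink.{u} S, inferInstance, inferInstance,
    i.comp ((φ : Shrink.{u} S →ₐ[F] S) : Shrink.{u} S →ₙₐ[F] S),
    FiniteDimensional.of_injective φ.toLinearMap φ.injective,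
    Subtype.val_injective.comp φ.injective, ?_, fun z => ?_⟩
  · change (φ 1 : R) = e
    rw [map_one]
    rfl
  · refine ⟨φ.symm ⟨e * z * e, by simp only [← mul_assoc, he], by simp only [mul_assoc, he]⟩, ?_⟩
    change (φ (φ.symm _) : R) = _
    rw [AlgEquiv.apply_symm_apply]

/-- Every finite-dimensional graded simple algebra has a corner which is a graded division
algebra. -/
theorem exists_divisionAlgebra_gradedCorner {R : Type v} [Ring R] [Algebra F R]
    [FiniteDimensional F R] [IsSimpleRing R] {ℛ : G → Submodule F R} (hℛ : IsAlgebraGrading ℛ) :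
    ∃ D : DivisionAlgebra F G, GradedCorner D.grading ℛ := by
  have main : ∀ (n : ℕ) (R : Type u) [Ring R] [Algebra F R] [FiniteDimensional F R]
      [IsSimpleRing R] (ℛ : G → Submodule F R), IsAlgebraGrading ℛ → Module.finrank F R ≤ n →
      ∃ D : DivisionAlgebra F G, GradedCorner D.grading ℛ := by
    intro n
    induction n with
    | zero =>
      intro R _ _ _ _ ℛ hℛ hn
      exact absurd (Module.finrank_pos (R := F) (M := R)) (by omega)
    | succ n ih =>
      intro R _ _ _ _ ℛ hℛ hn
      by_cases hidem : ∀ e ∈ ℛ 0, e * e = e → e = 0 ∨ e = 1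
      · exact ⟨{ carrier := R, grading := ℛ, isGrading := hℛ,
                 isUnit_of_homogeneous := fun g x hx hx0 => hℛ.isUnit_of_homogeneous hidem hx hx0 },
          (GradedIso.refl ℛ).gradedCorner⟩
      · push Not at hidem
        obtain ⟨e, he0, he, hne0, hne1⟩ := hidem
        obtain ⟨A, _, _, j, _, hinj, hj1, hcorner⟩ := exists_corner (F := F) he
        have hcorner' : ∀ z, ∃ a, j a = j 1 * z * j 1 := by rwa [hj1]
        have hg := isAlgebraGrading_comap hℛ hinj hcorner' (hj1 ▸ he0)
        have hj : IsCornerEmbedding (fun g => (ℛ g).comap (j : A →ₗ[F] R)) ℛ j :=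
          ⟨hinj, hcorner', fun h => h⟩
        have : Nontrivial A := ⟨1, 0, fun h => hne0 (by rw [← hj1, h, map_zero])⟩
        have := hj.isSimpleRing
        have hlt : Module.finrank F A < Module.finrank F R := by
          rw [← LinearMap.finrank_range_of_inj (f := (j : A →ₗ[F] R)) hinj]
          refine Submodule.finrank_lt fun h => hne1 ?_
          obtain ⟨a, ha⟩ : (1 : R) ∈ LinearMap.range (j : A →ₗ[F] R) := by rw [h]; trivial
          have ha : j a = 1 := ha
          have h1 := map_one_mul j a
          rwa [ha, mul_one, hj1] at h1
        obtain ⟨D, hD⟩ := ih A _ hg (by omega)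
        exact ⟨D, hD.trans ⟨j, hj⟩⟩
  obtain ⟨A, _, _, j, _, hinj, hj1, hcorner⟩ := exists_corner (F := F) (mul_one (1 : R))
  have hcorner' : ∀ z, ∃ a, j a = j 1 * z * j 1 := by rwa [hj1]
  have hg := isAlgebraGrading_comap hℛ hinj hcorner' (hj1 ▸ hℛ.one_mem)
  have hj : IsCornerEmbedding (fun g => (ℛ g).comap (j : A →ₗ[F] R)) ℛ j :=
    ⟨hinj, hcorner', fun h => h⟩
  have : Nontrivial A := ⟨1, 0, fun h => one_ne_zero (α := R) (by rw [← hj1, h, map_zero])⟩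
  have := hj.isSimpleRing
  obtain ⟨D, hD⟩ := main _ A _ hg le_rfl
  exact ⟨D, hD.trans ⟨j, hj⟩⟩

theorem gradedCorner_matrixGrading (𝒜 : G → Submodule F A) {k : ℕ} (hk : 0 < k) (γ : Fin k → G) :
    GradedCorner 𝒜 (matrixGrading 𝒜 γ) := by
  let i : Fin k := ⟨0, hk⟩
  let j : A →ₙₐ[F] Matrix (Fin k) (Fin k) A :=
    { toFun := Matrix.single i i
      map_smul' := fun c a => by simp [Matrix.smul_single]
      map_zero' := Matrix.single_zero i i
      map_add' := Matrix.single_add i i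
      map_mul' := fun a b => by simp }
  have hj : ∀ a, j a = Matrix.single i i a := fun _ => rfl
  refine ⟨j, ?_, fun z => ⟨z i i, ?_⟩, fun {g x} hx => ?_⟩
  · intro a b hab
    have := congrFun (congrFun hab i) i
    simpa [hj] using this
  · ext p q
    simp only [hj, Matrix.single_mul_mul_single, one_mul, mul_one]
  · intro p q
    rw [hj, Matrix.single_apply]
    split_ifs with h
    · rw [← h.1, ← h.2, add_sub_cancel_right]
      exact hx
    · exact zero_mem _

end Corner

end GradedBrauer

end

noncomputable section

universe u v w

namespace GradedBrauer

section DivisionCorner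

variable {F : Type u} [Field F] {G : Type w} [AddCommGroup G]
  {R : Type v} [Ring R] [Algebra F R] {ℛ : G → Submodule F R}

theorem exists_mul_eq_of_corner [IsSimpleRing R] (hℛ : IsAlgebraGrading ℛ)
    {D : DivisionAlgebra F G} {j : D.carrier →ₙₐ[F] R} (hj : IsCornerEmbedding D.grading ℛ j)
    {f : R} (hf0 : f ∈ ℛ 0) (hff : f * f = f) (hf : f ≠ 0) :
    ∃ g, ∃ a ∈ ℛ g, ∃ b ∈ ℛ (-g), f * a = a ∧ a * j 1 = a ∧ j 1 * b = b ∧ b * f = b ∧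
      b * a = j 1 := by
  have he : j 1 ≠ 0 := fun h => one_ne_zero (hj.injective (h.trans (map_zero j).symm))
  have hee : j 1 * j 1 = j 1 := map_one_mul j 1
  have he0 : j 1 ∈ ℛ 0 := hj.map_mem D.isGrading.one_mem
  obtain ⟨g, z, hz, hne⟩ := hℛ.exists_homogeneous_mul_mul_ne_zero hf he
  obtain ⟨k, z', hz', hne'⟩ := hℛ.exists_homogeneous_mul_mul_ne_zero he hne
  have ha : f * z * j 1 ∈ ℛ g := by simpa using hℛ.mul_mem (hℛ.mul_mem hf0 hz) he0
  have hb : j 1 * z' * f ∈ ℛ k := by simpa using hℛ.mul_mem (hℛ.mul_mem he0 hz') hf0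
  obtain ⟨d, hd⟩ := hj.exists_eq_of_mul (z := (j 1 * z' * f) * (f * z * j 1))
    (by simp only [← mul_assoc, hee]) (by simp only [mul_assoc, hee])
  have hd0 : d ≠ 0 := by
    rintro rfl
    rw [map_zero] at hd
    apply hne'
    calc j 1 * z' * (f * z * j 1) = j 1 * z' * (f * f * z * j 1) := by rw [hff]
      _ = (j 1 * z' * f) * (f * z * j 1) := by simp only [mul_assoc]
      _ = 0 := hd.symm
  have hdk : d ∈ D.grading (k + g) :=
    hj.mem_of_map_mem D.isGrading.iSup_eq_top hℛ.independent (hd ▸ hℛ.mul_mem hb ha)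
  obtain ⟨u, rfl⟩ := D.isUnit_of_homogeneous _ _ hdk hd0
  have hinv := D.isGrading.mem_neg_of_mul_eq_one hdk u.mul_inv u.inv_mul
  refine ⟨g, f * z * j 1, ha, j (u⁻¹ : D.carrierˣ) * (j 1 * z' * f), ?_, ?_, ?_, ?_, ?_, ?_⟩
  · have := hℛ.mul_mem (hj.map_mem hinv) hb
    rwa [show -(k + g) + k = -g by abel] at this
  · simp only [← mul_assoc, hff]
  · simp only [mul_assoc, hee]
  · rw [← mul_assoc, map_one_mul]
  · simp only [mul_assoc, hff]
  · rw [mul_assoc, ← hd, ← map_mul, u.inv_mul]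

/-- A graded simple algebra is a graded matrix algebra over any of its corners which is a graded
division algebra. -/
theorem isEndOver_of_gradedCorner [FiniteDimensional F R] [IsSimpleRing R]
    (hℛ : IsAlgebraGrading ℛ) {D : DivisionAlgebra F G} (h : GradedCorner D.grading ℛ) :
    IsEndOver ℛ D := by
  obtain ⟨j, hj⟩ := h
  have he : j 1 ≠ 0 := fun h => one_ne_zero (hj.injective (h.trans (map_zero j).symm))
  let P : (k : ℕ) → (Fin k → G) → (Fin k → R) → (Fin k → R) → Prop := fun k γ a b =>
    (∀ i, a i ∈ ℛ (γ i)) ∧ (∀ i, b i ∈ ℛ (-γ i)) ∧ (∀ i, a i * j 1 = a i) ∧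
      (∀ i, j 1 * b i = b i) ∧ ∀ i i', b i * a i' = if i = i' then j 1 else 0
  have hstep : ∀ n, (∃ k γ a b, P k γ a b ∧ ∑ i, a i * b i = 1) ∨ ∃ γ a b, P n γ a b := by
    intro n
    induction n with
    | zero =>
      exact Or.inr ⟨Fin.elim0, Fin.elim0, Fin.elim0, fun i => i.elim0, fun i => i.elim0,
        fun i => i.elim0, fun i => i.elim0, fun i => i.elim0⟩
    | succ n ih =>
      rcases ih with h | ⟨γ, a, b, hP⟩
      · exact Or.inl h
      obtain ⟨ha, hb, hae, heb, hba⟩ := id hP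
      by_cases hsum : ∑ i, a i * b i = 1
      · exact Or.inl ⟨n, γ, a, b, hP, hsum⟩
      right
      have hfa : ∀ i, (1 - ∑ l, a l * b l) * a i = 0 := fun i => by
        simp [sub_mul, Finset.sum_mul, mul_assoc, hba, hae]
      have hbf : ∀ i, b i * (1 - ∑ l, a l * b l) = 0 := fun i => by
        simp [mul_sub, Finset.mul_sum, ← mul_assoc, hba, heb]
      have hf0 : 1 - ∑ l, a l * b l ∈ ℛ 0 :=
        (ℛ 0).sub_mem hℛ.one_mem ((ℛ 0).sum_mem fun l _ => by
          simpa using hℛ.mul_mem (ha l) (hb l))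
      have hff : (1 - ∑ l, a l * b l) * (1 - ∑ l, a l * b l) = 1 - ∑ l, a l * b l := by
        conv_lhs => rw [mul_sub, mul_one, Finset.mul_sum]
        simp [← mul_assoc, hfa]
      obtain ⟨g, a₀, ha₀, b₀, hb₀, hfa₀, hae₀, heb₀, hbf₀, hba₀⟩ :=
        exists_mul_eq_of_corner hℛ hj hf0 hff (sub_ne_zero.2 (Ne.symm hsum))
      refine ⟨Fin.cons g γ, Fin.cons a₀ a, Fin.cons b₀ b, ?_, ?_, ?_, ?_, ?_⟩
      · exact Fin.cases ha₀ ha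
      · exact Fin.cases hb₀ hb
      · exact Fin.cases hae₀ hae
      · exact Fin.cases heb₀ heb
      · refine Fin.cases (Fin.cases ?_ fun i' => ?_) fun i => Fin.cases ?_ fun i' => ?_
        · simpa using hba₀
        · rw [Fin.cons_zero, Fin.cons_succ, ← hbf₀, mul_assoc, hfa, mul_zero,
            if_neg (Fin.succ_ne_zero i').symm]
        · rw [Fin.cons_zero, Fin.cons_succ, ← hfa₀, ← mul_assoc, hbf, zero_mul,
            if_neg (Fin.succ_ne_zero i)]
        · simpa using hba i i'
  obtain ⟨k, γ, a, b, ⟨ha, hb, hae, heb, hba⟩, hsum⟩ :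
      ∃ k γ a b, P k γ a b ∧ ∑ i, a i * b i = 1 := by
    refine (hstep (Module.finrank F R + 1)).resolve_right ?_
    rintro ⟨γ, a, b, -, -, hae, -, hba⟩
    have hli : LinearIndependent F a := by
      rw [Fintype.linearIndependent_iff]
      intro c hc i
      have : c i • j 1 = 0 := by
        have := congrArg (b i * ·) hc
        simpa [Finset.mul_sum, hba] using this
      exact (smul_eq_zero.1 this).resolve_right he
    have := hli.fintype_card_le_finrank
    simp at this
  have hk : 0 < k := by
    rcases Nat.eq_zero_or_pos k with rfl | h
    · simp at hsum
    · exact h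
  let ψ : Matrix (Fin k) (Fin k) D.carrier →ₗ[F] R :=
    { toFun := fun M => ∑ p, ∑ q, a p * j (M p q) * b q
      map_add' := fun M N => by
        simp only [Matrix.add_apply, map_add, mul_add, add_mul, Finset.sum_add_distrib]
      map_smul' := fun c M => by
        simp only [Matrix.smul_apply, map_smul, mul_smul_comm, smul_mul_assoc, Finset.smul_sum,
          RingHom.id_apply] }
  have hψ : ∀ M, ψ M = ∑ p, ∑ q, a p * j (M p q) * b q := fun _ => rfl
  have hbψ : ∀ M p, b p * ψ M = ∑ q, j (M p q) * b q := by
    intro M p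
    rw [hψ, Finset.mul_sum, Finset.sum_eq_single p]
    · rw [Finset.mul_sum]
      refine Finset.sum_congr rfl fun q _ => ?_
      rw [← mul_assoc, ← mul_assoc, hba, if_pos rfl, map_one_mul]
    · intro p' _ hp'
      rw [Finset.mul_sum]
      refine Finset.sum_eq_zero fun q _ => ?_
      rw [← mul_assoc, ← mul_assoc, hba, if_neg hp'.symm, zero_mul, zero_mul]
    · simp
  have hbψa : ∀ M p q, b p * ψ M * a q = j (M p q) := by
    intro M p q
    rw [hbψ, Finset.sum_mul, Finset.sum_eq_single q]
    · rw [mul_assoc, hba, if_pos rfl, map_mul_one]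
    · intro q' _ hq'
      rw [mul_assoc, hba, if_neg hq', mul_zero]
    · simp
  have hone : ψ 1 = 1 := by
    rw [hψ, ← hsum]
    refine Finset.sum_congr rfl fun p _ => ?_
    rw [Finset.sum_eq_single p]
    · rw [Matrix.one_apply_eq, hae]
    · intro q _ hq
      rw [Matrix.one_apply_ne hq.symm, map_zero, mul_zero, zero_mul]
    · simp
  have hmul : ∀ M N, ψ (M * N) = ψ M * ψ N := by
    intro M N
    rw [hψ M, Finset.sum_mul, hψ (M * N)]
    refine Finset.sum_congr rfl fun p _ => ?_
    simp only [Finset.sum_mul, mul_assoc, hbψ]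
    simp only [Matrix.mul_apply, map_sum, Finset.mul_sum, Finset.sum_mul, map_mul, mul_assoc]
    rw [Finset.sum_comm]
  let Ψ : Matrix (Fin k) (Fin k) D.carrier →ₐ[F] R := AlgHom.ofLinearMap ψ hone hmul
  have hinj : Function.Injective Ψ := by
    intro M N hMN
    ext p q
    apply hj.injective
    rw [← hbψa, ← hbψa]
    exact congrArg (fun x => b p * x * a q) hMN
  have hsurj' : ∀ (x : R) (M : Matrix (Fin k) (Fin k) D.carrier),
      (∀ p q, j (M p q) = b p * x * a q) → ψ M = x := by
    intro x M hM
    calc ψ M = (∑ p, a p * b p) * x * ∑ q, a q * b q := by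
          rw [hψ, Finset.sum_mul, Finset.sum_mul]
          refine Finset.sum_congr rfl fun p _ => ?_
          rw [Finset.mul_sum]
          refine Finset.sum_congr rfl fun q _ => ?_
          rw [hM]
          simp only [mul_assoc]
      _ = x := by rw [hsum, one_mul, mul_one]
  have hex : ∀ (x : R) p q, ∃ d, j d = b p * x * a q := fun x p q =>
    hj.exists_eq_of_mul (by simp only [← mul_assoc, heb]) (by simp only [mul_assoc, hae])
  have hsurj : Function.Surjective Ψ := by
    intro x
    choose M hM using hex x
    exact ⟨Matrix.of M, hsurj' x _ hM⟩
  refine ⟨k, γ, hk, GradedIso.symm ⟨AlgEquiv.ofBijective Ψ ⟨hinj, hsurj⟩, fun g => ?_⟩⟩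
  apply le_antisymm
  · rintro _ ⟨M, hM, rfl⟩
    change ψ M ∈ ℛ g
    rw [hψ]
    refine Submodule.sum_mem _ fun p _ => Submodule.sum_mem _ fun q _ => ?_
    have := hℛ.mul_mem (hℛ.mul_mem (ha p) (hj.map_mem (hM p q))) (hb q)
    rwa [show γ p + (g + γ q - γ p) + -γ q = g by abel] at this
  · intro x hx
    choose M hM using hex x
    refine ⟨Matrix.of M, fun p q => ?_, hsurj' x _ hM⟩
    refine hj.mem_of_map_mem D.isGrading.iSup_eq_top hℛ.independent ?_
    change j (M p q) ∈ _
    rw [hM]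
    have := hℛ.mul_mem (hℛ.mul_mem (hb p) hx) (ha q)
    rwa [show -γ p + g + γ q = g + γ q - γ p by abel] at this

/-- The corners of a graded simple algebra which are graded division algebras are isomorphic. -/
theorem gradedIso_of_gradedCorner [IsSimpleRing R] (hℛ : IsAlgebraGrading ℛ)
    {D D' : DivisionAlgebra F G} (h : GradedCorner D.grading ℛ) (h' : GradedCorner D'.grading ℛ) :
    GradedIso D.grading D'.grading := by
  obtain ⟨j, hj⟩ := h
  obtain ⟨j', hj'⟩ := h'
  have he : j 1 ≠ 0 := fun h => one_ne_zero (hj.injective (h.trans (map_zero j).symm))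
  have he' : j' 1 ≠ 0 := fun h => one_ne_zero (hj'.injective (h.trans (map_zero j').symm))
  obtain ⟨k, a, ha, b, hb, hea, hae, heb, hbe, hba⟩ := exists_mul_eq_of_corner hℛ hj
    (hj'.map_mem D'.isGrading.one_mem) (map_one_mul j' 1) he'
  have hab : a * b = j' 1 := by
    obtain ⟨d, hd⟩ := hj'.exists_eq_of_mul (z := a * b) (by rw [← mul_assoc, hea])
      (by rw [mul_assoc, hbe])
    have hdd : d * d = d := hj'.injective (by
      rw [map_mul, hd, mul_assoc a, ← mul_assoc b, hba, heb])
    have hd0 : d ≠ 0 := by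
      rintro rfl
      rw [map_zero] at hd
      apply he
      calc j 1 = (b * a) * (b * a) := by rw [hba, map_one_mul]
        _ = b * (a * b) * a := by simp only [mul_assoc]
        _ = 0 := by rw [← hd, mul_zero, zero_mul]
    have hdu : IsUnit d := by
      refine D'.isUnit_of_homogeneous 0 d ?_ hd0
      refine hj'.mem_of_map_mem D'.isGrading.iSup_eq_top hℛ.independent ?_
      rw [hd]
      simpa using hℛ.mul_mem ha hb
    have : d = 1 := hdu.mul_left_cancel (by rw [hdd, mul_one])
    rw [← hd, this]
  have hex : ∀ d, ∃ d', j' d' = a * j d * b := fun d =>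
    hj'.exists_eq_of_mul (by simp only [← mul_assoc, hea]) (by simp only [mul_assoc, hbe])
  choose φ hφ using hex
  have hφb : ∀ d, b * j' (φ d) * a = j d := fun d => by
    rw [hφ]
    calc b * (a * j d * b) * a = (b * a) * j d * (b * a) := by simp only [mul_assoc]
      _ = j d := by rw [hba, map_one_mul, map_mul_one]
  let Φ : D.carrier →ₐ[F] D'.carrier := AlgHom.ofLinearMap
    { toFun := φ
      map_add' := fun x y => hj'.injective (by
        rw [hφ, map_add, map_add, hφ, hφ, mul_add, add_mul])
      map_smul' := fun c x => hj'.injective (by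
        rw [hφ, map_smul, RingHom.id_apply, map_smul, hφ, mul_smul_comm, smul_mul_assoc]) }
    (hj'.injective (by
      change j' (φ 1) = _
      rw [hφ, hae, hab]))
    (fun x y => hj'.injective (by
      change j' (φ (x * y)) = j' (φ x * φ y)
      rw [map_mul, hφ, hφ, hφ, map_mul]
      calc a * (j x * j y) * b = a * (j x * j 1 * j y) * b := by rw [map_mul_one]
        _ = _ := by rw [← hba]; simp only [mul_assoc]))
  have hinj : Function.Injective Φ := fun x y hxy => hj.injective (by
    rw [← hφb x, ← hφb y]
    exact congrArg (fun z => b * j' z * a) hxy)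
  have hsurj' : ∀ d' d, j d = b * j' d' * a → φ d = d' := fun d' d hd => hj'.injective (by
    rw [hφ, hd]
    calc a * (b * j' d' * a) * b = (a * b) * j' d' * (a * b) := by simp only [mul_assoc]
      _ = _ := by rw [hab, map_one_mul, map_mul_one])
  have hex' : ∀ d', ∃ d, j d = b * j' d' * a := fun d' =>
    hj.exists_eq_of_mul (by simp only [← mul_assoc, heb]) (by simp only [mul_assoc, hae])
  refine ⟨AlgEquiv.ofBijective Φ ⟨hinj, fun d' => ?_⟩, fun g => le_antisymm ?_ ?_⟩
  · obtain ⟨d, hd⟩ := hex' d'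
    exact ⟨d, hsurj' _ _ hd⟩
  · rintro _ ⟨d, hd, rfl⟩
    change φ d ∈ _
    refine hj'.mem_of_map_mem D'.isGrading.iSup_eq_top hℛ.independent ?_
    rw [hφ]
    have := hℛ.mul_mem (hℛ.mul_mem ha (hj.map_mem hd)) hb
    rwa [show k + g + -k = g by abel] at this
  · intro d' hd'
    obtain ⟨d, hd⟩ := hex' d'
    refine ⟨d, ?_, hsurj' _ _ hd⟩
    refine hj.mem_of_map_mem D.isGrading.iSup_eq_top hℛ.independent ?_
    rw [hd]
    have := hℛ.mul_mem (hℛ.mul_mem hb (hj'.map_mem hd')) ha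
    rwa [show -k + g + k = g by abel] at this

/-- The class of a graded simple algebra in the graded Brauer group is that of any of its corners
which is a graded division algebra. -/
theorem brauerClass_eq_mk [FiniteDimensional F R] [IsSimpleRing R] (hℛ : IsAlgebraGrading ℛ)
    {D : DivisionAlgebra F G} (h : GradedCorner D.grading ℛ) :
    brauerClass ℛ = Quotient.mk _ D := by
  have hex : ∃ D : DivisionAlgebra F G, IsEndOver ℛ D := ⟨D, isEndOver_of_gradedCorner hℛ h⟩
  have hval : brauerClass ℛ = Quotient.mk _ hex.choose := dif_pos hex
  obtain ⟨k, γ, hk, hiso⟩ := hex.choose_spec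
  exact hval.trans <| Quotient.sound (gradedIso_of_gradedCorner hℛ
    ((gradedCorner_matrixGrading _ hk γ).trans hiso.symm.gradedCorner) h)

end DivisionCorner

end GradedBrauer

end

noncomputable section

attribute [local instance] LieRing.ofAssociativeRing

universe u v w

namespace GradedBrauer

section Independence

variable {F : Type*} [Field F]

theorem iSupIndep_fiber {M ι κ : Type*} [AddCommGroup M] [Module F M] {A : ι → Submodule F M}
    (hA : iSupIndep A) (f : ι → κ) : iSupIndep fun k => ⨆ i : {i // f i = k}, A i := by
  intro k
  have h := hA.disjoint_biSup_biSup (s := {i | f i = k}) (t := {i | f i ≠ k})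
    (Set.disjoint_left.2 fun i hi hi' => hi' hi)
  refine h.mono (iSup_le fun i => le_iSup₂_of_le i.1 i.2 le_rfl) ?_
  refine iSup₂_le fun k' hk' => iSup_le fun i => ?_
  exact le_iSup₂_of_le i.1 (show f i.1 ≠ k by rw [i.2]; exact hk') le_rfl

theorem exists_projection {M ι : Type*} [AddCommGroup M] [Module F M] {A : ι → Submodule F M}
    (hA : iSupIndep A) (htop : ⨆ i, A i = ⊤) (i : ι) :
    ∃ p : M →ₗ[F] M, (∀ x ∈ A i, p x = x) ∧ ∀ k ≠ i, ∀ x ∈ A k, p x = 0 := by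
  have hc : IsCompl (A i) (⨆ (k) (_ : k ≠ i), A k) := by
    refine ⟨hA i, codisjoint_iff_le_sup.2 ?_⟩
    rw [← htop]
    refine iSup_le fun k => ?_
    by_cases hk : k = i
    · rw [hk]; exact le_sup_left
    · exact le_sup_of_le_right (le_iSup₂_of_le k hk le_rfl)
  refine ⟨(A i).projection _ hc, fun x hx => Submodule.projection_apply_of_mem_left hc hx,
    fun k hk x hx => (Submodule.projection_apply_eq_zero_iff hc).2 ?_⟩
  exact Submodule.mem_iSup_of_mem k (Submodule.mem_iSup_of_mem hk hx)

theorem iSupIndep_map₂_mk {M N ι κ : Type*} [AddCommGroup M] [Module F M] [AddCommGroup N]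
    [Module F N] {A : ι → Submodule F M} {B : κ → Submodule F N} (hA : iSupIndep A)
    (hA' : ⨆ i, A i = ⊤) (hB : iSupIndep B) (hB' : ⨆ i, B i = ⊤) :
    iSupIndep fun p : ι × κ => Submodule.map₂ (TensorProduct.mk F M N) (A p.1) (B p.2) := by
  intro p
  obtain ⟨f, hf, hf'⟩ := exists_projection hA hA' p.1
  obtain ⟨g, hg, hg'⟩ := exists_projection hB hB' p.2
  rw [Submodule.disjoint_def]
  intro x hx hx'
  have h1 : Submodule.map₂ (TensorProduct.mk F M N) (A p.1) (B p.2) ≤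
      LinearMap.ker (TensorProduct.map f g - LinearMap.id) := by
    rw [Submodule.map₂_le]
    intro a ha b hb
    simp [hf a ha, hg b hb]
  have h2 : (⨆ (q : ι × κ) (_ : q ≠ p), Submodule.map₂ (TensorProduct.mk F M N) (A q.1) (B q.2)) ≤
      LinearMap.ker (TensorProduct.map f g) := by
    refine iSup₂_le fun q hq => ?_
    rw [Submodule.map₂_le]
    intro a ha b hb
    by_cases h : q.1 = p.1
    · have h' : q.2 ≠ p.2 := fun h' => hq (Prod.ext h h')
      simp [hg' _ h' b hb]
    · simp [hf' _ h a ha]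
  have h3 := h1 hx
  have h4 := h2 hx'
  rw [LinearMap.mem_ker] at h3 h4
  rw [LinearMap.sub_apply, h4, LinearMap.id_apply, zero_sub, neg_eq_zero] at h3
  exact h3

/-- The simultaneous eigenspace of the operators `T i` for the eigenvalues `c i q`. -/
def simEigenspace {M ι Q : Type*} [AddCommGroup M] [Module F M] (T : ι → Module.End F M)
    (c : ι → Q → F) (q : Q) : Submodule F M where
  carrier := {x | ∀ i, T i x = c i q • x}
  zero_mem' i := by simp
  add_mem' hx hy i := by rw [map_add, hx i, hy i, smul_add]
  smul_mem' a x hx i := by rw [map_smul, hx i, smul_comm]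

theorem iSupIndep_simEigenspace {M ι Q : Type*} [AddCommGroup M] [Module F M]
    (T : ι → Module.End F M) (c : ι → Q → F) (hc : ∀ q q', q ≠ q' → ∃ i, c i q ≠ c i q') :
    iSupIndep (simEigenspace T c) := by
  classical
  intro q
  have key : ∀ s : Finset Q, q ∉ s → ∃ (P : Module.End F M) (d : Q → F),
      (∀ q', ∀ x ∈ simEigenspace T c q', P x = d q' • x) ∧ d q ≠ 0 ∧ ∀ q' ∈ s, d q' = 0 := by
    intro s
    induction s using Finset.induction_on with
    | empty => exact fun _ => ⟨1, fun _ => 1, by simp, one_ne_zero, by simp⟩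
    | insert r s hr ih =>
      intro hq
      rw [Finset.mem_insert, not_or] at hq
      obtain ⟨P, d, hP, hd, hds⟩ := ih hq.2
      obtain ⟨i, hi⟩ := hc q r hq.1
      refine ⟨(T i - c i r • 1) * P, fun q' => (c i q' - c i r) * d q', fun q' x hx => ?_,
        mul_ne_zero (sub_ne_zero.2 hi) hd, fun q' hq' => ?_⟩
      · rw [Module.End.mul_apply, hP q' x hx, map_smul, LinearMap.sub_apply, hx i,
          LinearMap.smul_apply, Module.End.one_apply, ← sub_smul, smul_smul, mul_comm]
      · rcases Finset.mem_insert.1 hq' with rfl | h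
        · simp
        · simp [hds q' h]
  rw [Submodule.disjoint_def]
  intro x hx hx'
  rw [iSup_subtype', Submodule.mem_iSup_iff_exists_finset] at hx'
  obtain ⟨s, hs⟩ := hx'
  obtain ⟨P, d, hP, hd, hds⟩ := key (s.image Subtype.val) (by simp)
  have hle : (⨆ i ∈ s, simEigenspace T c i.1) ≤ LinearMap.ker P := by
    refine iSup₂_le fun q' hq' y hy => ?_
    rw [LinearMap.mem_ker, hP _ y hy, hds _ (Finset.mem_image_of_mem _ hq'), zero_smul]
  have h0 : P x = 0 := hle hs
  rw [hP q x hx] at h0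
  exact (smul_eq_zero.1 h0).resolve_left hd

end Independence

section Coarsen

variable {F : Type u} [Field F] {G : Type w} [AddCommGroup G]
  {A : Type*} [Ring A] [Algebra F A] {B : Type*} [Ring B] [Algebra F B]

theorem mem_coarsen {M : Type*} [AddCommGroup M] [Module F M] {G' : Type*} [AddCommGroup G']
    (f : G →+ G') (𝒜 : G → Submodule F M) {g : G} {x : M} (hx : x ∈ 𝒜 g) :
    x ∈ coarsen f 𝒜 (f g) :=
  Submodule.mem_iSup_of_mem (⟨g, rfl⟩ : {k : G // f k = f g}) hx

theorem coarsen_coarsen {M : Type*} [AddCommGroup M] [Module F M] {G' G'' : Type*}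
    [AddCommGroup G'] [AddCommGroup G''] (f : G →+ G') (f' : G' →+ G'') (𝒜 : G → Submodule F M) :
    coarsen f' (coarsen f 𝒜) = coarsen (f'.comp f) 𝒜 := by
  funext g
  apply le_antisymm
  · refine iSup_le fun k => iSup_le fun l => ?_
    exact le_iSup_of_le (⟨l.1, by rw [AddMonoidHom.comp_apply, l.2, k.2]⟩ :
      {l : G // f'.comp f l = g}) le_rfl
  · refine iSup_le fun l => ?_
    exact le_iSup_of_le (⟨f l.1, l.2⟩ : {k : G' // f' k = g})
      (le_iSup_of_le (⟨l.1, rfl⟩ : {k : G // f k = f l.1}) le_rfl)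

theorem IsAlgebraGrading.coarsen {G' : Type*} [AddCommGroup G'] (f : G →+ G')
    {𝒜 : G → Submodule F A} (h : IsAlgebraGrading 𝒜) :
    IsAlgebraGrading (GradedBrauer.coarsen f 𝒜) where
  gradedMonoid :=
    { one_mem := by
        have := mem_coarsen f 𝒜 h.one_mem
        rwa [map_zero] at this
      mul_mem := fun {g k x y} hx hy => by
        induction hx using Submodule.iSup_induction' with
        | zero => rw [zero_mul]; exact zero_mem _
        | add a b _ _ ha hb => rw [add_mul]; exact add_mem ha hb
        | mem i x hx =>
          induction hy using Submodule.iSup_induction' with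
          | zero => rw [mul_zero]; exact zero_mem _
          | add a b _ _ ha hb => rw [mul_add]; exact add_mem ha hb
          | mem i' y hy =>
            have := mem_coarsen f 𝒜 (h.mul_mem hx hy)
            rwa [map_add, i.2, i'.2] at this }
  independent := iSupIndep_fiber h.independent f
  iSup_eq_top := by
    rw [eq_top_iff, ← h.iSup_eq_top]
    exact iSup_le fun g => le_iSup_of_le (f g) fun x hx => mem_coarsen f 𝒜 hx

theorem tmul_mem_tensorGrading {𝒜 : G → Submodule F A} {ℬ : G → Submodule F B} {g k : G} {a : A}
    {b : B} (ha : a ∈ 𝒜 g) (hb : b ∈ ℬ k) : a ⊗ₜ b ∈ tensorGrading 𝒜 ℬ (g + k) :=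
  Submodule.mem_iSup_of_mem (⟨(g, k), rfl⟩ : {p : G × G // p.1 + p.2 = g + k})
    (Submodule.apply_mem_map₂ (TensorProduct.mk F A B) ha hb)

theorem tensorGrading_eq_span (𝒜 : G → Submodule F A) (ℬ : G → Submodule F B) (g : G) :
    tensorGrading 𝒜 ℬ g =
      Submodule.span F {x | ∃ k l, k + l = g ∧ ∃ a ∈ 𝒜 k, ∃ b ∈ ℬ l, x = a ⊗ₜ b} := by
  apply le_antisymm
  · refine iSup_le fun p => ?_
    rw [Submodule.map₂_le]
    intro a ha b hb
    exact Submodule.subset_span ⟨p.1.1, p.1.2, p.2, a, ha, b, hb, rfl⟩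
  · rw [Submodule.span_le]
    rintro _ ⟨k, l, rfl, a, ha, b, hb, rfl⟩
    exact tmul_mem_tensorGrading ha hb

theorem IsAlgebraGrading.tensor {𝒜 : G → Submodule F A} {ℬ : G → Submodule F B}
    (h : IsAlgebraGrading 𝒜) (h' : IsAlgebraGrading ℬ) :
    IsAlgebraGrading (tensorGrading 𝒜 ℬ) where
  gradedMonoid :=
    { one_mem := by
        have := tmul_mem_tensorGrading h.one_mem h'.one_mem
        rwa [add_zero] at this
      mul_mem := fun {g k x y} hx hy => by
        rw [tensorGrading_eq_span] at hx hy
        induction hx using Submodule.span_induction with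
        | zero => rw [zero_mul]; exact zero_mem _
        | add a b _ _ ha hb => rw [add_mul]; exact add_mem ha hb
        | smul c a _ ha => rw [smul_mul_assoc]; exact Submodule.smul_mem _ _ ha
        | mem x hx =>
          obtain ⟨i, i', rfl, a, ha, b, hb, rfl⟩ := hx
          induction hy using Submodule.span_induction with
          | zero => rw [mul_zero]; exact zero_mem _
          | add a b _ _ ha hb => rw [mul_add]; exact add_mem ha hb
          | smul c a _ ha => rw [mul_smul_comm]; exact Submodule.smul_mem _ _ ha
          | mem y hy =>
            obtain ⟨l, l', rfl, c, hc, d, hd, rfl⟩ := hy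
            rw [Algebra.TensorProduct.tmul_mul_tmul, add_add_add_comm]
            exact tmul_mem_tensorGrading (h.mul_mem ha hc) (h'.mul_mem hb hd) }
  independent := iSupIndep_fiber (iSupIndep_map₂_mk h.independent h.iSup_eq_top h'.independent
    h'.iSup_eq_top) fun p : G × G => p.1 + p.2
  iSup_eq_top := by
    rw [eq_top_iff]
    intro x _
    induction x with
    | zero => exact zero_mem _
    | add x y hx hy => exact add_mem (hx trivial) (hy trivial)
    | tmul a b =>
      have ha : a ∈ ⨆ g, 𝒜 g := by rw [h.iSup_eq_top]; trivial
      have hb : b ∈ ⨆ g, ℬ g := by rw [h'.iSup_eq_top]; trivial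
      induction ha using Submodule.iSup_induction' with
      | zero => simp
      | add a a' _ _ ha ha' => rw [TensorProduct.add_tmul]; exact add_mem (ha trivial) (ha' trivial)
      | mem k a ha =>
        induction hb using Submodule.iSup_induction' with
        | zero => simp
        | add b b' _ _ hb hb' => rw [TensorProduct.tmul_add]; exact add_mem (hb trivial) (hb' trivial)
        | mem l b hb => exact Submodule.mem_iSup_of_mem _ (tmul_mem_tensorGrading ha hb)

end Coarsen

section Density

variable {F : Type*} [Field F] {V : Type*} [AddCommGroup V] [Module F V] [FiniteDimensional F V]

theorem isSimpleRing_end [Nontrivial V] : IsSimpleRing (Module.End F V) := by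
  have : Nonempty (Fin (Module.finrank F V)) := ⟨⟨0, Module.finrank_pos⟩⟩
  exact IsSimpleRing.of_ringEquiv (algEquivMatrix (Module.finBasis F V)).symm.toRingEquiv
    inferInstance

/-- Burnside's theorem. -/
theorem subalgebra_eq_top [IsAlgClosed F] [Nontrivial V] (A : Subalgebra F (Module.End F V))
    (hA : ∀ W : Submodule F V, (∀ a ∈ A, ∀ w ∈ W, a w ∈ W) → W = ⊥ ∨ W = ⊤) : A = ⊤ := by
  have hsimple : IsSimpleModule A V := by
    refine (isSimpleModule_iff A V).2 ⟨fun W => ?_⟩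
    rcases hA (W.restrictScalars F) (fun a ha w hw => W.smul_mem ⟨a, ha⟩ hw) with h | h
    · left
      rwa [Submodule.restrictScalars_eq_bot_iff] at h
    · right
      rwa [Submodule.restrictScalars_eq_top_iff] at h
  rw [eq_top_iff]
  intro f _
  let f' : Module.End (Module.End A V) V :=
    { toFun := f
      map_add' := map_add f
      map_smul' := fun s v => by
        obtain ⟨c, rfl⟩ := (IsSimpleModule.algebraMap_end_bijective_of_isAlgClosed F).2 s
        change f (c • v) = c • f v
        exact map_smul f c v }
  classical
  let b := Module.finBasis F V
  obtain ⟨a, ha⟩ := jacobson_density (R := A) f' (Finset.univ.image b)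
  have : f = a := b.ext fun i => ha (b i) (Finset.mem_image_of_mem _ (Finset.mem_univ i))
  rw [this]
  exact a.2

end Density

end GradedBrauer

end

noncomputable section

attribute [local instance] LieRing.ofAssociativeRing

universe u v w

set_option linter.unusedSectionVars false

namespace GradedBrauer

section EndGrading

variable {F : Type*} [Field F] {L : Type*} [LieRing L] [LieAlgebra F L]
  {G : Type*} [AddCommGroup G] [DecidableEq G]
  (ℒ : G → Submodule F L) [GradedLieAlgebra ℒ]
  (V : Type*) [AddCommGroup V] [Module F V] [LieRingModule L V] [LieModule F L V]

/-- The image of the component of degree `g` of `U(L)` in `End(V)`. -/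
def opComponent (g : G) : Submodule F (Module.End F V) :=
  (envelopingGrading ℒ g).map (rep (F := F) (L := L) V).toLinearMap

theorem opComponent_eq_span (g : G) : opComponent ℒ V g =
    Submodule.span F {a | ∃ l : List (Σ i : G, ℒ i), (l.map Sigma.fst).sum = g ∧
      a = (l.map fun x => LieModule.toEnd F L V (x.2 : L)).prod} := by
  rw [opComponent, envelopingGrading, Submodule.map_span]
  congr 1
  have key : ∀ l : List (Σ i : G, ℒ i),
      rep (F := F) V (l.map fun x => UniversalEnvelopingAlgebra.ι F (x.2 : L)).prod =
        (l.map fun x => LieModule.toEnd F L V (x.2 : L)).prod := by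
    intro l
    rw [map_list_prod, List.map_map]
    congr 1
    refine List.map_congr_left fun x _ => ?_
    exact UniversalEnvelopingAlgebra.lift_ι_apply F _ _
  ext a
  constructor
  · rintro ⟨_, ⟨l, hl, rfl⟩, rfl⟩
    exact ⟨l, hl, key l⟩
  · rintro ⟨l, hl, rfl⟩
    exact ⟨_, ⟨l, hl, rfl⟩, key l⟩

theorem endGrading_eq_coarsen :
    endGrading ℒ V = coarsen (QuotientAddGroup.mk' (inertiaPerp ℒ V)) (opComponent ℒ V) := by
  funext q
  simp only [endGrading, coarsen, Submodule.map_iSup, opComponent]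

theorem toEnd_mem_opComponent {g : G} {x : L} (hx : x ∈ ℒ g) :
    LieModule.toEnd F L V x ∈ opComponent ℒ V g := by
  rw [opComponent_eq_span]
  exact Submodule.subset_span ⟨[⟨g, x, hx⟩], by simp, by simp⟩

theorem one_mem_opComponent : 1 ∈ opComponent ℒ V 0 := by
  rw [opComponent_eq_span]
  exact Submodule.subset_span ⟨[], by simp, by simp⟩

theorem mul_mem_opComponent {g k : G} {x y : Module.End F V} (hx : x ∈ opComponent ℒ V g)
    (hy : y ∈ opComponent ℒ V k) : x * y ∈ opComponent ℒ V (g + k) := by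
  rw [opComponent_eq_span] at hx hy ⊢
  induction hx using Submodule.span_induction with
  | zero => rw [zero_mul]; exact zero_mem _
  | add a b _ _ ha hb => rw [add_mul]; exact add_mem ha hb
  | smul c a _ ha => rw [smul_mul_assoc]; exact Submodule.smul_mem _ _ ha
  | mem x hx =>
    obtain ⟨l, rfl, rfl⟩ := hx
    induction hy using Submodule.span_induction with
    | zero => rw [mul_zero]; exact zero_mem _
    | add a b _ _ ha hb => rw [mul_add]; exact add_mem ha hb
    | smul c a _ ha => rw [mul_smul_comm]; exact Submodule.smul_mem _ _ ha
    | mem y hy =>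
      obtain ⟨l', rfl, rfl⟩ := hy
      exact Submodule.subset_span ⟨l ++ l', by simp, by simp⟩

/-- The sum of the components `opComponent`, as a subalgebra. -/
def opSubalgebra : Subalgebra F (Module.End F V) where
  carrier := (⨆ g, opComponent ℒ V g : Submodule F (Module.End F V))
  add_mem' ha hb := add_mem (S := Submodule F (Module.End F V)) ha hb
  mul_mem' {a b} ha hb := by
    induction ha using Submodule.iSup_induction' with
    | zero => rw [zero_mul]; exact zero_mem (⨆ g, opComponent ℒ V g)
    | add a a' _ _ ha ha' => rw [add_mul]; exact add_mem (S := Submodule F (Module.End F V)) ha ha'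
    | mem k a ha =>
      induction hb using Submodule.iSup_induction' with
      | zero => rw [mul_zero]; exact zero_mem (⨆ g, opComponent ℒ V g)
      | add b b' _ _ hb hb' =>
        rw [mul_add]; exact add_mem (S := Submodule F (Module.End F V)) hb hb'
      | mem l b hb => exact Submodule.mem_iSup_of_mem _ (mul_mem_opComponent ℒ V ha hb)
  algebraMap_mem' c := by
    rw [Algebra.algebraMap_eq_smul_one]
    exact Submodule.smul_mem _ _ (Submodule.mem_iSup_of_mem 0 (one_mem_opComponent ℒ V))

theorem toEnd_mem_opSubalgebra (x : L) : LieModule.toEnd F L V x ∈ opSubalgebra ℒ V := by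
  induction x using DirectSum.Decomposition.inductionOn ℒ with
  | zero => rw [map_zero]; exact zero_mem _
  | add a b ha hb => rw [map_add]; exact add_mem ha hb
  | homogeneous a => exact Submodule.mem_iSup_of_mem _ (toEnd_mem_opComponent ℒ V a.2)

variable {V}

theorem comp_eq_smul_of_mem_opComponent {χ : AddChar G F} {φ : V ≃ₗ[F] V}
    (hφ : ∀ (x : L) (v : V), φ ⁅x, v⁆ = ⁅charAut ℒ χ x, φ v⁆) {g : G} {a : Module.End F V}
    (ha : a ∈ opComponent ℒ V g) (v : V) : φ (a v) = χ g • a (φ v) := by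
  rw [opComponent_eq_span] at ha
  induction ha using Submodule.span_induction generalizing v with
  | zero => simp
  | add a b _ _ ha hb => simp only [LinearMap.add_apply, map_add, ha, hb, smul_add]
  | smul c a _ ha => simp only [LinearMap.smul_apply, map_smul, ha, smul_comm c]
  | mem a ha =>
    obtain ⟨l, rfl, rfl⟩ := ha
    induction l generalizing v with
    | nil => simp
    | cons x l ih =>
      have hx : charAut ℒ χ (x.2 : L) = χ x.1 • (x.2 : L) := charLinear_of_mem ℒ χ x.2.2
      simp only [List.map_cons, List.prod_cons, List.sum_cons, Module.End.mul_apply,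
        LieModule.toEnd_apply_apply, hφ, ih, hx, AddChar.map_add_eq_mul, smul_lie, lie_smul,
        mul_smul]
      rw [smul_comm]

theorem apply_eq_of_mk_eq {χ : AddChar G F} (hχ : χ ∈ inertiaGroup ℒ V) {g k : G}
    (h : (g : G ⧸ inertiaPerp ℒ V) = k) : χ g = χ k := by
  have hmem := (QuotientAddGroup.eq.1 h) χ hχ
  have : k = g + (-g + k) := by abel
  rw [this, AddChar.map_add_eq_mul, hmem, mul_one]

theorem exists_apply_ne {q q' : G ⧸ inertiaPerp ℒ V} (h : q ≠ q') :
    ∃ χ : inertiaGroup ℒ V, χ.1 q.out ≠ χ.1 q'.out := by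
  by_contra! hc
  apply h
  rw [← QuotientAddGroup.out_eq' q, ← QuotientAddGroup.out_eq' q', QuotientAddGroup.eq]
  intro χ hχ
  rw [AddChar.map_add_eq_mul, ← hc ⟨χ, hχ⟩, ← AddChar.map_add_eq_mul, neg_add_cancel,
    AddChar.map_zero_eq_one]

variable (V)

theorem isAlgebraGrading_endGrading [IsAlgClosed F] [FiniteDimensional F V]
    (hV : LieModule.IsIrreducible F L V) : IsAlgebraGrading (endGrading ℒ V) := by
  have := LieModule.nontrivial_of_isIrreducible F L V
  have htop : (⨆ g, opComponent ℒ V g) = ⊤ := by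
    have h : opSubalgebra ℒ V = ⊤ := subalgebra_eq_top _ fun W hW => by
      let N : LieSubmodule F L V :=
        { W with lie_mem := fun {x m} hm => hW _ (toEnd_mem_opSubalgebra ℒ V x) m hm }
      rcases eq_bot_or_eq_top N with hN | hN
      · left
        have := congrArg LieSubmodule.toSubmodule hN
        simpa [N] using this
      · right
        have := congrArg LieSubmodule.toSubmodule hN
        simpa [N] using this
    rw [eq_top_iff]
    intro x _
    have : x ∈ opSubalgebra ℒ V := by rw [h]; trivial
    exact this
  rw [endGrading_eq_coarsen]
  refine ⟨{ one_mem := ?_, mul_mem := ?_ }, ?_, ?_⟩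
  · have := mem_coarsen (QuotientAddGroup.mk' (inertiaPerp ℒ V)) _ (one_mem_opComponent ℒ V)
    rwa [map_zero] at this
  · intro q q' x y hx hy
    induction hx using Submodule.iSup_induction' with
    | zero => rw [zero_mul]; exact zero_mem _
    | add a b _ _ ha hb => rw [add_mul]; exact add_mem ha hb
    | mem i x hx =>
      induction hy using Submodule.iSup_induction' with
      | zero => rw [mul_zero]; exact zero_mem _
      | add a b _ _ ha hb => rw [mul_add]; exact add_mem ha hb
      | mem i' y hy =>
        have := mem_coarsen (QuotientAddGroup.mk' (inertiaPerp ℒ V)) _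
          (mul_mem_opComponent ℒ V hx hy)
        rwa [map_add, i.2, i'.2] at this
  · choose φ hφ using fun χ : inertiaGroup ℒ V => χ.2
    refine (iSupIndep_simEigenspace (fun χ => (φ χ).conj.toLinearMap)
      (fun χ q => χ.1 q.out) fun q q' => exists_apply_ne ℒ).mono fun q => ?_
    refine iSup_le fun i a ha χ => ?_
    ext v
    simp only [LinearEquiv.coe_coe, LinearEquiv.conj_apply_apply, LinearMap.smul_apply]
    rw [comp_eq_smul_of_mem_opComponent ℒ (hφ χ) ha, LinearEquiv.apply_symm_apply]
    congr 1
    refine apply_eq_of_mk_eq ℒ χ.2 ?_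
    rw [QuotientAddGroup.out_eq']
    exact i.2
  · rw [eq_top_iff, ← htop]
    exact iSup_le fun g => le_iSup_of_le (QuotientAddGroup.mk' (inertiaPerp ℒ V) g)
      fun x hx => mem_coarsen _ _ hx

/-- The inertia group is the group of all characters which are trivial on `inertiaPerp`. -/
theorem mem_inertiaGroup_of_forall [IsAlgClosed F] [FiniteDimensional F V]
    (hV : LieModule.IsIrreducible F L V) {χ : AddChar G F}
    (hχ : ∀ g ∈ inertiaPerp ℒ V, χ g = 1) : χ ∈ inertiaGroup ℒ V := by
  classical
  have hgr := isAlgebraGrading_endGrading ℒ V hV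
  have hcongr : ∀ {g k : G}, (g : G ⧸ inertiaPerp ℒ V) = k → χ g = χ k := by
    intro g k h
    have hmem := hχ _ (QuotientAddGroup.eq.1 h)
    have : k = g + (-g + k) := by abel
    rw [this, AddChar.map_add_eq_mul, hmem, mul_one]
  let _ := (DirectSum.isInternal_submodule_of_iSupIndep_of_iSup_eq_top hgr.independent
    hgr.iSup_eq_top).chooseDecomposition
  let S : AddChar G F → Module.End F (Module.End F V) := fun ψ =>
    (DirectSum.toModule F _ _ fun q => ψ q.out • (endGrading ℒ V q).subtype) ∘ₗ
      (DirectSum.decomposeLinearEquiv (endGrading ℒ V)).toLinearMap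
  have hS : ∀ ψ q, ∀ a ∈ endGrading ℒ V q, S ψ a = ψ q.out • a := by
    intro ψ q a ha
    lift a to endGrading ℒ V q using ha
    simp [S]
  have hSS : ∀ a, S χ⁻¹ (S χ a) = a ∧ S χ (S χ⁻¹ a) = a := by
    intro a
    induction a using DirectSum.Decomposition.inductionOn (endGrading ℒ V) with
    | zero => simp
    | add a b ha hb => simp only [map_add, ha, hb, and_self]
    | @homogeneous q a =>
      have hne : χ q.out * χ⁻¹ q.out = 1 := by
        rw [← AddChar.mul_apply, mul_inv_cancel, AddChar.one_apply]
      have hne' : χ⁻¹ q.out * χ q.out = 1 := by rw [mul_comm, hne]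
      simp only [hS _ q _ a.2, map_smul, smul_smul, hne, hne', one_smul, and_self]
  have hmul : ∀ a b, S χ (a * b) = S χ a * S χ b := by
    intro a b
    induction a using DirectSum.Decomposition.inductionOn (endGrading ℒ V) with
    | zero => simp
    | add a b ha hb => simp only [add_mul, map_add, ha, hb]
    | @homogeneous q a =>
      induction b using DirectSum.Decomposition.inductionOn (endGrading ℒ V) with
      | zero => simp
      | add a b ha hb => simp only [mul_add, map_add, ha, hb]
      | @homogeneous q' b =>
        rw [hS _ q _ a.2, hS _ q' _ b.2, hS _ _ _ (hgr.mul_mem a.2 b.2), smul_mul_smul_comm,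
          ← AddChar.map_add_eq_mul]
        congr 1
        apply hcongr
        rw [QuotientAddGroup.out_eq', QuotientAddGroup.mk_add, QuotientAddGroup.out_eq',
          QuotientAddGroup.out_eq']
  have hSg : ∀ g, ∀ a ∈ opComponent ℒ V g, S χ a = χ g • a := by
    intro g a ha
    have hmem : a ∈ endGrading ℒ V (g : G ⧸ inertiaPerp ℒ V) := by
      rw [endGrading_eq_coarsen]
      exact mem_coarsen _ _ ha
    rw [hS χ _ a hmem]
    congr 1
    exact hcongr (QuotientAddGroup.out_eq' _)
  have hone : S χ 1 = 1 := by
    rw [hSg 0 1 (one_mem_opComponent ℒ V), AddChar.map_zero_eq_one, one_smul]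
  let Φ : Module.End F V ≃ₐ[F] Module.End F V :=
    AlgEquiv.ofBijective (AlgHom.ofLinearMap (S χ) hone hmul)
      ⟨Function.LeftInverse.injective fun a => (hSS a).1,
        Function.RightInverse.surjective fun a => (hSS a).2⟩
  obtain ⟨T, hT⟩ := Φ.eq_linearEquivConjAlgEquiv
  refine ⟨T, fun x v => ?_⟩
  induction x using DirectSum.Decomposition.inductionOn ℒ with
  | zero => simp
  | add a b ha hb => simp only [add_lie, map_add, ha, hb]
  | @homogeneous g a =>
    have h1 : Φ (LieModule.toEnd F L V (a : L)) = χ g • LieModule.toEnd F L V (a : L) :=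
      hSg g _ (toEnd_mem_opComponent ℒ V a.2)
    rw [hT] at h1
    have h2 := LinearMap.congr_fun h1 (T v)
    simp only [LinearEquiv.conjAlgEquiv_apply_apply, LinearEquiv.symm_apply_apply,
      LieModule.toEnd_apply_apply, LinearMap.smul_apply] at h2
    have hx : charAut ℒ χ (a : L) = χ g • (a : L) := charLinear_of_mem ℒ χ a.2
    rw [hx, smul_lie, ← h2]

theorem inertiaPerp_le_iff [IsAlgClosed F] [FiniteDimensional F V]
    (hV : LieModule.IsIrreducible F L V) (W : Type*) [AddCommGroup W] [Module F W]
    [LieRingModule L W] [LieModule F L W] :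
    inertiaPerp ℒ V ≤ inertiaPerp ℒ W ↔ inertiaGroup ℒ W ≤ inertiaGroup ℒ V :=
  ⟨fun h _ hχ => mem_inertiaGroup_of_forall ℒ V hV fun _ hg => h hg _ hχ,
    fun h _ hg χ hχ => hg χ (h hχ)⟩

end EndGrading

end GradedBrauer

end

noncomputable section

attribute [local instance] LieRing.ofAssociativeRing

universe u v w

set_option linter.unusedSectionVars false

namespace GradedBrauer

open LieAlgebra LieAlgebra.IsKilling

section Casimir

theorem bilinForm_dualBasis_apply {K W ι : Type*} [Field K] [AddCommGroup W] [Module K W]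
    [Finite ι] [DecidableEq ι] {B : LinearMap.BilinForm K W} (hB : B.Nondegenerate)
    (c : Module.Basis ι K W) (i : ι) (w : W) : B (B.dualBasis hB c i) w = c.repr w i := by
  have := c.finiteDimensional_of_finite
  rw [LinearMap.BilinForm.dualBasis, Module.Basis.map_apply, Module.Basis.coe_dualBasis,
    ← LinearMap.BilinForm.toDual_def hB, LinearEquiv.apply_symm_apply, Module.Basis.coord_apply]

variable {F : Type*} [Field F] {L : Type*} [LieRing L] [LieAlgebra F L] [FiniteDimensional F L]
  [LieAlgebra.IsKilling F L]

variable (F L) in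
/-- The basis dual to `Module.finBasis F L` with respect to the Killing form. -/
def killingDualBasis : Module.Basis (Fin (Module.finrank F L)) F L :=
  (killingForm F L).dualBasis (LieAlgebra.IsKilling.killingForm_nondegenerate F L)
    (Module.finBasis F L)

theorem sum_killingForm_smul_dualBasis (y : L) :
    ∑ i, killingForm F L y (Module.finBasis F L i) • killingDualBasis F L i = y := by
  conv_rhs => rw [← (killingDualBasis F L).sum_repr y]
  refine Finset.sum_congr rfl fun i _ => ?_
  rw [killingDualBasis, LinearMap.BilinForm.dualBasis_repr_apply]

theorem sum_killingForm_smul_finBasis (w : L) :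
    ∑ i, killingForm F L (killingDualBasis F L i) w • Module.finBasis F L i = w := by
  conv_rhs => rw [← (Module.finBasis F L).sum_repr w]
  refine Finset.sum_congr rfl fun i _ => ?_
  rw [killingDualBasis, bilinForm_dualBasis_apply]

theorem sum_bilinear_eq {M ι : Type*} [AddCommGroup M] [Module F M] [Fintype ι]
    (β : L →ₗ[F] L →ₗ[F] M) (x y : ι → L) :
    ∑ k, β (x k) (y k) = ∑ i, β (∑ k, killingForm F L (y k) (Module.finBasis F L i) • x k)
      (killingDualBasis F L i) := by
  simp only [map_sum, LinearMap.sum_apply, map_smul, LinearMap.smul_apply]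
  rw [Finset.sum_comm]
  refine Finset.sum_congr rfl fun k _ => ?_
  conv_lhs => rw [← sum_killingForm_smul_dualBasis (F := F) (y k)]
  simp only [map_sum, map_smul]

variable (V : Type*) [AddCommGroup V] [Module F V] [LieRingModule L V] [LieModule F L V]

variable (F L) in
/-- The action of the Casimir element on an `L`-module. -/
def casimir : Module.End F V :=
  ∑ i, LieModule.toEnd F L V (Module.finBasis F L i) * LieModule.toEnd F L V (killingDualBasis F L i)

variable (F L) in
/-- The bilinear map `(x, y) ↦ ρ(x) ρ(y)`. -/
def mulToEnd : L →ₗ[F] L →ₗ[F] Module.End F V :=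
  (LinearMap.mul F (Module.End F V)).compl₁₂ (LieModule.toEnd F L V : L →ₗ[F] Module.End F V)
    (LieModule.toEnd F L V : L →ₗ[F] Module.End F V)

theorem mulToEnd_apply (x y : L) :
    mulToEnd F L V x y = LieModule.toEnd F L V x * LieModule.toEnd F L V y := rfl

theorem casimir_eq_sum {ι : Type*} [Fintype ι] (x y : ι → L)
    (h : ∀ w, ∑ k, killingForm F L (y k) w • x k = w) :
    casimir F L V = ∑ k, LieModule.toEnd F L V (x k) * LieModule.toEnd F L V (y k) := by
  have := sum_bilinear_eq (mulToEnd F L V) x y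
  simp only [h, mulToEnd_apply] at this
  exact this.symm

theorem toEnd_mul_casimir (z : L) :
    LieModule.toEnd F L V z * casimir F L V = casimir F L V * LieModule.toEnd F L V z := by
  have h1 := sum_bilinear_eq (mulToEnd F L V) (fun i => ⁅z, Module.finBasis F L i⁆)
    (killingDualBasis F L)
  have h2 := sum_bilinear_eq (mulToEnd F L V) (Module.finBasis F L)
    (fun i => ⁅z, killingDualBasis F L i⁆)
  have h3 : ∀ i, ∑ k, killingForm F L ⁅z, killingDualBasis F L k⁆ (Module.finBasis F L i) •
      Module.finBasis F L k = -⁅z, Module.finBasis F L i⁆ := by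
    intro i
    rw [← sum_killingForm_smul_finBasis (F := F) ⁅z, Module.finBasis F L i⁆,
      ← Finset.sum_neg_distrib]
    refine Finset.sum_congr rfl fun k _ => ?_
    rw [← neg_smul]
    congr 1
    have := LieModule.traceForm_apply_lie_apply F L L (killingDualBasis F L k) z
      (Module.finBasis F L i)
    change killingForm F L ⁅_, _⁆ _ = killingForm F L _ ⁅_, _⁆ at this
    rw [← this, ← lie_skew, map_neg, LinearMap.neg_apply]
  simp only [h3, map_neg, LinearMap.neg_apply, Finset.sum_neg_distrib, mulToEnd_apply] at h2
  rw [← sub_eq_zero, casimir, Finset.mul_sum, Finset.sum_mul, ← Finset.sum_sub_distrib]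
  calc _ = ∑ i, (LieModule.toEnd F L V ⁅z, Module.finBasis F L i⁆ *
          LieModule.toEnd F L V (killingDualBasis F L i) +
        LieModule.toEnd F L V (Module.finBasis F L i) *
          LieModule.toEnd F L V ⁅z, killingDualBasis F L i⁆) := by
        refine Finset.sum_congr rfl fun i _ => ?_
        rw [LieHom.map_lie, LieHom.map_lie, LieRing.of_associative_ring_bracket,
          LieRing.of_associative_ring_bracket]
        noncomm_ring
    _ = 0 := by rw [Finset.sum_add_distrib, h2, add_neg_cancel]

theorem casimir_lie (z : L) (v : V) : casimir F L V ⁅z, v⁆ = ⁅z, casimir F L V v⁆ :=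
  (LinearMap.congr_fun (toEnd_mul_casimir V z) v).symm

/-- The Casimir element is invariant under automorphisms of `L`. -/
theorem casimir_eq_sum_equiv (e : L ≃ₗ⁅F⁆ L) :
    casimir F L V = ∑ i, LieModule.toEnd F L V (e (Module.finBasis F L i)) *
      LieModule.toEnd F L V (e (killingDualBasis F L i)) := by
  refine casimir_eq_sum V _ _ fun w => ?_
  obtain ⟨w, rfl⟩ := e.surjective w
  conv_rhs => rw [← sum_killingForm_smul_finBasis (F := F) w]
  rw [map_sum]
  refine Finset.sum_congr rfl fun i _ => ?_
  rw [map_smul]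
  congr 1
  exact LieAlgebra.killingForm_of_equiv_apply e _ _

variable {V}

/-- A linear isomorphism which is semilinear with respect to an automorphism of `L` commutes with
the Casimir element. -/
theorem casimir_apply_of_equiv {W : Type*} [AddCommGroup W] [Module F W] [LieRingModule L W]
    [LieModule F L W] (e : L ≃ₗ⁅F⁆ L) (φ : V →ₗ[F] W) (hφ : ∀ (x : L) (v : V), φ ⁅x, v⁆ = ⁅e x, φ v⁆)
    (v : V) : φ (casimir F L V v) = casimir F L W (φ v) := by
  rw [casimir_eq_sum_equiv W e, casimir]
  simp only [LinearMap.sum_apply, map_sum, Module.End.mul_apply, LieModule.toEnd_apply_apply, hφ]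

end Casimir

section Weights

variable {F : Type*} [Field F] [CharZero F] [IsAlgClosed F]
  {L : Type*} [LieRing L] [LieAlgebra F L] [FiniteDimensional F L] [LieAlgebra.IsSemisimple F L]
  {𝔥 : LieSubalgebra F L} [𝔥.IsCartanSubalgebra]

/-- `v` is a highest weight vector of weight `ν`. -/
structure IsHighestWeightVector (b : (rootSystem 𝔥).Base) (ν : Module.Dual F 𝔥) {V : Type*}
    [AddCommGroup V] [Module F V] [LieRingModule L V] (v : V) : Prop where
  ne_zero : v ≠ 0
  lie_eq : ∀ h : 𝔥, ⁅(h : L), v⁆ = ν h • v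
  lie_eq_zero : ∀ α : 𝔥.root, b.IsPos α → ∀ x ∈ rootSpace 𝔥 (α : LieModule.Weight F 𝔥 L),
    ⁅x, v⁆ = 0

open Classical in
/-- The sum of the positive roots. -/
def twoRho (b : (rootSystem 𝔥).Base) : Module.Dual F 𝔥 :=
  ∑ α : 𝔥.root with b.IsPos α, (rootSystem 𝔥).root α

/-- The scalar by which the Casimir element acts on a highest weight vector of weight `ν`. -/
def casimirScalar (b : (rootSystem 𝔥).Base) (ν : Module.Dual F 𝔥) : F :=
  ν ((cartanEquivDual 𝔥).symm (ν + twoRho b))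

theorem killingForm_cartanEquivDual_symm (ν : Module.Dual F 𝔥) (h : 𝔥) :
    killingForm F L ((cartanEquivDual 𝔥).symm ν : 𝔥) (h : L) = ν h :=
  LinearMap.BilinForm.apply_toDual_symm_apply (hB := traceForm_cartan_nondegenerate F L 𝔥) _ _

theorem apply_cartanEquivDual_symm_comm (ν η : Module.Dual F 𝔥) :
    ν ((cartanEquivDual 𝔥).symm η) = η ((cartanEquivDual 𝔥).symm ν) := by
  rw [← killingForm_cartanEquivDual_symm, ← killingForm_cartanEquivDual_symm,
    LieModule.traceForm_comm]

theorem exists_root_dual_pair (α : 𝔥.root) :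
    ∃ x ∈ rootSpace 𝔥 (α : LieModule.Weight F 𝔥 L),
      ∃ y ∈ rootSpace 𝔥 (-(α : LieModule.Weight F 𝔥 L) : 𝔥 → F), killingForm F L x y = 1 := by
  obtain ⟨x, hx, hx0⟩ := (α : LieModule.Weight F 𝔥 L).exists_ne_zero
  obtain ⟨y, hy, hxy⟩ : ∃ y ∈ rootSpace 𝔥 (-(α : LieModule.Weight F 𝔥 L) : 𝔥 → F),
      killingForm F L x y ≠ 0 := by
    contrapose! hx0
    simpa using mem_ker_killingForm_of_mem_rootSpace_of_forall_rootSpace_neg F L 𝔥 hx hx0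
  refine ⟨x, hx, (killingForm F L x y)⁻¹ • y, Submodule.smul_mem _ _ hy, ?_⟩
  rw [map_smul, smul_eq_mul, inv_mul_cancel₀ hxy]

theorem casimir_apply_highestWeightVector {b : (rootSystem 𝔥).Base} {ν : Module.Dual F 𝔥}
    {V : Type*} [AddCommGroup V] [Module F V] [LieRingModule L V] [LieModule F L V] {v : V}
    (hv : IsHighestWeightVector b ν v) : casimir F L V v = casimirScalar b ν • v := by
  classical
  choose x hx y hy hxy using exists_root_dual_pair (𝔥 := 𝔥)
  let B := LieModule.traceForm F 𝔥 L
  have hB : B.Nondegenerate := traceForm_cartan_nondegenerate F L 𝔥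
  let c := Module.finBasis F 𝔥
  let c' := LinearMap.BilinForm.dualBasis B hB c
  have hc : ∀ w : 𝔥, ∑ i, killingForm F L (c' i) (w : L) • c i = w := by
    intro w
    conv_rhs => rw [← c.sum_repr w]
    refine Finset.sum_congr rfl fun i _ => ?_
    congr 1
    exact bilinForm_dualBasis_apply hB c i w
  have hy0 : ∀ (α : 𝔥.root) (w : 𝔥), killingForm F L (y α) w = 0 := by
    intro α w
    refine killingForm_apply_eq_zero_of_mem_rootSpace_of_add_ne_zero F L 𝔥 (hy α)
      (β := 0) ?_ ?_
    · rw [rootSpace_zero_eq]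
      exact w.2
    · rw [add_zero, neg_ne_zero]
      exact LieSubalgebra.isNonZero_coe_root α
  have hdual : ∀ w, ∑ k, killingForm F L (Sum.elim (fun i => (c' i : L)) y k) w •
      Sum.elim (fun i => (c i : L)) x k = w := by
    have hlin : ∀ w, (∑ k, ((killingForm F L) (Sum.elim (fun i => (c' i : L)) y k)).smulRight
        (Sum.elim (fun i => (c i : L)) x k)) w = ∑ k, killingForm F L
          (Sum.elim (fun i => (c' i : L)) y k) w • Sum.elim (fun i => (c i : L)) x k := by
      intro w
      simp
    suffices h : (∑ k, ((killingForm F L) (Sum.elim (fun i => (c' i : L)) y k)).smulRight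
        (Sum.elim (fun i => (c i : L)) x k)) = LinearMap.id by
      intro w
      rw [← hlin, h, LinearMap.id_apply]
    have htop : (⊤ : Submodule F L) ≤ LinearMap.eqLocus (∑ k, ((killingForm F L)
        (Sum.elim (fun i => (c' i : L)) y k)).smulRight (Sum.elim (fun i => (c i : L)) x k))
        LinearMap.id := by
      have h := LieModule.iSup_genWeightSpace_eq_top' F 𝔥 L
      rw [← LieSubmodule.toSubmodule_inj, LieSubmodule.iSup_toSubmodule,
        LieSubmodule.top_toSubmodule] at h
      rw [← h]
      refine iSup_le fun β w hw => ?_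
      rw [LinearMap.mem_eqLocus, hlin, LinearMap.id_apply, Fintype.sum_sum_type]
      simp only [Sum.elim_inl, Sum.elim_inr]
      by_cases hβ : β.IsZero
      · have hw' : w ∈ rootSpace 𝔥 (0 : 𝔥 → F) := by rw [← hβ.eq]; exact hw
        rw [rootSpace_zero_eq] at hw'
        lift w to 𝔥 using hw'
        simp only [hy0, zero_smul, Finset.sum_const_zero, add_zero]
        conv_rhs => rw [← hc w]
        simp
      · have h1 : ∀ i, killingForm F L (c' i) w = 0 := fun i =>
          killingForm_apply_eq_zero_of_mem_rootSpace_of_add_ne_zero F L 𝔥 (α := 0)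
            (by rw [rootSpace_zero_eq]; exact (c' i).2) hw (by rw [zero_add]; exact hβ)
        let β' : 𝔥.root := ⟨β, by simpa using hβ⟩
        have h2 : ∀ α, α ≠ β' → killingForm F L (y α) w = 0 := fun α hα =>
          killingForm_apply_eq_zero_of_mem_rootSpace_of_add_ne_zero F L 𝔥 (hy α) hw (by
            intro h
            apply hα
            apply Subtype.ext
            have h' := neg_add_eq_zero.1 h
            exact DFunLike.coe_injective h')
        simp only [h1, zero_smul, Finset.sum_const_zero, zero_add]
        rw [Finset.sum_eq_single β' (fun α _ hα => by rw [h2 α hα, zero_smul]) (by simp)]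
        have hx0 : x β' ≠ 0 := by
          intro h
          have := hxy β'
          rw [h] at this
          simp at this
        obtain ⟨r, hr⟩ := (finrank_eq_one_iff_of_nonzero' (⟨x β', hx β'⟩ : rootSpace 𝔥 β)
          (by simpa using hx0)).1 (finrank_rootSpace_eq_one β hβ) ⟨w, hw⟩
        have hr : r • x β' = w := congrArg Subtype.val hr
        rw [← hr, map_smul, LieModule.traceForm_comm, hxy, smul_eq_mul, mul_one]
    exact LinearMap.ext fun w => htop (trivial : w ∈ ⊤)
  rw [casimir_eq_sum V _ _ hdual, LinearMap.sum_apply, Fintype.sum_sum_type]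
  simp only [Sum.elim_inl, Sum.elim_inr, Module.End.mul_apply, LieModule.toEnd_apply_apply]
  have h1 : ∑ i, ⁅(c i : L), ⁅(c' i : L), v⁆⁆ = ν ((cartanEquivDual 𝔥).symm ν) • v := by
    simp only [hv.lie_eq, lie_smul, smul_smul]
    rw [← Finset.sum_smul]
    congr 1
    have : (cartanEquivDual 𝔥).symm ν = ∑ i, ν (c i) • c' i := by
      rw [← c'.sum_repr ((cartanEquivDual 𝔥).symm ν)]
      refine Finset.sum_congr rfl fun i _ => ?_
      rw [LinearMap.BilinForm.dualBasis_repr_apply]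
      congr 1
      exact killingForm_cartanEquivDual_symm ν (c i)
    rw [this, map_sum]
    simp only [map_smul, smul_eq_mul, mul_comm]
  have h2 : ∀ α : 𝔥.root, ⁅x α, ⁅y α, v⁆⁆ =
      if b.IsPos α then ν ((cartanEquivDual 𝔥).symm ((rootSystem 𝔥).root α)) • v else 0 := by
    intro α
    split_ifs with hα
    · rw [leibniz_lie, hv.lie_eq_zero α hα _ (hx α), lie_zero, add_zero,
        lie_eq_killingForm_smul_of_mem_rootSpace_of_mem_rootSpace_neg (hx α) (hy α), hxy, one_smul,
        hv.lie_eq]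
      rfl
    · have hneg := (RootPairing.Base.IsPos.or_neg b α).resolve_left hα
      have h0 : ⁅y α, v⁆ = 0 := by
        refine hv.lie_eq_zero _ hneg _ ?_
        have := (rootSystem 𝔥).root_reflectionPerm α α
        rw [RootPairing.reflection_apply_self] at this
        convert hy α using 2
        funext h
        exact LinearMap.congr_fun this h
      rw [h0, lie_zero]
  rw [h1]
  simp only [h2]
  rw [casimirScalar, map_add, map_add, add_smul, twoRho, map_sum, map_sum, Finset.sum_smul,
    Finset.sum_ite, Finset.sum_const_zero, add_zero]

end Weights

end GradedBrauer

end

noncomputable section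

attribute [local instance] LieRing.ofAssociativeRing

universe u v w

set_option linter.unusedSectionVars false

namespace GradedBrauer

open LieAlgebra LieAlgebra.IsKilling

section PosRat

variable {F : Type*} [Field F] [CharZero F]

/-- `x` is a positive rational number. -/
def IsPosRat (x : F) : Prop := ∃ q : ℚ, 0 < q ∧ (q : F) = x

theorem IsPosRat.add {x y : F} (hx : IsPosRat x) (hy : IsPosRat y) : IsPosRat (x + y) := by
  obtain ⟨p, hp, rfl⟩ := hx
  obtain ⟨q, hq, rfl⟩ := hy
  exact ⟨p + q, add_pos hp hq, by push_cast; rfl⟩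

theorem IsPosRat.ne_zero {x : F} (hx : IsPosRat x) : x ≠ 0 := by
  obtain ⟨p, hp, rfl⟩ := hx
  exact_mod_cast hp.ne'

end PosRat

section Weights

variable {F : Type*} [Field F] [CharZero F] [IsAlgClosed F]
  {L : Type*} [LieRing L] [LieAlgebra F L] [FiniteDimensional F L] [LieAlgebra.IsSemisimple F L]
  {𝔥 : LieSubalgebra F L} [𝔥.IsCartanSubalgebra]

theorem isPosRat_root_norm (α : 𝔥.root) :
    IsPosRat ((rootSystem 𝔥).root α ((cartanEquivDual 𝔥).symm ((rootSystem 𝔥).root α))) := by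
  have h1 := traceForm_coroot (α : LieModule.Weight F 𝔥 L) (coroot (α : LieModule.Weight F 𝔥 L))
  rw [root_apply_coroot (LieSubalgebra.isNonZero_coe_root α)] at h1
  have h2 : LieModule.traceForm F 𝔥 L (coroot (α : LieModule.Weight F 𝔥 L))
      (coroot (α : LieModule.Weight F 𝔥 L)) =
      ∑ β ∈ 𝔥.root, (β (coroot (α : LieModule.Weight F 𝔥 L))) ^ 2 := by
    have := LinearMap.congr_fun₂ (restrict_killingForm_eq_sum (K := F) (L := L) (H := 𝔥))
      (coroot (α : LieModule.Weight F 𝔥 L)) (coroot (α : LieModule.Weight F 𝔥 L))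
    rw [restrict_killingForm] at this
    rw [this]
    simp only [pow_two, LinearMap.sum_apply, LinearMap.smulRight_apply, LinearMap.smul_apply,
      smul_eq_mul]
    rfl
  have h3 : ∀ β : LieModule.Weight F 𝔥 L, ∃ n : ℤ, β (coroot (α : LieModule.Weight F 𝔥 L)) = n :=
    fun β => ⟨_, apply_coroot_eq_cast' _ β⟩
  choose n hn using h3
  have hnα : n α = 2 := by
    have := root_apply_coroot (LieSubalgebra.isNonZero_coe_root α)
    rw [hn] at this
    exact_mod_cast this
  have hpos : 0 < ∑ β ∈ 𝔥.root, (n β : ℚ) ^ 2 :=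
    Finset.sum_pos' (fun β _ => sq_nonneg _) ⟨α, α.2, by rw [hnα]; norm_num⟩
  have hne := root_apply_cartanEquivDual_symm_ne_zero (LieSubalgebra.isNonZero_coe_root α)
  refine ⟨4 / ∑ β ∈ 𝔥.root, (n β : ℚ) ^ 2, by positivity, ?_⟩
  have h4 : ((∑ β ∈ 𝔥.root, (n β : ℚ) ^ 2 : ℚ) : F) =
      LieModule.traceForm F 𝔥 L (coroot (α : LieModule.Weight F 𝔥 L))
        (coroot (α : LieModule.Weight F 𝔥 L)) := by
    rw [h2]
    push_cast
    exact Finset.sum_congr rfl fun β _ => by rw [hn]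
  rw [Rat.cast_div, h4, h1]
  simp only [nsmul_eq_mul, smul_eq_mul, Nat.cast_ofNat, Rat.cast_ofNat]
  change _ = (α : LieModule.Weight F 𝔥 L) ((cartanEquivDual 𝔥).symm (α : LieModule.Weight F 𝔥 L))
  field_simp
  norm_num

theorem apply_cartanEquivDual_symm_root (η : Module.Dual F 𝔥) (α : 𝔥.root) :
    η ((cartanEquivDual 𝔥).symm ((rootSystem 𝔥).root α)) = η ((rootSystem 𝔥).coroot α) *
      ((rootSystem 𝔥).root α ((cartanEquivDual 𝔥).symm ((rootSystem 𝔥).root α)) / 2) := by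
  have hne := root_apply_cartanEquivDual_symm_ne_zero (LieSubalgebra.isNonZero_coe_root α)
  change _ = η (2 • ((α : LieModule.Weight F 𝔥 L) ((cartanEquivDual 𝔥).symm
    (α : LieModule.Weight F 𝔥 L)))⁻¹ • (cartanEquivDual 𝔥).symm (α : LieModule.Weight F 𝔥 L)) *
    ((α : LieModule.Weight F 𝔥 L) ((cartanEquivDual 𝔥).symm (α : LieModule.Weight F 𝔥 L)) / 2)
  rw [map_nsmul, map_smul]
  simp only [nsmul_eq_mul, smul_eq_mul, Nat.cast_ofNat]
  field_simp
  rfl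

theorem twoRho_coroot {b : (rootSystem 𝔥).Base} {i : 𝔥.root} (hi : i ∈ b.support) :
    twoRho b ((rootSystem 𝔥).coroot i) = 2 := by
  classical
  have hsum : twoRho b ((rootSystem 𝔥).coroot i) =
      ∑ α : 𝔥.root with b.IsPos α, (rootSystem 𝔥).pairing α i := by
    rw [twoRho, LinearMap.sum_apply]
    refine Finset.sum_congr (by congr) fun α _ => ?_
    rfl
  rw [hsum, ← Finset.add_sum_erase _ _
    (Finset.mem_filter.2 ⟨Finset.mem_univ i, b.isPos_of_mem_support hi⟩),
    RootPairing.pairing_same]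
  rw [add_eq_left]
  have hneg : ∀ α, (rootSystem 𝔥).pairing ((rootSystem 𝔥).reflectionPerm i α) i =
      -(rootSystem 𝔥).pairing α i := fun α => by
    rw [← RootPairing.pairing_reflectionPerm, RootPairing.pairing_reflectionPerm_self_right]
  refine Finset.sum_involution (fun α _ => (rootSystem 𝔥).reflectionPerm i α) ?_ ?_ ?_ ?_
  · intro α _
    rw [hneg, add_neg_cancel]
  · intro α _ hne h
    have := hneg α
    rw [h] at this
    exact hne (self_eq_neg.1 this)
  · intro α hα
    simp only [Finset.mem_erase, Finset.mem_filter, Finset.mem_univ, true_and] at hα ⊢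
    refine ⟨fun h => ?_, hα.2.reflectionPerm hi hα.1⟩
    have h2 : α = (rootSystem 𝔥).reflectionPerm i i := by
      rw [← RootPairing.reflectionPerm_self (rootSystem 𝔥) i α, h]
    have h3 := (RootPairing.Base.IsPos.neg_iff_not b i).1 (by
      change b.IsPos ((rootSystem 𝔥).reflectionPerm i i)
      rw [← h2]
      exact hα.2)
    exact h3 (b.isPos_of_mem_support hi)
  · intro α _
    exact RootPairing.reflectionPerm_self _ _ _

theorem isPosRat_apply {b : (rootSystem 𝔥).Base} {η : Module.Dual F 𝔥}
    (hη : IsDominantIntegral b η) {i : 𝔥.root} (hi : i ∈ b.support) :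
    IsPosRat ((rootSystem 𝔥).root i ((cartanEquivDual 𝔥).symm (η + twoRho b))) := by
  obtain ⟨n, hn⟩ := hη i hi
  obtain ⟨q, hq, hq'⟩ := isPosRat_root_norm i
  rw [apply_cartanEquivDual_symm_comm, apply_cartanEquivDual_symm_root, LinearMap.add_apply, hn,
    twoRho_coroot hi, ← hq']
  exact ⟨(n + 2) * (q / 2), by positivity, by push_cast; rfl⟩

/-- The monoid generated by the simple roots. -/
def posCone (b : (rootSystem 𝔥).Base) : AddSubmonoid (Module.Dual F 𝔥) :=
  AddSubmonoid.closure ((rootSystem 𝔥).root '' b.support)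

theorem root_mem_posCone {b : (rootSystem 𝔥).Base} {α : 𝔥.root} (hα : b.IsPos α) :
    (rootSystem 𝔥).root α ∈ posCone b := by
  refine RootPairing.Base.IsPos.induction_on_add hα
    (p := fun α => (rootSystem 𝔥).root α ∈ posCone b)
    (fun i hi => AddSubmonoid.subset_closure ⟨i, hi, rfl⟩) fun i j k hk hi hj => ?_
  rw [hk]
  exact add_mem hi (AddSubmonoid.subset_closure ⟨j, hj, rfl⟩)

theorem eq_zero_or_isPosRat {b : (rootSystem 𝔥).Base} {h : 𝔥}
    (hh : ∀ i ∈ b.support, IsPosRat ((rootSystem 𝔥).root i h)) {δ : Module.Dual F 𝔥}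
    (hδ : δ ∈ posCone b) : δ = 0 ∨ IsPosRat (δ h) := by
  induction hδ using AddSubmonoid.closure_induction with
  | mem x hx =>
    obtain ⟨i, hi, rfl⟩ := hx
    exact Or.inr (hh i hi)
  | zero => exact Or.inl rfl
  | add x y _ _ hx hy =>
    rcases hx with rfl | hx
    · simpa using hy
    · rcases hy with rfl | hy
      · right
        simpa using hx
      · right
        rw [LinearMap.add_apply]
        exact hx.add hy

theorem isDominantIntegral_zero (b : (rootSystem 𝔥).Base) : IsDominantIntegral b 0 :=
  fun _ _ => ⟨0, by simp⟩

theorem isPosRat_twoRho {b : (rootSystem 𝔥).Base} {i : 𝔥.root} (hi : i ∈ b.support) :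
    IsPosRat ((rootSystem 𝔥).root i ((cartanEquivDual 𝔥).symm (twoRho b))) := by
  have := isPosRat_apply (isDominantIntegral_zero b) hi
  rwa [zero_add] at this

theorem isPosRat_root_twoRho {b : (rootSystem 𝔥).Base} {α : 𝔥.root} (hα : b.IsPos α) :
    IsPosRat ((rootSystem 𝔥).root α ((cartanEquivDual 𝔥).symm (twoRho b))) :=
  (eq_zero_or_isPosRat (fun _ => isPosRat_twoRho) (root_mem_posCone hα)).resolve_left
    ((rootSystem 𝔥).ne_zero α)

theorem add_root_ne_zero {b : (rootSystem 𝔥).Base} {δ : Module.Dual F 𝔥} (hδ : δ ∈ posCone b)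
    {α : 𝔥.root} (hα : b.IsPos α) : δ + (rootSystem 𝔥).root α ≠ 0 := by
  intro h
  rcases eq_zero_or_isPosRat (fun _ => isPosRat_twoRho) hδ with rfl | h1
  · rw [zero_add] at h
    exact (rootSystem 𝔥).ne_zero α h
  · have h2 := (h1.add (isPosRat_root_twoRho hα)).ne_zero
    rw [← LinearMap.add_apply, h] at h2
    exact h2 rfl

theorem IsDominantIntegral.add {b : (rootSystem 𝔥).Base} {ν η : Module.Dual F 𝔥}
    (hν : IsDominantIntegral b ν) (hη : IsDominantIntegral b η) : IsDominantIntegral b (ν + η) := by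
  intro α hα
  obtain ⟨m, hm⟩ := hν α hα
  obtain ⟨n, hn⟩ := hη α hα
  exact ⟨m + n, by rw [LinearMap.add_apply, hm, hn]; push_cast; rfl⟩

/-- Comparable dominant integral weights with the same Casimir scalar are equal. -/
theorem eq_of_casimirScalar_eq {b : (rootSystem 𝔥).Base} {ν η : Module.Dual F 𝔥}
    (hν : IsDominantIntegral b ν) (hη : IsDominantIntegral b η) (h : η - ν ∈ posCone b)
    (hc : casimirScalar b η = casimirScalar b ν) : η = ν := by
  rcases eq_zero_or_isPosRat (fun _ => isPosRat_apply (hη.add hν)) h with h0 | h0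
  · exact sub_eq_zero.1 h0
  · refine absurd ?_ h0.ne_zero
    rw [casimirScalar, casimirScalar, ← sub_eq_zero] at hc
    rw [← hc]
    simp only [map_add, LinearMap.sub_apply]
    rw [apply_cartanEquivDual_symm_comm η ν]
    ring

theorem exists_highestWeightVector (b : (rootSystem 𝔥).Base) (V : Type*) [AddCommGroup V]
    [Module F V] [LieRingModule L V] [LieModule F L V] [FiniteDimensional F V] [Nontrivial V] :
    ∃ (ν : Module.Dual F 𝔥) (v : V), IsHighestWeightVector b ν v := by
  let t : 𝔥 := (cartanEquivDual 𝔥).symm (twoRho b)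
  let r : LieModule.Weight F 𝔥 V → LieModule.Weight F 𝔥 V → Prop :=
    fun χ χ' => IsPosRat (χ t - χ' t)
  have : IsTrans _ r := ⟨fun a b c hab hbc => by
    have := IsPosRat.add hab hbc
    rwa [sub_add_sub_cancel] at this⟩
  have : Std.Irrefl r := ⟨fun a ha => ha.ne_zero (sub_self _)⟩
  have hne : Nonempty (LieModule.Weight F 𝔥 V) := by
    by_contra! contra
    simpa only [iSup_of_empty, bot_ne_top] using LieModule.iSup_genWeightSpace_eq_top' F 𝔥 V
  obtain ⟨χ, -, hχ⟩ := (Finite.wellFounded_of_trans_of_irrefl r).has_min Set.univ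
    Set.univ_nonempty
  obtain ⟨v, hv0, hv⟩ := LieModule.exists_forall_lie_eq_smul F 𝔥 V χ
  refine ⟨χ.toLinear, v, hv0, fun h => hv h, fun α hα x hx => ?_⟩
  have hvχ : v ∈ LieModule.genWeightSpace V (χ : 𝔥 → F) :=
    LieModule.weightSpace_le_genWeightSpace V _ ((LieModule.mem_weightSpace _ v).2 hv)
  have hmem := lie_mem_genWeightSpace_of_mem_genWeightSpace hx hvχ
  by_contra hxv
  let χ' : LieModule.Weight F 𝔥 V := ⟨((α : LieModule.Weight F 𝔥 L) : 𝔥 → F) + χ, fun hbot => by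
    rw [hbot] at hmem
    exact hxv hmem⟩
  refine hχ χ' trivial ?_
  change IsPosRat ((α : LieModule.Weight F 𝔥 L) t + χ t - χ t)
  rw [add_sub_cancel_right]
  exact isPosRat_root_twoRho hα

theorem IsHighestWeightVector.isDominantIntegral {b : (rootSystem 𝔥).Base} {ν : Module.Dual F 𝔥}
    {V : Type*} [AddCommGroup V] [Module F V] [LieRingModule L V] [LieModule F L V]
    [FiniteDimensional F V] {v : V} (hv : IsHighestWeightVector b ν v) :
    IsDominantIntegral b ν := by
  intro α hα
  have hnz := LieSubalgebra.isNonZero_coe_root α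
  obtain ⟨h, e, f, ht, he, hf⟩ := exists_isSl2Triple_of_weight_isNonZero hnz
  have hh := ht.h_eq_coroot hnz he hf
  have P : ht.HasPrimitiveVectorWith v (ν ((rootSystem 𝔥).coroot α)) :=
    ⟨hv.ne_zero, by rw [hh]; exact hv.lie_eq _,
      hv.lie_eq_zero α (b.isPos_of_mem_support hα) e he⟩
  exact P.exists_nat

end Weights

end GradedBrauer

end

noncomputable section

attribute [local instance] LieRing.ofAssociativeRing

universe u v w

set_option linter.unusedSectionVars false

namespace GradedBrauer

open LieAlgebra LieAlgebra.IsKilling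

theorem tmul_ne_zero {F : Type*} [Field F] {V : Type*} [AddCommGroup V] [Module F V]
    {W : Type*} [AddCommGroup W] [Module F W] {v : V} {w : W} (hv : v ≠ 0) (hw : w ≠ 0) : v ⊗ₜ[F] w ≠ 0 := by
  intro h
  obtain ⟨f, hf⟩ := not_forall.1 (mt (Module.forall_dual_apply_eq_zero_iff F v).1 hv)
  obtain ⟨g, hg⟩ := not_forall.1 (mt (Module.forall_dual_apply_eq_zero_iff F w).1 hw)
  have := congrArg (TensorProduct.lift ((LinearMap.mul F F).compl₁₂ f g)) h
  rw [TensorProduct.lift.tmul, map_zero] at this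
  exact (mul_ne_zero hf hg) this

section Weights

variable {F : Type*} [Field F] [CharZero F] [IsAlgClosed F]
  {L : Type*} [LieRing L] [LieAlgebra F L] [FiniteDimensional F L] [LieAlgebra.IsSemisimple F L]
  {𝔥 : LieSubalgebra F L} [𝔥.IsCartanSubalgebra]

section WeightSpace

variable (V : Type*) [AddCommGroup V] [Module F V] [LieRingModule L V] [LieModule F L V]

/-- The space of vectors of weight `ν`. -/
def wtSpace (ν : Module.Dual F 𝔥) : Submodule F V :=
  simEigenspace (fun h : 𝔥 => LieModule.toEnd F L V h) (fun h (ν : Module.Dual F 𝔥) => ν h) ν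

variable {V}

theorem mem_wtSpace {ν : Module.Dual F 𝔥} {v : V} :
    v ∈ wtSpace V ν ↔ ∀ h : 𝔥, ⁅(h : L), v⁆ = ν h • v := Iff.rfl

variable (V) in
theorem iSupIndep_wtSpace : iSupIndep (wtSpace V : Module.Dual F 𝔥 → Submodule F V) :=
  iSupIndep_simEigenspace _ _ fun ν η h => by
    contrapose! h
    exact LinearMap.ext h

variable (V) in
/-- The sum of the weight spaces for the weights strictly below `ν`. -/
def lowerSpace (b : (rootSystem 𝔥).Base) (ν : Module.Dual F 𝔥) : Submodule F V :=
  ⨆ δ : {δ // δ ∈ posCone b ∧ δ ≠ 0}, wtSpace V (ν - (δ : Module.Dual F 𝔥))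

theorem mem_lowerSpace {b : (rootSystem 𝔥).Base} {ν δ : Module.Dual F 𝔥} (hδ : δ ∈ posCone b)
    (hδ0 : δ ≠ 0) {v : V} (hv : v ∈ wtSpace V (ν - δ)) : v ∈ lowerSpace V b ν :=
  Submodule.mem_iSup_of_mem (p := fun δ : {δ // δ ∈ posCone b ∧ δ ≠ 0} =>
    wtSpace V (ν - (δ : Module.Dual F 𝔥))) ⟨δ, hδ, hδ0⟩ hv

theorem lowerSpace_le (b : (rootSystem 𝔥).Base) (ν : Module.Dual F 𝔥) :
    lowerSpace V b ν ≤ ⨆ (η : Module.Dual F 𝔥) (_ : η ≠ ν), wtSpace V η :=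
  iSup_le fun δ => le_iSup₂_of_le (ν - δ.1) (by simpa using δ.2.2) le_rfl

/-- `V` is spanned by the vector `v` of weight `ν` and weight vectors of lower weight. -/
structure IsTop (b : (rootSystem 𝔥).Base) (ν : Module.Dual F 𝔥) (v : V) : Prop where
  mem : v ∈ wtSpace V ν
  sup_eq_top : Submodule.span F {v} ⊔ lowerSpace V b ν = ⊤

theorem mem_span_of_mem_sup {b : (rootSystem 𝔥).Base} {ν : Module.Dual F 𝔥} {v w : V}
    (hv : v ∈ wtSpace V ν) (hw : w ∈ wtSpace V ν)
    (h : w ∈ Submodule.span F {v} ⊔ lowerSpace V b ν) : w ∈ Submodule.span F {v} := by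
  obtain ⟨y, hy, z, hz, rfl⟩ := Submodule.mem_sup.1 h
  have hy' : y ∈ wtSpace V ν := (Submodule.span_singleton_le_iff_mem _ _).2 hv hy
  have hz' : z ∈ wtSpace V ν := by simpa using sub_mem hw hy'
  have : z = 0 := Submodule.disjoint_def.1 (iSupIndep_wtSpace V ν) z hz' (lowerSpace_le b ν hz)
  rw [this, add_zero]
  exact hy

theorem IsTop.sub_mem_posCone {b : (rootSystem 𝔥).Base} {ν η : Module.Dual F 𝔥} {v w : V}
    (hv : IsTop b ν v) (hw : w ∈ wtSpace V η) (hw0 : w ≠ 0) : ν - η ∈ posCone b := by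
  by_contra hη
  refine hw0 (Submodule.disjoint_def.1 (iSupIndep_wtSpace V η) w hw ?_)
  have h : (⊤ : Submodule F V) ≤ ⨆ (ξ : Module.Dual F 𝔥) (_ : ξ ≠ η), wtSpace V ξ := by
    rw [← hv.sup_eq_top, sup_le_iff, Submodule.span_singleton_le_iff_mem]
    constructor
    · refine (le_iSup₂_of_le ν ?_ le_rfl : wtSpace V ν ≤ _) hv.mem
      rintro rfl
      exact hη (by rw [sub_self]; exact zero_mem _)
    · refine iSup_le fun δ => le_iSup₂_of_le (ν - δ.1) ?_ le_rfl
      rintro rfl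
      exact hη (by rw [sub_sub_cancel]; exact δ.2.1)
  exact h trivial

theorem lie_mem_wtSpace {α : 𝔥.root} {x : L}
    (hx : x ∈ rootSpace 𝔥 (α : LieModule.Weight F 𝔥 L)) {ν : Module.Dual F 𝔥} {v : V}
    (hv : v ∈ wtSpace V ν) : ⁅x, v⁆ ∈ wtSpace V (ν + (rootSystem 𝔥).root α) := by
  refine mem_wtSpace.2 fun h => ?_
  have h1 := mem_wtSpace.1 hv h
  have h2 : ⁅(h : L), x⁆ = (rootSystem 𝔥).root α h • x := lie_eq_smul_of_mem_rootSpace hx h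
  rw [leibniz_lie, h1, h2, LinearMap.add_apply, add_smul, smul_lie, lie_smul, add_comm]

theorem neg_root_mem_posCone {b : (rootSystem 𝔥).Base} {α : 𝔥.root} (hα : ¬ b.IsPos α) :
    ∃ β : 𝔥.root, b.IsPos β ∧ (rootSystem 𝔥).root β = -(rootSystem 𝔥).root α := by
  have hneg := (RootPairing.Base.IsPos.or_neg b α).resolve_left hα
  refine ⟨_, hneg, ?_⟩
  have := (rootSystem 𝔥).root_reflectionPerm α α
  rwa [RootPairing.reflection_apply_self] at this

theorem forall_of_rootSpace {p : Submodule F L} (h0 : ∀ h : 𝔥, (h : L) ∈ p)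
    (h1 : ∀ α : 𝔥.root, ∀ x ∈ rootSpace 𝔥 (α : LieModule.Weight F 𝔥 L), x ∈ p) (x : L) :
    x ∈ p := by
  have h := LieModule.iSup_genWeightSpace_eq_top' F 𝔥 L
  rw [← LieSubmodule.toSubmodule_inj, LieSubmodule.iSup_toSubmodule,
    LieSubmodule.top_toSubmodule] at h
  have hle : (⊤ : Submodule F L) ≤ p := by
    rw [← h]
    refine iSup_le fun β w hw => ?_
    by_cases hβ : β.IsZero
    · have hw' : w ∈ rootSpace 𝔥 (0 : 𝔥 → F) := by rw [← hβ.eq]; exact hw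
      rw [rootSpace_zero_eq] at hw'
      exact h0 ⟨w, hw'⟩
    · exact h1 ⟨β, by simpa using hβ⟩ w hw
  exact hle trivial

theorem IsHighestWeightVector.mem_wtSpace {b : (rootSystem 𝔥).Base} {ν : Module.Dual F 𝔥} {v : V}
    (hv : IsHighestWeightVector b ν v) : v ∈ wtSpace V ν := fun h => hv.lie_eq h

theorem IsHighestWeightVector.exists_lieSubmodule {b : (rootSystem 𝔥).Base}
    {ν : Module.Dual F 𝔥} {v : V} (hv : IsHighestWeightVector b ν v) :
    ∃ N : LieSubmodule F L V, v ∈ N ∧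
      N.toSubmodule ≤ Submodule.span F {v} ⊔ lowerSpace V b ν := by
  let S : Set (Submodule F V) := {N | v ∈ N ∧ ∀ α : 𝔥.root, ¬ b.IsPos α →
    ∀ y ∈ rootSpace 𝔥 (α : LieModule.Weight F 𝔥 L), ∀ w ∈ N, ⁅y, w⁆ ∈ N}
  have hS : sInf S ∈ S := ⟨Submodule.mem_sInf.2 fun N hN => hN.1, fun α hα y hy w hw =>
    Submodule.mem_sInf.2 fun N hN => hN.2 α hα y hy w (Submodule.mem_sInf.1 hw N hN)⟩
  let M : Submodule F V :=
    { carrier := {w | ∀ x : L, ⁅x, w⁆ ∈ sInf S}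
      zero_mem' := fun x => by rw [lie_zero]; exact zero_mem _
      add_mem' := fun ha hb x => by rw [lie_add]; exact add_mem (ha x) (hb x)
      smul_mem' := fun c a ha x => by rw [lie_smul]; exact Submodule.smul_mem _ _ (ha x) }
  have hvM : v ∈ M := by
    intro x
    refine forall_of_rootSpace (𝔥 := 𝔥) (p := (sInf S).comap
      ((LieModule.toEnd F L V).toLinearMap.flip v)) (fun h => ?_) (fun α x hx => ?_) x
    · change ⁅(h : L), v⁆ ∈ sInf S
      rw [hv.lie_eq]
      exact Submodule.smul_mem _ _ hS.1
    · change ⁅x, v⁆ ∈ sInf S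
      by_cases hα : b.IsPos α
      · rw [hv.lie_eq_zero α hα x hx]
        exact zero_mem _
      · exact hS.2 α hα x hx v hS.1
  have hM : sInf S ≤ M ⊓ sInf S := by
    refine sInf_le ⟨⟨hvM, hS.1⟩, fun α hα y hy w hw => ⟨fun x => ?_, hS.2 α hα y hy w hw.2⟩⟩
    rw [leibniz_lie]
    exact add_mem (hw.1 _) (hS.2 α hα y hy _ (hw.1 x))
  refine ⟨{ sInf S with lie_mem := fun {x m} hm => (hM hm).1 x }, hS.1, sInf_le ⟨?_, ?_⟩⟩
  · exact Submodule.mem_sup_left (Submodule.mem_span_singleton_self v)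
  · intro α hα y hy w hw
    obtain ⟨β, hβ, hβα⟩ := neg_root_mem_posCone hα
    have hβ' := root_mem_posCone hβ
    suffices h : Submodule.span F {v} ⊔ lowerSpace V b ν ≤
        (lowerSpace V b ν).comap (LieModule.toEnd F L V y) from Submodule.mem_sup_right (h hw)
    rw [sup_le_iff, Submodule.span_singleton_le_iff_mem]
    constructor
    · refine mem_lowerSpace hβ' ((rootSystem 𝔥).ne_zero β) ?_
      rw [hβα, sub_neg_eq_add]
      exact lie_mem_wtSpace hy hv.mem_wtSpace
    · refine iSup_le fun δ w hw => ?_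
      refine mem_lowerSpace (add_mem δ.2.1 hβ') (add_root_ne_zero δ.2.1 hβ) ?_
      rw [hβα, ← sub_sub, sub_neg_eq_add]
      exact lie_mem_wtSpace hy hw

theorem IsHighestWeightVector.isTop {b : (rootSystem 𝔥).Base} {ν : Module.Dual F 𝔥} {v : V}
    (hv : IsHighestWeightVector b ν v) (hV : LieModule.IsIrreducible F L V) : IsTop b ν v := by
  obtain ⟨N, hvN, hN⟩ := hv.exists_lieSubmodule
  refine ⟨hv.mem_wtSpace, ?_⟩
  rcases eq_bot_or_eq_top N with h | h
  · rw [h, LieSubmodule.mem_bot] at hvN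
    exact absurd hvN hv.ne_zero
  · rw [h, LieSubmodule.top_toSubmodule] at hN
    exact top_le_iff.1 hN

end WeightSpace

section Tensor

variable {V : Type*} [AddCommGroup V] [Module F V] [LieRingModule L V] [LieModule F L V]
  {W : Type*} [AddCommGroup W] [Module F W] [LieRingModule L W] [LieModule F L W]

theorem tmul_mem_wtSpace {ν η : Module.Dual F 𝔥} {v : V} {w : W} (hv : v ∈ wtSpace V ν)
    (hw : w ∈ wtSpace W η) : v ⊗ₜ[F] w ∈ wtSpace (V ⊗[F] W) (ν + η) := by
  refine mem_wtSpace.2 fun h => ?_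
  rw [TensorProduct.LieModule.lie_tmul_right, mem_wtSpace.1 hv, mem_wtSpace.1 hw,
    ← TensorProduct.smul_tmul', TensorProduct.tmul_smul, LinearMap.add_apply, add_smul]

theorem IsHighestWeightVector.tmul {b : (rootSystem 𝔥).Base} {ν η : Module.Dual F 𝔥} {v : V}
    {w : W} (hv : IsHighestWeightVector b ν v) (hw : IsHighestWeightVector b η w) :
    IsHighestWeightVector b (ν + η) (v ⊗ₜ[F] w) := by
  refine ⟨?_, tmul_mem_wtSpace hv.mem_wtSpace hw.mem_wtSpace, fun α hα x hx => ?_⟩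
  · exact tmul_ne_zero hv.ne_zero hw.ne_zero
  · rw [TensorProduct.LieModule.lie_tmul_right, hv.lie_eq_zero α hα x hx,
      hw.lie_eq_zero α hα x hx, TensorProduct.zero_tmul, TensorProduct.tmul_zero, add_zero]

theorem posCone_add_ne_zero {b : (rootSystem 𝔥).Base} {δ ε : Module.Dual F 𝔥}
    (hδ : δ ∈ posCone b) (hε : ε ∈ posCone b) (hδ0 : δ ≠ 0) : δ + ε ≠ 0 := by
  intro h
  have h1 := (eq_zero_or_isPosRat (fun _ => isPosRat_twoRho) hδ).resolve_left hδ0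
  rcases eq_zero_or_isPosRat (fun _ => isPosRat_twoRho) hε with rfl | h2
  · exact hδ0 (by simpa using h)
  · have := (h1.add h2).ne_zero
    rw [← LinearMap.add_apply, h] at this
    exact this rfl

theorem IsTop.tmul {b : (rootSystem 𝔥).Base} {ν η : Module.Dual F 𝔥} {v : V}
    {w : W} (hv : IsTop b ν v) (hw : IsTop b η w) : IsTop b (ν + η) (v ⊗ₜ[F] w) := by
  refine ⟨tmul_mem_wtSpace hv.mem hw.mem, ?_⟩
  rw [eq_top_iff, ← TensorProduct.map₂_mk_top_top_eq_top, ← hv.sup_eq_top, ← hw.sup_eq_top,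
    Submodule.map₂_sup_left, Submodule.map₂_sup_right, Submodule.map₂_sup_right]
  refine sup_le (sup_le ?_ (le_sup_of_le_right ?_))
    (sup_le (le_sup_of_le_right ?_) (le_sup_of_le_right ?_))
  · rw [Submodule.map₂_span_span]
    simp
  · rw [lowerSpace, Submodule.map₂_iSup_right]
    refine iSup_le fun δ => Submodule.map₂_le.2 fun x hx y hy =>
      mem_lowerSpace δ.2.1 δ.2.2 ?_
    rw [add_sub_assoc]
    exact tmul_mem_wtSpace ((Submodule.span_singleton_le_iff_mem _ _).2 hv.mem hx) hy
  · rw [lowerSpace, Submodule.map₂_iSup_left]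
    refine iSup_le fun δ => Submodule.map₂_le.2 fun x hx y hy =>
      mem_lowerSpace δ.2.1 δ.2.2 ?_
    rw [add_sub_right_comm]
    exact tmul_mem_wtSpace hx ((Submodule.span_singleton_le_iff_mem _ _).2 hw.mem hy)
  · rw [lowerSpace, lowerSpace, Submodule.map₂_iSup_left]
    refine iSup_le fun δ => ?_
    rw [Submodule.map₂_iSup_right]
    refine iSup_le fun ε => Submodule.map₂_le.2 fun x hx y hy =>
      mem_lowerSpace (add_mem δ.2.1 ε.2.1) (posCone_add_ne_zero δ.2.1 ε.2.1 δ.2.2) ?_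
    rw [add_sub_add_comm]
    exact tmul_mem_wtSpace hx hy

end Tensor

end Weights

end GradedBrauer

end

noncomputable section

attribute [local instance] LieRing.ofAssociativeRing

universe u v w

set_option linter.unusedSectionVars false

namespace GradedBrauer

open LieAlgebra LieAlgebra.IsKilling

section Prod

variable {F : Type*} [Field F] {L : Type*} [LieRing L] [LieAlgebra F L]
  {V : Type*} [AddCommGroup V] [Module F V] [LieRingModule L V] [LieModule F L V]
  {W : Type*} [AddCommGroup W] [Module F W] [LieRingModule L W] [LieModule F L W]

instance prodLieRingModule : LieRingModule L (V × W) where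
  bracket x p := (⁅x, p.1⁆, ⁅x, p.2⁆)
  add_lie x y p := Prod.ext (add_lie x y p.1) (add_lie x y p.2)
  lie_add x p q := Prod.ext (lie_add x p.1 q.1) (lie_add x p.2 q.2)
  leibniz_lie x y p := Prod.ext (leibniz_lie x y p.1) (leibniz_lie x y p.2)

theorem lie_prod (x : L) (p : V × W) : ⁅x, p⁆ = (⁅x, p.1⁆, ⁅x, p.2⁆) := rfl

instance prodLieModule : LieModule F L (V × W) where
  smul_lie c x p := Prod.ext (smul_lie c x p.1) (smul_lie c x p.2)
  lie_smul c x p := Prod.ext (lie_smul c x p.1) (lie_smul c x p.2)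

theorem eq_bot_or_eq_top_of_isIrreducible (hV : LieModule.IsIrreducible F L V)
    (N : Submodule F V) (hN : ∀ (x : L), ∀ v ∈ N, ⁅x, v⁆ ∈ N) : N = ⊥ ∨ N = ⊤ := by
  let N' : LieSubmodule F L V := { N with lie_mem := fun {x m} hm => hN x m hm }
  rcases eq_bot_or_eq_top N' with h | h
  · left
    have := congrArg LieSubmodule.toSubmodule h
    simpa [N'] using this
  · right
    have := congrArg LieSubmodule.toSubmodule h
    simpa [N'] using this

end Prod

theorem projection_comm {F : Type*} [Field F] {T : Type*} [AddCommGroup T] [Module F T] {p q : Submodule F T}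
    (h : IsCompl p q) {φ : Module.End F T} (hp : ∀ t ∈ p, φ t ∈ p) (hq : ∀ t ∈ q, φ t ∈ q)
    (t : T) : (p.projectionOnto q h (φ t) : T) = φ (p.projectionOnto q h t) := by
  obtain ⟨a, ha, c, hc, rfl⟩ := Submodule.mem_sup.1 (h.sup_eq_top ▸ trivial : t ∈ p ⊔ q)
  rw [map_add, map_add, map_add, Submodule.projectionOnto_apply_of_mem_left h ha,
    Submodule.projectionOnto_apply_of_mem_left h (hp a ha),
    (Submodule.projectionOnto_apply_eq_zero_iff h).2 hc,
    (Submodule.projectionOnto_apply_eq_zero_iff h).2 (hq c hc)]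
  simp

section Weights

variable {F : Type*} [Field F] [CharZero F] [IsAlgClosed F]
  {L : Type*} [LieRing L] [LieAlgebra F L] [FiniteDimensional F L] [LieAlgebra.IsSemisimple F L]
  {𝔥 : LieSubalgebra F L} [𝔥.IsCartanSubalgebra]

/-- A simple module is determined by its highest weight. -/
theorem exists_equiv_of_highestWeightVector {b : (rootSystem 𝔥).Base} {ν : Module.Dual F 𝔥}
    {V : Type*} [AddCommGroup V] [Module F V] [LieRingModule L V] [LieModule F L V]
    {W : Type*} [AddCommGroup W] [Module F W] [LieRingModule L W] [LieModule F L W]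
    (hV : LieModule.IsIrreducible F L V) (hW : LieModule.IsIrreducible F L W) {v : V} {w : W}
    (hv : IsHighestWeightVector b ν v) (hw : IsHighestWeightVector b ν w) :
    ∃ ψ : V ≃ₗ[F] W, ∀ (x : L) (v : V), ψ ⁅x, v⁆ = ⁅x, ψ v⁆ := by
  have hvw : IsHighestWeightVector b ν (v, w) := by
    refine ⟨fun h => hv.ne_zero (congrArg Prod.fst h), fun h => ?_, fun α hα x hx => ?_⟩
    · rw [lie_prod, hv.lie_eq, hw.lie_eq]
      rfl
    · rw [lie_prod, hv.lie_eq_zero α hα x hx, hw.lie_eq_zero α hα x hx]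
      rfl
  obtain ⟨N, hN, hN'⟩ := hvw.exists_lieSubmodule
  have hspan : ∀ p ∈ N, p ∈ wtSpace (V × W) ν → ∃ c : F, c • (v, w) = p := fun p hp hp' =>
    Submodule.mem_span_singleton.1 (mem_span_of_mem_sup hvw.mem_wtSpace hp' (hN' hp))
  let p₁ : N →ₗ[F] V := LinearMap.fst F V W ∘ₗ N.toSubmodule.subtype
  let p₂ : N →ₗ[F] W := LinearMap.snd F V W ∘ₗ N.toSubmodule.subtype
  have h₁ : Function.Bijective p₁ := by
    constructor
    · have hK : N.toSubmodule.comap (LinearMap.inr F V W) = ⊥ := by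
        refine (eq_bot_or_eq_top_of_isIrreducible hW _ fun x u hu => ?_).resolve_right fun h => ?_
        · have : ⁅x, ((0 : V), u)⁆ ∈ N := N.lie_mem hu
          rwa [lie_prod, lie_zero] at this
        · have hmem : ((0 : V), w) ∈ N := by
            have : w ∈ N.toSubmodule.comap (LinearMap.inr F V W) := by rw [h]; trivial
            exact this
          obtain ⟨c, hc⟩ := hspan _ hmem fun t => by
            change ⁅(t : L), ((0 : V), w)⁆ = ν t • ((0 : V), w)
            rw [lie_prod, lie_zero, hw.lie_eq, Prod.smul_mk, smul_zero]
          have hc1 : c = 0 := (smul_eq_zero.1 (congrArg Prod.fst hc)).resolve_right hv.ne_zero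
          rw [hc1, zero_smul] at hc
          exact hw.ne_zero (congrArg Prod.snd hc).symm
      rw [← LinearMap.ker_eq_bot, LinearMap.ker_eq_bot']
      rintro ⟨⟨a, u⟩, hu⟩ (rfl : a = 0)
      have : u ∈ N.toSubmodule.comap (LinearMap.inr F V W) := hu
      rw [hK, Submodule.mem_bot] at this
      subst this
      rfl
    · rw [← LinearMap.range_eq_top]
      refine (eq_bot_or_eq_top_of_isIrreducible hV _ ?_).resolve_left fun h => ?_
      · rintro x _ ⟨n, rfl⟩
        exact ⟨⁅x, n⁆, rfl⟩
      · have : v ∈ LinearMap.range p₁ := ⟨⟨(v, w), hN⟩, rfl⟩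
        rw [h] at this
        exact hv.ne_zero this
  have h₂ : Function.Bijective p₂ := by
    constructor
    · have hK : N.toSubmodule.comap (LinearMap.inl F V W) = ⊥ := by
        refine (eq_bot_or_eq_top_of_isIrreducible hV _ fun x u hu => ?_).resolve_right fun h => ?_
        · have : ⁅x, (u, (0 : W))⁆ ∈ N := N.lie_mem hu
          rwa [lie_prod, lie_zero] at this
        · have hmem : (v, (0 : W)) ∈ N := by
            have : v ∈ N.toSubmodule.comap (LinearMap.inl F V W) := by rw [h]; trivial
            exact this
          obtain ⟨c, hc⟩ := hspan _ hmem fun t => by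
            change ⁅(t : L), (v, (0 : W))⁆ = ν t • (v, (0 : W))
            rw [lie_prod, lie_zero, hv.lie_eq, Prod.smul_mk, smul_zero]
          have hc1 : c = 0 := (smul_eq_zero.1 (congrArg Prod.snd hc)).resolve_right hw.ne_zero
          rw [hc1, zero_smul] at hc
          exact hv.ne_zero (congrArg Prod.fst hc).symm
      rw [← LinearMap.ker_eq_bot, LinearMap.ker_eq_bot']
      rintro ⟨⟨u, a⟩, hu⟩ (rfl : a = 0)
      have : u ∈ N.toSubmodule.comap (LinearMap.inl F V W) := hu
      rw [hK, Submodule.mem_bot] at this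
      subst this
      rfl
    · rw [← LinearMap.range_eq_top]
      refine (eq_bot_or_eq_top_of_isIrreducible hW _ ?_).resolve_left fun h => ?_
      · rintro x _ ⟨n, rfl⟩
        exact ⟨⁅x, n⁆, rfl⟩
      · have : w ∈ LinearMap.range p₂ := ⟨⟨(v, w), hN⟩, rfl⟩
        rw [h] at this
        exact hw.ne_zero this
  let e₁ := LinearEquiv.ofBijective p₁ h₁
  let e₂ := LinearEquiv.ofBijective p₂ h₂
  refine ⟨e₁.symm.trans e₂, fun x u => ?_⟩
  obtain ⟨n, rfl⟩ := e₁.surjective u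
  have : ⁅x, e₁ n⁆ = e₁ ⁅x, n⁆ := rfl
  rw [this, LinearEquiv.trans_apply, LinearEquiv.trans_apply, LinearEquiv.symm_apply_apply,
    LinearEquiv.symm_apply_apply]
  rfl

theorem IsTop.mem_of_casimir {b : (rootSystem 𝔥).Base} {μ : Module.Dual F 𝔥}
    (hμ : IsDominantIntegral b μ) {T : Type*} [AddCommGroup T] [Module F T] [LieRingModule L T]
    [LieModule F L T] [FiniteDimensional F T] {v : T} (hv : IsTop b μ v) {M : LieSubmodule F L T}
    (hM : M ≠ ⊥) {n : ℕ}
    (hn : ∀ w ∈ M, ((casimir F L T - casimirScalar b μ • (1 : Module.End F T)) ^ n) w = 0) :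
    v ∈ M ∧ v ≠ 0 := by
  have : Nontrivial M := (LieSubmodule.nontrivial_iff_ne_bot F L T).2 hM
  obtain ⟨ν, ⟨w, hwM⟩, hw⟩ := exists_highestWeightVector b M
  have hw' : IsHighestWeightVector b ν w :=
    ⟨fun h => hw.ne_zero (Subtype.ext h), fun h => congrArg Subtype.val (hw.lie_eq h),
      fun α hα x hx => congrArg Subtype.val (hw.lie_eq_zero α hα x hx)⟩
  have hpow : ∀ k : ℕ, ((casimir F L T - casimirScalar b μ • (1 : Module.End F T)) ^ k) w =
      (casimirScalar b ν - casimirScalar b μ) ^ k • w := by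
    intro k
    induction k with
    | zero => simp
    | succ k ih =>
      rw [pow_succ', Module.End.mul_apply, ih, map_smul, LinearMap.sub_apply,
        casimir_apply_highestWeightVector hw', LinearMap.smul_apply, Module.End.one_apply,
        ← sub_smul, smul_smul, pow_succ]
  have hc : casimirScalar b μ = casimirScalar b ν := by
    have h1 := hpow n
    rw [hn w hwM] at h1
    exact (sub_eq_zero.1 (eq_zero_of_pow_eq_zero
      ((smul_eq_zero.1 h1.symm).resolve_right hw'.ne_zero))).symm
  have hμν : μ = ν := eq_of_casimirScalar_eq hw'.isDominantIntegral hμ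
    (hv.sub_mem_posCone hw'.mem_wtSpace hw'.ne_zero) hc
  subst hμν
  have hwv := mem_span_of_mem_sup (b := b) hv.mem hw'.mem_wtSpace
    (by rw [hv.sup_eq_top]; trivial)
  obtain ⟨c, hc⟩ := Submodule.mem_span_singleton.1 hwv
  have hc0 : c ≠ 0 := by
    rintro rfl
    rw [zero_smul] at hc
    exact hw'.ne_zero hc.symm
  refine ⟨?_, ?_⟩
  · rw [← hc] at hwM
    exact (Submodule.smul_mem_iff M.toSubmodule hc0).1 hwM
  · rintro rfl
    rw [smul_zero] at hc
    exact hw'.ne_zero hc.symm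

/-- The simple module of highest weight `μ` is a direct summand of a module in which `μ` is a highest
weight, and the summand is preserved by all operators commuting with the Casimir operator. -/
theorem exists_splitting {b : (rootSystem 𝔥).Base} {μ : Module.Dual F 𝔥}
    {T : Type*} [AddCommGroup T] [Module F T] [LieRingModule L T]
    [LieModule F L T] [FiniteDimensional F T] {v : T} (hv : IsTop b μ v)
    (hv' : IsHighestWeightVector b μ v)
    {V : Type*} [AddCommGroup V] [Module F V] [LieRingModule L V] [LieModule F L V]
    (hV : LieModule.IsIrreducible F L V) {u : V} (hu : IsHighestWeightVector b μ u) :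
    ∃ (i : V →ₗ[F] T) (p : T →ₗ[F] V), (∀ (x : L) (a : V), i ⁅x, a⁆ = ⁅x, i a⁆) ∧
      (∀ (x : L) (t : T), p ⁅x, t⁆ = ⁅x, p t⁆) ∧ (∀ a, p (i a) = a) ∧
      ∀ φ : Module.End F T, (∀ t, φ (casimir F L T t) = casimir F L T (φ t)) →
        ∀ t, φ (i (p t)) = i (p (φ t)) := by
  have hμ := hv'.isDominantIntegral
  let f : Module.End F T := casimir F L T - casimirScalar b μ • 1
  obtain ⟨n, hn⟩ := (Filter.eventually_atTop.1 (LinearMap.eventually_isCompl_ker_pow_range_pow f))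
  obtain ⟨m, hm0, hm⟩ : ∃ m, 1 ≤ m ∧ IsCompl (LinearMap.ker (f ^ m)) (LinearMap.range (f ^ m)) :=
    ⟨n + 1, by omega, hn _ (by omega)⟩
  have hcomm : ∀ φ : Module.End F T, (∀ t, φ (casimir F L T t) = casimir F L T (φ t)) →
      ∀ t, φ ((f ^ m) t) = (f ^ m) (φ t) := by
    intro φ hφ t
    have h1 : Commute φ f := by
      refine Commute.sub_right (LinearMap.ext hφ) ?_
      exact (Commute.one_right φ).smul_right _
    exact LinearMap.congr_fun (h1.pow_right m).eq t
  have hker : ∀ φ : Module.End F T, (∀ t, φ (casimir F L T t) = casimir F L T (φ t)) →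
      ∀ t ∈ LinearMap.ker (f ^ m), φ t ∈ LinearMap.ker (f ^ m) := by
    intro φ hφ t ht
    rw [LinearMap.mem_ker] at ht ⊢
    rw [← hcomm φ hφ, ht, map_zero]
  have hran : ∀ φ : Module.End F T, (∀ t, φ (casimir F L T t) = casimir F L T (φ t)) →
      ∀ t ∈ LinearMap.range (f ^ m), φ t ∈ LinearMap.range (f ^ m) := by
    rintro φ hφ _ ⟨t, rfl⟩
    exact ⟨φ t, (hcomm φ hφ t).symm⟩
  have hL : ∀ (x : L) t, LieModule.toEnd F L T x (casimir F L T t) =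
      casimir F L T (LieModule.toEnd F L T x t) := fun x t => (casimir_lie T x t).symm
  let C : LieSubmodule F L T :=
    { LinearMap.ker (f ^ m) with lie_mem := fun {x t} ht => hker _ (hL x) t ht }
  have hvC : v ∈ C := by
    change (f ^ m) v = 0
    have hf : f v = 0 := by
      simp only [f, LinearMap.sub_apply, casimir_apply_highestWeightVector hv',
        LinearMap.smul_apply, Module.End.one_apply, sub_self]
    rw [← Nat.sub_add_cancel hm0, pow_succ, Module.End.mul_apply, hf, map_zero]
  have hC : ∀ M : LieSubmodule F L T, M ≤ C → M ≠ ⊥ → C ≤ M := by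
    intro M hMC hM
    have hvM : v ∈ M := (hv.mem_of_casimir hμ hM (n := m) fun w hw => hMC hw).1
    let π : T →ₗ⁅F,L⁆ T ⧸ M := LieSubmodule.Quotient.mk' M
    have hπ : ∀ t, π t = 0 ↔ t ∈ M := fun t => LieSubmodule.Quotient.mk_eq_zero M
    have htop : IsTop b μ (π v) := by
      refine ⟨fun h => ?_, ?_⟩
      · change ⁅(h : L), π v⁆ = μ h • π v
        rw [← LieModuleHom.map_lie, hv'.lie_eq, map_smul]
      · rw [eq_top_iff]
        rintro q -
        obtain ⟨t, rfl⟩ := LieSubmodule.Quotient.surjective_mk' M q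
        have ht : t ∈ Submodule.span F {v} ⊔ lowerSpace T b μ := by
          rw [hv.sup_eq_top]; trivial
        have hle : Submodule.span F {v} ⊔ lowerSpace T b μ ≤
            (Submodule.span F {π v} ⊔ lowerSpace (T ⧸ M) b μ).comap (π : T →ₗ[F] T ⧸ M) := by
          rw [sup_le_iff, Submodule.span_singleton_le_iff_mem]
          constructor
          · exact Submodule.mem_sup_left (Submodule.mem_span_singleton_self _)
          · refine iSup_le fun δ w hw => Submodule.mem_sup_right
              (mem_lowerSpace δ.2.1 δ.2.2 (mem_wtSpace.2 fun h => ?_))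
            change ⁅(h : L), π w⁆ = _ • π w
            rw [← LieModuleHom.map_lie, mem_wtSpace.1 hw, map_smul]
        exact hle ht
    by_contra hne
    have hbot : C.map π ≠ ⊥ := by
      intro h
      refine hne fun t ht => (hπ t).1 ?_
      have : π t ∈ C.map π := (LieSubmodule.mem_map _).2 ⟨t, ht, rfl⟩
      rwa [h, LieSubmodule.mem_bot] at this
    have hcas : ∀ t, π (casimir F L T t) = casimir F L (T ⧸ M) (π t) :=
      casimir_apply_of_equiv LieEquiv.refl (π : T →ₗ[F] T ⧸ M) fun x t => π.map_lie x t
    refine (htop.mem_of_casimir hμ hbot (n := m) fun w hw => ?_).2 ((hπ v).2 hvM)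
    obtain ⟨t, ht, rfl⟩ := (LieSubmodule.mem_map _).1 hw
    have hpow : ∀ k : ℕ, ((casimir F L (T ⧸ M) -
        casimirScalar b μ • (1 : Module.End F (T ⧸ M))) ^ k) (π t) = π ((f ^ k) t) := by
      intro k
      induction k with
      | zero => rfl
      | succ k ih =>
        rw [pow_succ', Module.End.mul_apply, ih, pow_succ', Module.End.mul_apply,
          LinearMap.sub_apply, ← hcas, LinearMap.smul_apply, Module.End.one_apply, ← map_smul,
          ← map_sub]
        rfl
    rw [hpow, show (f ^ m) t = 0 from ht, map_zero]
  have hCirr : LieModule.IsIrreducible F L C := by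
    have : Nontrivial C := ⟨⟨⟨v, hvC⟩, 0, fun h => hv'.ne_zero (congrArg Subtype.val h)⟩⟩
    refine LieModule.IsIrreducible.mk fun N hN => ?_
    have h1 := hC (N.map C.incl) (LieSubmodule.map_incl_le) (by
      intro h
      refine hN ((LieSubmodule.eq_bot_iff N).2 fun t ht => Subtype.ext ?_)
      have : C.incl t ∈ N.map C.incl := (LieSubmodule.mem_map _).2 ⟨t, ht, rfl⟩
      rwa [h, LieSubmodule.mem_bot] at this)
    rw [eq_top_iff]
    rintro t -
    obtain ⟨t', ht', h⟩ := (LieSubmodule.mem_map _).1 (h1 t.2)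
    rwa [← Subtype.ext h]
  have hvC' : IsHighestWeightVector b μ (⟨v, hvC⟩ : C) :=
    ⟨fun h => hv'.ne_zero (congrArg Subtype.val h), fun h => Subtype.ext (hv'.lie_eq h),
      fun α hα x hx => Subtype.ext (hv'.lie_eq_zero α hα x hx)⟩
  obtain ⟨ψ, hψ⟩ := exists_equiv_of_highestWeightVector hV hCirr hu hvC'
  let pr : T →ₗ[F] C := Submodule.projectionOnto (LinearMap.ker (f ^ m)) _ hm
  have hpr : ∀ c : C, pr (c : T) = c := fun c => Submodule.projectionOnto_apply_left hm c
  have hprcomm : ∀ φ : Module.End F T, (∀ t, φ (casimir F L T t) = casimir F L T (φ t)) →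
      ∀ t, (pr (φ t) : T) = φ (pr t) := fun φ hφ t =>
    projection_comm hm (hker φ hφ) (hran φ hφ) t
  refine ⟨C.toSubmodule.subtype ∘ₗ ψ.toLinearMap, ψ.symm.toLinearMap ∘ₗ pr, fun x a => ?_,
    fun x t => ?_, fun a => ?_, fun φ hφ t => ?_⟩
  · exact congrArg Subtype.val (hψ x a)
  · apply ψ.injective
    change ψ (ψ.symm (pr ⁅x, t⁆)) = ψ ⁅x, ψ.symm (pr t)⁆
    rw [hψ, LinearEquiv.apply_symm_apply, LinearEquiv.apply_symm_apply]
    exact Subtype.ext (hprcomm _ (hL x) t)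
  · change ψ.symm (pr (ψ a : T)) = a
    rw [hpr, LinearEquiv.symm_apply_apply]
  · change φ (ψ (ψ.symm (pr t)) : T) = (ψ (ψ.symm (pr (φ t))) : T)
    rw [LinearEquiv.apply_symm_apply, LinearEquiv.apply_symm_apply, hprcomm φ hφ]

end Weights

end GradedBrauer

end

noncomputable section

attribute [local instance] LieRing.ofAssociativeRing

universe u v w

set_option linter.unusedSectionVars false

namespace GradedBrauer

open LieAlgebra LieAlgebra.IsKilling

section Twist

variable {F : Type*} [Field F] {L : Type*} [LieRing L] [LieAlgebra F L]

/-- The module `V` twisted by an automorphism `e` of `L`. -/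
def Twist (_e : L ≃ₗ⁅F⁆ L) (V : Type*) : Type _ := V

variable (e : L ≃ₗ⁅F⁆ L) (V : Type*) [AddCommGroup V] [Module F V] [LieRingModule L V]
  [LieModule F L V]

instance : AddCommGroup (Twist e V) := inferInstanceAs (AddCommGroup V)

instance : Module F (Twist e V) := inferInstanceAs (Module F V)

instance [FiniteDimensional F V] : FiniteDimensional F (Twist e V) :=
  inferInstanceAs (FiniteDimensional F V)

instance : LieRingModule L (Twist e V) := LieRingModule.compLieHom V (e : L →ₗ⁅F⁆ L)

instance : LieModule F L (Twist e V) := LieModule.compLieHom V (e : L →ₗ⁅F⁆ L)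

/-- The identity map from `V` to its twist. -/
def toTwist : V ≃ₗ[F] Twist e V := LinearEquiv.refl F V

variable {V}

theorem lie_toTwist (x : L) (v : V) : ⁅x, toTwist e V v⁆ = toTwist e V ⁅e x, v⁆ := rfl

theorem isIrreducible_twist (hV : LieModule.IsIrreducible F L V) :
    LieModule.IsIrreducible F L (Twist e V) := by
  have := LieModule.nontrivial_of_isIrreducible F L V
  have : Nontrivial (Twist e V) := inferInstanceAs (Nontrivial V)
  refine LieModule.IsIrreducible.mk fun N hN => ?_
  have h := (eq_bot_or_eq_top_of_isIrreducible hV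
    (N.toSubmodule.comap (toTwist e V).toLinearMap) fun x v hv => ?_).resolve_left fun h => ?_
  · rw [eq_top_iff]
    rintro v -
    have : (toTwist e V).symm v ∈ N.toSubmodule.comap (toTwist e V).toLinearMap := by
      rw [h]; trivial
    simpa using this
  · have : ⁅e.symm x, toTwist e V v⁆ ∈ N := N.lie_mem hv
    rwa [lie_toTwist, LieEquiv.apply_symm_apply] at this
  · refine hN ((LieSubmodule.eq_bot_iff N).2 fun v hv => ?_)
    have : (toTwist e V).symm v ∈ N.toSubmodule.comap (toTwist e V).toLinearMap := by
      simpa using hv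
    rw [h] at this
    simpa using this

end Twist

section CharEquiv

variable {F : Type*} [Field F] {L : Type*} [LieRing L] [LieAlgebra F L]
  {G : Type*} [AddCommGroup G] [DecidableEq G]
  (ℒ : G → Submodule F L) [GradedLieAlgebra ℒ]

/-- The automorphism by which a character acts, as an equivalence. -/
def charEquiv (χ : AddChar G F) : L ≃ₗ⁅F⁆ L :=
  { charAut ℒ χ with
    invFun := charAut ℒ χ⁻¹
    left_inv := fun x => by
      change charAut ℒ χ⁻¹ (charAut ℒ χ x) = x
      rw [← charAut_mul, inv_mul_cancel, charAut_one]
    right_inv := fun x => by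
      change charAut ℒ χ (charAut ℒ χ⁻¹ x) = x
      rw [← charAut_mul, mul_inv_cancel, charAut_one] }

end CharEquiv

/-- The algebra `End(V₁) ⊗ End(V₂)` is isomorphic to `End(V₁ ⊗ V₂)`. -/
def tensorEnd (K : Type*) [Field K] (V₁ : Type*) [AddCommGroup V₁] [Module K V₁]
    [FiniteDimensional K V₁] (V₂ : Type*) [AddCommGroup V₂] [Module K V₂]
    [FiniteDimensional K V₂] :
    (Module.End K V₁ ⊗[K] Module.End K V₂) ≃ₐ[K] Module.End K (V₁ ⊗[K] V₂) :=
  AlgEquiv.ofBijective (Module.endTensorEndAlgHom (R := K) (S := K) (A := K)) (by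
    have h : (Module.endTensorEndAlgHom (R := K) (S := K) (A := K) (M := V₁) (N := V₂)).toLinearMap
        = (homTensorHomEquiv K V₁ V₂ V₁ V₂).toLinearMap := by
      rw [homTensorHomEquiv_toLinearMap]
      ext
      rfl
    have h' : ⇑(Module.endTensorEndAlgHom (R := K) (S := K) (A := K) (M := V₁) (N := V₂)) =
        homTensorHomEquiv K V₁ V₂ V₁ V₂ := funext fun x => LinearMap.congr_fun h x
    rw [h']
    exact (homTensorHomEquiv K V₁ V₂ V₁ V₂).bijective)

theorem tensorEnd_tmul (K : Type*) [Field K] {V₁ : Type*} [AddCommGroup V₁] [Module K V₁]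
    [FiniteDimensional K V₁] {V₂ : Type*} [AddCommGroup V₂] [Module K V₂]
    [FiniteDimensional K V₂] (f : Module.End K V₁) (g : Module.End K V₂) :
    tensorEnd K V₁ V₂ (f ⊗ₜ g) = TensorProduct.map f g := rfl

section Weights

variable {F : Type*} [Field F] [CharZero F] [IsAlgClosed F]
  {L : Type*} [LieRing L] [LieAlgebra F L] [FiniteDimensional F L] [LieAlgebra.IsSemisimple F L]
  {𝔥 : LieSubalgebra F L} [𝔥.IsCartanSubalgebra]

theorem casimir_eq_smul {b : (rootSystem 𝔥).Base} {ν : Module.Dual F 𝔥}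
    {V : Type*} [AddCommGroup V] [Module F V] [LieRingModule L V] [LieModule F L V]
    (hV : LieModule.IsIrreducible F L V) {v : V} (hv : IsHighestWeightVector b ν v) (w : V) :
    casimir F L V w = casimirScalar b ν • w := by
  let N := LinearMap.eqLocus (casimir F L V) (casimirScalar b ν • LinearMap.id)
  have hN : N = ⊤ := by
    refine (eq_bot_or_eq_top_of_isIrreducible hV N fun x u hu => ?_).resolve_left fun h => ?_
    · change casimir F L V ⁅x, u⁆ = casimirScalar b ν • ⁅x, u⁆
      rw [casimir_lie, show casimir F L V u = casimirScalar b ν • u from hu, lie_smul]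
    · have : v ∈ N := casimir_apply_highestWeightVector hv
      rw [h] at this
      exact hv.ne_zero this
  exact (hN ▸ trivial : w ∈ N)

variable {G : Type*} [AddCommGroup G] [DecidableEq G] (ℒ : G → Submodule F L) [GradedLieAlgebra ℒ]

theorem mem_inertiaGroup_of_tensor {b : (rootSystem 𝔥).Base} {ν₁ ν₂ : Module.Dual F 𝔥}
    {V₁ : Type*} [AddCommGroup V₁] [Module F V₁] [LieRingModule L V₁] [LieModule F L V₁]
    {V₂ : Type*} [AddCommGroup V₂] [Module F V₂] [LieRingModule L V₂] [LieModule F L V₂]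
    {V : Type*} [AddCommGroup V] [Module F V] [LieRingModule L V] [LieModule F L V]
    [FiniteDimensional F V₁] [FiniteDimensional F V₂]
    (hV₁ : LieModule.IsIrreducible F L V₁) (hV₂ : LieModule.IsIrreducible F L V₂)
    (hV : LieModule.IsIrreducible F L V) {v₁ : V₁} {v₂ : V₂} {v : V}
    (hv₁ : IsHighestWeightVector b ν₁ v₁) (hv₂ : IsHighestWeightVector b ν₂ v₂)
    (hv : IsHighestWeightVector b (ν₁ + ν₂) v) {χ : AddChar G F}
    (hχ₁ : χ ∈ inertiaGroup ℒ V₁) (hχ : χ ∈ inertiaGroup ℒ V) : χ ∈ inertiaGroup ℒ V₂ := by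
  obtain ⟨φ₁, hφ₁⟩ := hχ₁
  obtain ⟨φ, hφ⟩ := hχ
  let e := charEquiv ℒ χ
  have hirr := isIrreducible_twist e hV₂
  have := LieModule.nontrivial_of_isIrreducible F L (Twist e V₂)
  obtain ⟨η, w, hw⟩ := exists_highestWeightVector b (Twist e V₂)
  obtain ⟨i, p, hi, -, hpi, -⟩ :=
    exists_splitting ((hv₁.isTop hV₁).tmul (hv₂.isTop hV₂)) (hv₁.tmul hv₂) hV hv
  have hφ₁' : ∀ (x : L) (a : V₁), φ₁.symm ⁅e x, a⁆ = ⁅x, φ₁.symm a⁆ := fun x a =>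
    φ₁.injective (by rw [LinearEquiv.apply_symm_apply, hφ₁, LinearEquiv.apply_symm_apply]; rfl)
  let Φ : V₁ ⊗[F] V₂ ≃ₗ[F] V₁ ⊗[F] Twist e V₂ := TensorProduct.congr φ₁.symm (toTwist e V₂)
  have hΦ : ∀ (x : L) (t : V₁ ⊗[F] V₂), Φ ⁅e x, t⁆ = ⁅x, Φ t⁆ := by
    intro x t
    induction t with
    | zero => simp
    | add s t hs ht => rw [lie_add, map_add, hs, ht, map_add, lie_add]
    | tmul a c =>
      rw [TensorProduct.LieModule.lie_tmul_right, map_add, TensorProduct.congr_tmul,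
        TensorProduct.congr_tmul, TensorProduct.congr_tmul,
        TensorProduct.LieModule.lie_tmul_right, hφ₁', lie_toTwist]
  let Ψ : V →ₗ[F] V₁ ⊗[F] Twist e V₂ := Φ.toLinearMap ∘ₗ i ∘ₗ φ.toLinearMap
  have hΨ : ∀ (x : L) (a : V), Ψ ⁅x, a⁆ = ⁅x, Ψ a⁆ := by
    intro x a
    change Φ (i (φ ⁅x, a⁆)) = ⁅x, Φ (i (φ a))⁆
    rw [hφ, hi, ← hΦ]
    rfl
  have hwt : Ψ v ∈ wtSpace (V₁ ⊗[F] Twist e V₂) (ν₁ + ν₂) :=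
    mem_wtSpace.2 fun h => by rw [← hΨ, hv.lie_eq, map_smul]
  have hne : Ψ v ≠ 0 := by
    intro h
    have h1 : i (φ v) = 0 := Φ.map_eq_zero_iff.1 h
    have h2 : φ v = 0 := by rw [← hpi (φ v), h1, map_zero]
    exact hv.ne_zero (φ.map_eq_zero_iff.1 h2)
  have hcone := ((hv₁.isTop hV₁).tmul (hw.isTop hirr)).sub_mem_posCone hwt hne
  rw [add_sub_add_left_eq_sub] at hcone
  have hcas : casimirScalar b η = casimirScalar b ν₂ := by
    have h1 := casimir_apply_of_equiv e.symm (toTwist e V₂).toLinearMap (fun x a => by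
      change toTwist e V₂ ⁅x, a⁆ = ⁅e.symm x, toTwist e V₂ a⁆
      rw [lie_toTwist, LieEquiv.apply_symm_apply]) ((toTwist e V₂).symm w)
    rw [casimir_eq_smul hV₂ hv₂, map_smul] at h1
    simp only [LinearEquiv.coe_coe, LinearEquiv.apply_symm_apply] at h1
    rw [casimir_apply_highestWeightVector hw, ← sub_eq_zero, ← sub_smul] at h1
    exact (sub_eq_zero.1 ((smul_eq_zero.1 h1).resolve_right hw.ne_zero)).symm
  have hη : η = ν₂ :=
    eq_of_casimirScalar_eq hv₂.isDominantIntegral hw.isDominantIntegral hcone hcas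
  subst hη
  obtain ⟨ψ, hψ⟩ := exists_equiv_of_highestWeightVector hV₂ hirr hv₂ hw
  exact ⟨ψ.trans (toTwist e V₂).symm, hψ⟩

end Weights

end GradedBrauer

end

noncomputable section

attribute [local instance] LieRing.ofAssociativeRing

universe u v w

set_option linter.unusedSectionVars false

namespace GradedBrauer

section Corner

variable {F : Type*} [Field F] {L : Type*} [LieRing L] [LieAlgebra F L]
  {G : Type*} [AddCommGroup G] [DecidableEq G] (ℒ : G → Submodule F L) [GradedLieAlgebra ℒ]
  {V₁ : Type*} [AddCommGroup V₁] [Module F V₁] [LieRingModule L V₁] [LieModule F L V₁]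
  {V₂ : Type*} [AddCommGroup V₂] [Module F V₂] [LieRingModule L V₂] [LieModule F L V₂]
  {V : Type*} [AddCommGroup V] [Module F V] [LieRingModule L V] [LieModule F L V]

theorem coarsen_map_endGrading (i₁ : inertiaPerp ℒ V₁ ≤ inertiaPerp ℒ V) :
    coarsen (QuotientAddGroup.map _ _ (AddMonoidHom.id G) i₁) (endGrading ℒ V₁) =
      coarsen (QuotientAddGroup.mk' (inertiaPerp ℒ V)) (opComponent ℒ V₁) := by
  rw [endGrading_eq_coarsen, coarsen_coarsen]
  rfl

theorem comp_eq_smul_of_mem_coarsen {χ : AddChar G F} (hχ : χ ∈ inertiaGroup ℒ V)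
    {φ : V₁ ≃ₗ[F] V₁} (hφ : ∀ (x : L) (v : V₁), φ ⁅x, v⁆ = ⁅charAut ℒ χ x, φ v⁆)
    {q : G ⧸ inertiaPerp ℒ V} {a : Module.End F V₁}
    (ha : a ∈ coarsen (QuotientAddGroup.mk' (inertiaPerp ℒ V)) (opComponent ℒ V₁) q) (v : V₁) :
    φ (a v) = χ q.out • a (φ v) := by
  induction ha using Submodule.iSup_induction' with
  | zero => simp
  | add a c _ _ ha hc => simp only [LinearMap.add_apply, map_add, ha, hc, smul_add]
  | mem g a ha =>
    rw [comp_eq_smul_of_mem_opComponent ℒ hφ ha, apply_eq_of_mk_eq ℒ hχ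
      (g := g.1) (k := q.out) (by rw [QuotientAddGroup.out_eq']; exact g.2)]

theorem charAut_tensor {χ : AddChar G F} {φ₁ : V₁ ≃ₗ[F] V₁} {φ₂ : V₂ ≃ₗ[F] V₂}
    (h₁ : ∀ (x : L) (v : V₁), φ₁ ⁅x, v⁆ = ⁅charAut ℒ χ x, φ₁ v⁆)
    (h₂ : ∀ (x : L) (v : V₂), φ₂ ⁅x, v⁆ = ⁅charAut ℒ χ x, φ₂ v⁆) (x : L) (t : V₁ ⊗[F] V₂) :
    TensorProduct.congr φ₁ φ₂ ⁅x, t⁆ = ⁅charAut ℒ χ x, TensorProduct.congr φ₁ φ₂ t⁆ := by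
  induction t with
  | zero => simp
  | add s t hs ht => rw [lie_add, map_add, hs, ht, map_add, lie_add]
  | tmul a c =>
    rw [TensorProduct.LieModule.lie_tmul_right, map_add, TensorProduct.congr_tmul,
      TensorProduct.congr_tmul, TensorProduct.congr_tmul,
      TensorProduct.LieModule.lie_tmul_right, h₁, h₂]

variable [FiniteDimensional F V₁] [FiniteDimensional F V₂]

theorem tensorEnd_comp_eq_smul {χ : AddChar G F} (hχ : χ ∈ inertiaGroup ℒ V)
    {φ₁ : V₁ ≃ₗ[F] V₁} {φ₂ : V₂ ≃ₗ[F] V₂}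
    (h₁ : ∀ (x : L) (v : V₁), φ₁ ⁅x, v⁆ = ⁅charAut ℒ χ x, φ₁ v⁆)
    (h₂ : ∀ (x : L) (v : V₂), φ₂ ⁅x, v⁆ = ⁅charAut ℒ χ x, φ₂ v⁆)
    {q : G ⧸ inertiaPerp ℒ V} {z : Module.End F V₁ ⊗[F] Module.End F V₂}
    (hz : z ∈ tensorGrading
      (coarsen (QuotientAddGroup.mk' (inertiaPerp ℒ V)) (opComponent ℒ V₁))
      (coarsen (QuotientAddGroup.mk' (inertiaPerp ℒ V)) (opComponent ℒ V₂)) q)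
    (t : V₁ ⊗[F] V₂) :
    TensorProduct.congr φ₁ φ₂ (tensorEnd F V₁ V₂ z t) =
      χ q.out • tensorEnd F V₁ V₂ z (TensorProduct.congr φ₁ φ₂ t) := by
  rw [tensorGrading_eq_span] at hz
  induction hz using Submodule.span_induction with
  | zero => simp
  | add x y _ _ hx hy => simp only [map_add, LinearMap.add_apply, hx, hy, smul_add]
  | smul c x _ hx =>
    rw [map_smul, LinearMap.smul_apply, map_smul, hx, LinearMap.smul_apply, smul_comm]
  | mem x hx =>
    obtain ⟨k, l, rfl, a, ha, c, hc, rfl⟩ := hx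
    have hout : χ (k + l).out = χ k.out * χ l.out := by
      rw [← AddChar.map_add_eq_mul]
      refine apply_eq_of_mk_eq ℒ hχ ?_
      rw [QuotientAddGroup.mk_add, QuotientAddGroup.out_eq', QuotientAddGroup.out_eq',
        QuotientAddGroup.out_eq']
    rw [tensorEnd_tmul, hout]
    induction t with
    | zero => simp
    | add s t hs ht => simp only [map_add, hs, ht, smul_add]
    | tmul u w =>
      rw [TensorProduct.map_tmul, TensorProduct.congr_tmul, TensorProduct.congr_tmul,
        TensorProduct.map_tmul, comp_eq_smul_of_mem_coarsen ℒ hχ h₁ ha,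
        comp_eq_smul_of_mem_coarsen ℒ hχ h₂ hc, TensorProduct.smul_tmul_smul]

/-- The graded algebra `End(V)` is a corner of `End(V₁) ⊗ End(V₂)` if `V` is a direct summand of
`V₁ ⊗ V₂` which is preserved by all the maps defining the actions of the characters. -/
theorem gradedCorner_endGrading [IsAlgClosed F] (hV₁ : LieModule.IsIrreducible F L V₁)
    (hV₂ : LieModule.IsIrreducible F L V₂)
    (i₁ : inertiaPerp ℒ V₁ ≤ inertiaPerp ℒ V) (i₂ : inertiaPerp ℒ V₂ ≤ inertiaPerp ℒ V)
    (i : V →ₗ[F] V₁ ⊗[F] V₂) (p : V₁ ⊗[F] V₂ →ₗ[F] V) (hi : ∀ (x : L) (a : V), i ⁅x, a⁆ = ⁅x, i a⁆)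
    (hp : ∀ (x : L) (t : V₁ ⊗[F] V₂), p ⁅x, t⁆ = ⁅x, p t⁆) (hpi : ∀ a, p (i a) = a)
    (hcomm : ∀ (χ : AddChar G F) (φ : V₁ ⊗[F] V₂ ≃ₗ[F] V₁ ⊗[F] V₂),
      (∀ (x : L) (t : V₁ ⊗[F] V₂), φ ⁅x, t⁆ = ⁅charAut ℒ χ x, φ t⁆) →
        ∀ t, φ (i (p t)) = i (p (φ t))) :
    GradedCorner (endGrading ℒ V)
      (tensorGrading (coarsen (QuotientAddGroup.map _ _ (AddMonoidHom.id G) i₁) (endGrading ℒ V₁))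
        (coarsen (QuotientAddGroup.map _ _ (AddMonoidHom.id G) i₂) (endGrading ℒ V₂))) := by
  have hgr := ((isAlgebraGrading_endGrading ℒ V₁ hV₁).coarsen
    (QuotientAddGroup.map _ (inertiaPerp ℒ V) (AddMonoidHom.id G) i₁)).tensor
    ((isAlgebraGrading_endGrading ℒ V₂ hV₂).coarsen
    (QuotientAddGroup.map _ (inertiaPerp ℒ V) (AddMonoidHom.id G) i₂))
  rw [coarsen_map_endGrading, coarsen_map_endGrading] at hgr ⊢
  have hK₁ := (inertiaPerp_le_iff ℒ V₁ hV₁ V).1 i₁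
  have hK₂ := (inertiaPerp_le_iff ℒ V₂ hV₂ V).1 i₂
  choose φ₁ hφ₁ using fun χ : inertiaGroup ℒ V => hK₁ χ.2
  choose φ₂ hφ₂ using fun χ : inertiaGroup ℒ V => hK₂ χ.2
  let Θ := tensorEnd F V₁ V₂
  let φ : inertiaGroup ℒ V → V₁ ⊗[F] V₂ ≃ₗ[F] V₁ ⊗[F] V₂ := fun χ =>
    TensorProduct.congr (φ₁ χ) (φ₂ χ)
  have hφ : ∀ (χ : inertiaGroup ℒ V) (x : L) (t : V₁ ⊗[F] V₂),
      φ χ ⁅x, t⁆ = ⁅charAut ℒ χ.1 x, φ χ t⁆ := fun χ => charAut_tensor ℒ (hφ₁ χ) (hφ₂ χ)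
  have hφe : ∀ χ t, φ χ (i (p t)) = i (p (φ χ t)) := fun χ => hcomm χ.1 (φ χ) (hφ χ)
  let T : inertiaGroup ℒ V → Module.End F (Module.End F V₁ ⊗[F] Module.End F V₂) := fun χ =>
    Θ.symm.toLinearMap ∘ₗ (φ χ).conj.toLinearMap ∘ₗ Θ.toLinearMap
  let c : inertiaGroup ℒ V → G ⧸ inertiaPerp ℒ V → F := fun χ q => χ.1 q.out
  have hT : ∀ χ z (r : F), T χ z = r • z ↔ ∀ t, φ χ (Θ z t) = r • Θ z (φ χ t) := by
    intro χ z r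
    have h1 : T χ z = r • z ↔ (φ χ).conj (Θ z) = r • Θ z := by
      change Θ.symm ((φ χ).conj (Θ z)) = r • z ↔ _
      rw [AlgEquiv.symm_apply_eq, map_smul]
    rw [h1]
    constructor
    · intro h t
      have := LinearMap.congr_fun h (φ χ t)
      rwa [LinearEquiv.conj_apply_apply, LinearEquiv.symm_apply_apply] at this
    · intro h
      refine LinearMap.ext fun t => ?_
      rw [LinearEquiv.conj_apply_apply, h, LinearEquiv.apply_symm_apply]
      rfl
  have hmem : ∀ (q : G ⧸ inertiaPerp ℒ V) (z : Module.End F V₁ ⊗[F] Module.End F V₂),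
      (∀ χ t, φ χ (Θ z t) = c χ q • Θ z (φ χ t)) → z ∈ tensorGrading
        (coarsen (QuotientAddGroup.mk' (inertiaPerp ℒ V)) (opComponent ℒ V₁))
        (coarsen (QuotientAddGroup.mk' (inertiaPerp ℒ V)) (opComponent ℒ V₂)) q := by
    intro q z hz
    refine mem_of_map_mem hgr.iSup_eq_top
      (iSupIndep_simEigenspace T c fun q q' => exists_apply_ne ℒ) LinearMap.id
      Function.injective_id (fun q z hz χ => ?_) (x := z) fun χ => (hT χ z _).2 (hz χ)
    exact (hT χ z _).2 (tensorEnd_comp_eq_smul ℒ χ.2 (hφ₁ χ) (hφ₂ χ) hz)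
  let j₀ : Module.End F V →ₗ[F] Module.End F (V₁ ⊗[F] V₂) :=
    { toFun := fun S => i ∘ₗ S ∘ₗ p
      map_add' := fun S S' => by ext; simp
      map_smul' := fun r S => by ext; simp }
  have hj₀ : ∀ S t, j₀ S t = i (S (p t)) := fun _ _ => rfl
  let j : Module.End F V →ₙₐ[F] Module.End F V₁ ⊗[F] Module.End F V₂ :=
    { toFun := fun S => Θ.symm (j₀ S)
      map_smul' := fun r S => by simp
      map_zero' := by simp
      map_add' := fun S S' => by simp
      map_mul' := fun S S' => by
        rw [← map_mul]
        congr 1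
        refine LinearMap.ext fun t => ?_
        rw [Module.End.mul_apply, hj₀, hj₀, hj₀, hpi]
        rfl }
  have hj : ∀ S, Θ (j S) = j₀ S := fun S => Θ.apply_symm_apply _
  refine ⟨j, fun S S' h => ?_, fun z => ⟨p ∘ₗ Θ z ∘ₗ i, ?_⟩, fun {q S} hS => ?_⟩
  · refine LinearMap.ext fun a => ?_
    have h1 : j₀ S (i a) = j₀ S' (i a) := by rw [← hj, ← hj, h]
    rw [hj₀, hj₀, hpi] at h1
    have := congrArg p h1
    rwa [hpi, hpi] at this
  · apply Θ.injective
    rw [map_mul, map_mul, hj, hj]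
    refine LinearMap.ext fun t => ?_
    rfl
  · refine hmem q _ fun χ t => ?_
    let ψ : V ≃ₗ[F] V := LinearEquiv.ofLinearMap (p ∘ₗ (φ χ).toLinearMap ∘ₗ i)
      (p ∘ₗ (φ χ).symm.toLinearMap ∘ₗ i)
      (LinearMap.ext fun a => by
        change p (φ χ (i (p ((φ χ).symm (i a))))) = a
        rw [hφe, LinearEquiv.apply_symm_apply, hpi, hpi])
      (LinearMap.ext fun a => by
        change p ((φ χ).symm (i (p (φ χ (i a))))) = a
        rw [← hφe, LinearEquiv.symm_apply_apply, hpi, hpi])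
    have hψ : ∀ a, ψ a = p (φ χ (i a)) := fun _ => rfl
    rw [endGrading_eq_coarsen] at hS
    have hS' := comp_eq_smul_of_mem_coarsen ℒ χ.2 (φ := ψ)
      (fun x a => by rw [hψ, hψ, hi, hφ, hp]) hS
    rw [hj, hj₀, hj₀]
    have h1 : φ χ (i (S (p t))) = i (ψ (S (p t))) := by
      rw [hψ, ← hφe, hpi]
    have h2 : ψ (p t) = p (φ χ t) := by rw [hψ, hφe, hpi]
    rw [h1, hS', h2, map_smul]

end Corner

section Brauer

variable {F : Type*} [Field F]

theorem brauerInvariant_eq_mul [IsAlgClosed F] {L : Type*} [LieRing L] [LieAlgebra F L]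
    {G : Type*} [AddCommGroup G] [DecidableEq G] (ℒ : G → Submodule F L) [GradedLieAlgebra ℒ]
    {V₁ : Type*} [AddCommGroup V₁] [Module F V₁] [LieRingModule L V₁] [LieModule F L V₁]
    {V₂ : Type*} [AddCommGroup V₂] [Module F V₂] [LieRingModule L V₂] [LieModule F L V₂]
    {V : Type*} [AddCommGroup V] [Module F V] [LieRingModule L V] [LieModule F L V]
    [FiniteDimensional F V₁] [FiniteDimensional F V₂] [FiniteDimensional F V]
    (hV₁ : LieModule.IsIrreducible F L V₁) (hV₂ : LieModule.IsIrreducible F L V₂)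
    (hV : LieModule.IsIrreducible F L V)
    (f₁ : G ⧸ inertiaPerp ℒ V₁ →+ G ⧸ inertiaPerp ℒ V)
    (f₂ : G ⧸ inertiaPerp ℒ V₂ →+ G ⧸ inertiaPerp ℒ V)
    (h : GradedCorner (endGrading ℒ V)
      (tensorGrading (coarsen f₁ (endGrading ℒ V₁)) (coarsen f₂ (endGrading ℒ V₂)))) :
    brauerInvariant ℒ V =
      BrauerGroup.map f₁ (brauerInvariant ℒ V₁) * BrauerGroup.map f₂ (brauerInvariant ℒ V₂) := by
  have := LieModule.nontrivial_of_isIrreducible F L V₁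
  have := LieModule.nontrivial_of_isIrreducible F L V₂
  have := LieModule.nontrivial_of_isIrreducible F L V
  have : IsSimpleRing (Module.End F V₁) := isSimpleRing_end
  have : IsSimpleRing (Module.End F V₂) := isSimpleRing_end
  have : IsSimpleRing (Module.End F V) := isSimpleRing_end
  have : Nontrivial (V₁ ⊗[F] V₂) := by
    obtain ⟨a, ha⟩ := exists_ne (0 : V₁)
    obtain ⟨c, hc⟩ := exists_ne (0 : V₂)
    exact ⟨a ⊗ₜ c, 0, tmul_ne_zero ha hc⟩
  have : IsSimpleRing (Module.End F V₁ ⊗[F] Module.End F V₂) :=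
    IsSimpleRing.of_ringEquiv (tensorEnd F V₁ V₂).symm.toRingEquiv isSimpleRing_end
  have hg₁ := isAlgebraGrading_endGrading ℒ V₁ hV₁
  have hg₂ := isAlgebraGrading_endGrading ℒ V₂ hV₂
  have hg := isAlgebraGrading_endGrading ℒ V hV
  obtain ⟨D₁, hD₁⟩ := exists_divisionAlgebra_gradedCorner hg₁
  obtain ⟨D₂, hD₂⟩ := exists_divisionAlgebra_gradedCorner hg₂
  obtain ⟨D, hD⟩ := exists_divisionAlgebra_gradedCorner hg
  obtain ⟨E₁, hE₁⟩ := exists_divisionAlgebra_gradedCorner (D₁.isGrading.coarsen f₁)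
  obtain ⟨E₂, hE₂⟩ := exists_divisionAlgebra_gradedCorner (D₂.isGrading.coarsen f₂)
  have hE := (hE₁.trans (hD₁.coarsen f₁)).tensor (hE₂.trans (hD₂.coarsen f₂))
  have : Nontrivial (E₁.carrier ⊗[F] E₂.carrier) :=
    ⟨1 ⊗ₜ 1, 0, tmul_ne_zero one_ne_zero one_ne_zero⟩
  have : IsSimpleRing (E₁.carrier ⊗[F] E₂.carrier) := by
    obtain ⟨j, hj⟩ := hE
    exact hj.isSimpleRing
  have hgE := E₁.isGrading.tensor E₂.isGrading
  obtain ⟨E, hE'⟩ := exists_divisionAlgebra_gradedCorner hgE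
  have e₁ : BrauerGroup.map f₁ (brauerInvariant ℒ V₁) = Quotient.mk _ E₁ := by
    rw [brauerInvariant, brauerClass_eq_mk hg₁ hD₁]
    exact brauerClass_eq_mk (D₁.isGrading.coarsen f₁) hE₁
  have e₂ : BrauerGroup.map f₂ (brauerInvariant ℒ V₂) = Quotient.mk _ E₂ := by
    rw [brauerInvariant, brauerClass_eq_mk hg₂ hD₂]
    exact brauerClass_eq_mk (D₂.isGrading.coarsen f₂) hE₂
  rw [e₁, e₂, brauerInvariant, brauerClass_eq_mk hg hD]
  refine Eq.trans ?_ (brauerClass_eq_mk hgE hE').symm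
  exact Quotient.sound (gradedIso_of_gradedCorner ((hg₁.coarsen f₁).tensor (hg₂.coarsen f₂))
    (hD.trans h) (hE'.trans hE))

end Brauer

end GradedBrauer

end

theorem mainTheorem3
    {F : Type*} [Field F] [CharZero F] [IsAlgClosed F]
    {L : Type*} [LieRing L] [LieAlgebra F L] [FiniteDimensional F L] [LieAlgebra.IsSemisimple F L]
    {𝔥 : LieSubalgebra F L} [𝔥.IsCartanSubalgebra]
    (b : (LieAlgebra.IsKilling.rootSystem 𝔥).Base)
    {G : Type*} [AddCommGroup G] [DecidableEq G]
    (ℒ : G → Submodule F L) [GradedLieAlgebra ℒ]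
    (lam₁ lam₂ μ : Module.Dual F 𝔥)
    (h₁ : GradedBrauer.IsDominantIntegral b lam₁) (h₂ : GradedBrauer.IsDominantIntegral b lam₂)
    (hμ : μ = lam₁ + lam₂)
    (V₁ : Type*) [AddCommGroup V₁] [Module F V₁] [LieRingModule L V₁] [LieModule F L V₁]
    [FiniteDimensional F V₁] (hV₁ : GradedBrauer.IsSimpleOfHighestWeight b lam₁ V₁)
    (V₂ : Type*) [AddCommGroup V₂] [Module F V₂] [LieRingModule L V₂] [LieModule F L V₂]
    [FiniteDimensional F V₂] (hV₂ : GradedBrauer.IsSimpleOfHighestWeight b lam₂ V₂)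
    (Vμ : Type*) [AddCommGroup Vμ] [Module F Vμ] [LieRingModule L Vμ] [LieModule F L Vμ]
    [FiniteDimensional F Vμ] (hVμ : GradedBrauer.IsSimpleOfHighestWeight b μ Vμ) :
    (GradedBrauer.inertiaPerp ℒ V₁ ≤ GradedBrauer.inertiaPerp ℒ Vμ ↔
      GradedBrauer.inertiaPerp ℒ V₂ ≤ GradedBrauer.inertiaPerp ℒ Vμ) ∧
    ∀ (i₁ : GradedBrauer.inertiaPerp ℒ V₁ ≤ GradedBrauer.inertiaPerp ℒ Vμ)
      (i₂ : GradedBrauer.inertiaPerp ℒ V₂ ≤ GradedBrauer.inertiaPerp ℒ Vμ),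
      GradedBrauer.brauerInvariant ℒ Vμ =
        GradedBrauer.BrauerGroup.map
          (QuotientAddGroup.map _ _ (AddMonoidHom.id G) i₁)
          (GradedBrauer.brauerInvariant ℒ V₁) *
        GradedBrauer.BrauerGroup.map
          (QuotientAddGroup.map _ _ (AddMonoidHom.id G) i₂)
          (GradedBrauer.brauerInvariant ℒ V₂) := by
  have hirr₁ := hV₁.irreducible
  have hirr₂ := hV₂.irreducible
  have hirr := hVμ.irreducible
  obtain ⟨v₁, h10, h1, h1'⟩ := hV₁.exists_vector
  obtain ⟨v₂, h20, h2, h2'⟩ := hV₂.exists_vector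
  obtain ⟨v, h0, h, h'⟩ := hVμ.exists_vector
  subst hμ
  have hv₁ : GradedBrauer.IsHighestWeightVector b lam₁ v₁ := ⟨h10, h1, h1'⟩
  have hv₂ : GradedBrauer.IsHighestWeightVector b lam₂ v₂ := ⟨h20, h2, h2'⟩
  have hv : GradedBrauer.IsHighestWeightVector b (lam₁ + lam₂) v := ⟨h0, h, h'⟩
  refine ⟨?_, fun i₁ i₂ => ?_⟩
  · rw [GradedBrauer.inertiaPerp_le_iff ℒ V₁ hirr₁, GradedBrauer.inertiaPerp_le_iff ℒ V₂ hirr₂]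
    refine ⟨fun hle χ hχ => ?_, fun hle χ hχ => ?_⟩
    · exact GradedBrauer.mem_inertiaGroup_of_tensor ℒ hirr₁ hirr₂ hirr hv₁ hv₂ hv (hle hχ) hχ
    · rw [add_comm] at hv
      exact GradedBrauer.mem_inertiaGroup_of_tensor ℒ hirr₂ hirr₁ hirr hv₂ hv₁ hv (hle hχ) hχ
  · obtain ⟨i, p, hi, hp, hpi, hcomm⟩ := GradedBrauer.exists_splitting
      ((hv₁.isTop hirr₁).tmul (hv₂.isTop hirr₂)) (hv₁.tmul hv₂) hirr hv
    refine GradedBrauer.brauerInvariant_eq_mul ℒ hirr₁ hirr₂ hirr _ _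
      (GradedBrauer.gradedCorner_endGrading ℒ hirr₁ hirr₂ i₁ i₂ i p hi hp hpi fun χ φ hφ => ?_)
    exact hcomm φ.toLinearMap (GradedBrauer.casimir_apply_of_equiv
      (GradedBrauer.charEquiv ℒ χ) φ.toLinearMap hφ)
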